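/- Let $d\ge 2$ and let $P,Q,R\in\mathbb C[z,w]$ be homogeneous of degree $d$, with $(0,0)$ the only common zero of $P$ and $Q$. For $\varepsilon\in\mathbb C$ let $f=f_\varepsilon$ be the endomorphism $[z:w:t]\mapsto[P(z,w):Q(z,w):t^d+\varepsilon R(z,w)]$ of $\mathbb P^2$, let $f_\infty:[z:w]\mapsto[P(z,w):Q(z,w)]$ on $\mathbb P^1$ and $f_\infty^+:[z:w]\mapsto[P(z,w):Q(z,w):R(z,w)]$ from $\mathbb P^1$ to $\mathbb P^2$. For $\rho>0$ put $U_\rho=\{[z:w:t]\in\mathbb P^2:\ |t|<\rho\max(|z|,|w|)\}$. Let $X_{-1}\subset\mathbb P^1\times\mathbb P^1$ be the set of the pairs $(p,q)$ with $p\ne q$ and $f_\infty^+(p)=f_\infty^+(q)$, together with the pairs $(p,p)$ where $p$ is a critical point of $f_\infty$. Let $Y_{-2}\subset\mathbb P^1\times\mathbb P^1$ be the set of the pairs $([u],[v])$, $u,v\in\mathbb C^2\setminus\{0\}$, such that $P(u)=P(v)$, $Q(u)=Q(v)$ and $R(u)=\zeta R(v)$ for some $\zeta\in\mathbb C$ with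 $\zeta^d=1$, $\zeta\neq1$ (this contains the pairs $(p,p)$ with $R(p)=0$). With $\mathrm{pr}_1$ the first projection, put $X=f_\infty(\mathrm{pr}_1(X_{-1}))$, $Y=f_\infty^2(\mathrm{pr}_1(Y_{-2}))$ and $Z=X\cup Y$. Definitions. A trapping region of an endomorphism $g$ of $\mathbb P^2$ is an open set $U$ such that $g(U)$ is relatively compact in $U$; its attracting set is $\mathscr A=\bigcap_{n\ge0}g^n(U)$. The set $\mathscr A$ is of dimension $s$ if it supports a nonzero positive closed current of bidimension $(s,s)$ but none of bidimension $(l,l)$ with $l>s$. If $g$ has algebraic degree $\delta$, then $g$ is of small topological degree on $U$ if $U$ is a trapping region of $g$, its attracting set has some dimension $s$, and every point of $g(U)$ has strictly fewer than $\delta^{s}$ preimages under $g$ in $U$. **Proposition.** Suppose that $X\cap Y=\emptyset$ and $f_\infty^{-2}(Z)\cap f_\infty^{-1}(Z)\cap Z=\emptyset$. Then there is $\varepsilon_0>0$ such that for every $\varepsilon\in\mathbb C$ with $0<|\varepsilon|<\varepsilon_0$ there is $\rho>0$ such that $U_\rho$ is a trapping region of $f=f_\varepsilon$ and $f^3$ is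 of small topological degree on $f(U_\rho)$. -/

import Mathlib

open scoped LinearAlgebra.Projectivization ContDiff

noncomputable section

namespace SmallDegree

/-! ### Complex projective spaces and their endomorphisms -/

/-- The complex vector space `ℂⁿ`. -/
abbrev CV (n : ℕ) : Type := Fin n → ℂ

/-- The complex projective space `ℙ(ℂⁿ)`, of dimension `n - 1`. -/
abbrev PS (n : ℕ) : Type := ℙ ℂ (CV n)

/-- The quotient topology of projective space. -/
instance instTopologicalSpacePS (n : ℕ) : TopologicalSpace (PS n) :=
  TopologicalSpace.coinduced
    (fun v : {v : CV n // v ≠ 0} => Projectivization.mk ℂ v.1 v.2) inferInstance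

theorem eval_smul_of_isHomogeneous {n d : ℕ} {F : MvPolynomial (Fin n) ℂ}
    (hF : F.IsHomogeneous d) (t : ℂ) (v : CV n) :
    MvPolynomial.eval (t • v) F = t ^ d * MvPolynomial.eval v F := by
  rw [MvPolynomial.eval_eq, MvPolynomial.eval_eq, Finset.mul_sum]
  refine Finset.sum_congr rfl fun m hm => ?_
  have h1 : ∑ i ∈ m.support, m i = d := by
    have := hF (MvPolynomial.mem_support_iff.1 hm)
    change Finsupp.weight (fun _ => 1) m = d at this
    rwa [← Finsupp.degree_eq_weight_one, Finsupp.degree_apply] at this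
  simp only [Pi.smul_apply, smul_eq_mul, mul_pow, Finset.prod_mul_distrib,
    Finset.prod_pow_eq_pow_sum, h1]
  ring

/-- The map `[x] ↦ [F₁(x) : ⋯ : Fₘ(x)]` given by homogeneous polynomials of the same degree
without a common zero outside the origin. -/
def projMap {n m d : ℕ} (F : Fin m → MvPolynomial (Fin n) ℂ)
    (hF : ∀ i, (F i).IsHomogeneous d)
    (h0 : ∀ x : CV n, (∀ i, MvPolynomial.eval x (F i) = 0) → x = 0) : PS n → PS m :=
  Projectivization.lift
    (fun v => Projectivization.mk ℂ (fun i => MvPolynomial.eval v.1 (F i))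
      (fun h => v.2 (h0 v.1 fun i => congrFun h i)))
    (by
      intro a b t hab
      rw [Projectivization.mk_eq_mk_iff']
      refine ⟨t ^ d, ?_⟩
      funext i
      rw [hab, eval_smul_of_isHomogeneous (hF i)]
      rfl)

theorem projMap_mk {n m d : ℕ} (F : Fin m → MvPolynomial (Fin n) ℂ)
    (hF : ∀ i, (F i).IsHomogeneous d)
    (h0 : ∀ x : CV n, (∀ i, MvPolynomial.eval x (F i) = 0) → x = 0) (v : CV n) (hv : v ≠ 0) :
    projMap F hF h0 (Projectivization.mk ℂ v hv) =
      Projectivization.mk ℂ (fun i => MvPolynomial.eval v (F i))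
        (fun h => hv (h0 v fun i => congrFun h i)) := rfl

/-- `g` is a (holomorphic) endomorphism of projective space of algebraic degree `δ`. -/
def IsEndomorphism {n : ℕ} (g : PS n → PS n) (δ : ℕ) : Prop :=
  ∃ (F : Fin n → MvPolynomial (Fin n) ℂ) (hF : ∀ i, (F i).IsHomogeneous δ)
    (h0 : ∀ x : CV n, (∀ i, MvPolynomial.eval x (F i) = 0) → x = 0), g = projMap F hF h0

/-! ### Trapping regions and attracting sets -/

/-- `U` is open and `g(U)` is relatively compact in `U`. -/
def IsTrappingRegion {n : ℕ} (g : PS n → PS n) (U : Set (PS n)) : Prop :=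
  IsOpen U ∧ IsCompact (closure (g '' U)) ∧ closure (g '' U) ⊆ U

/-- The attracting set `⋂ₙ gⁿ(U)` of a trapping region `U`. -/
def attractingSet {n : ℕ} (g : PS n → PS n) (U : Set (PS n)) : Set (PS n) :=
  ⋂ k : ℕ, g^[k] '' U

/-! ### Positive closed currents on `ℙ²` -/

/-- The real vector space of smooth real differential `r`-forms on `ℙ²`. A form on `ℙ²` is
identified with its pull-back to `ℂ³ ∖ {0}` by the principal `ℂˣ`-bundle `ℂ³ ∖ {0} → ℙ²`; the
pull-backs are exactly the smooth forms that are killed by the vectors tangent to the fibres and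
invariant under the dilations `z ↦ c z`. The irrelevant value at the origin is set to `0`. -/
def smoothForms (r : ℕ) : Submodule ℝ (CV 3 → CV 3 [⋀^Fin r]→L[ℝ] ℝ) where
  carrier := {φ | φ 0 = 0 ∧ ContDiffOn ℝ ∞ φ {0}ᶜ ∧
    (∀ z ≠ 0, ∀ v : Fin r → CV 3, (∃ i, ∃ c : ℂ, v i = c • z) → φ z v = 0) ∧
    (∀ z ≠ 0, ∀ c : ℂ, c ≠ 0 → ∀ v : Fin r → CV 3, φ (c • z) (fun i => c • v i) = φ z v)}
  add_mem' := by
    rintro φ ψ ⟨a0, a1, a2, a3⟩ ⟨b0, b1, b2, b3⟩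
    refine ⟨by simp [a0, b0], a1.add b1, fun z hz v hv => ?_, fun z hz c hc v => ?_⟩
    · simp [a2 z hz v hv, b2 z hz v hv]
    · simp [a3 z hz c hc v, b3 z hz c hc v]
  zero_mem' := by
    refine ⟨rfl, contDiffOn_const, fun z hz v hv => ?_, fun z hz c hc v => ?_⟩ <;> simp
  smul_mem' := by
    rintro a φ ⟨a0, a1, a2, a3⟩
    refine ⟨by simp [a0], a1.const_smul a, fun z hz v hv => ?_, fun z hz c hc v => ?_⟩
    · simp [a2 z hz v hv]
    · simp [a3 z hz c hc v]

/-- The `2p`-tuple `(v₁, i v₁, …, vₚ, i vₚ)`. -/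
def complexTuple {p : ℕ} (v : Fin p → CV 3) : Fin (2 * p) → CV 3 := fun i =>
  (if i.val % 2 = 0 then (1 : ℂ) else Complex.I) • v ⟨i.val / 2, by omega⟩

/-- Continuity of a linear functional on the forms for the `C^∞` topology: it is bounded by a
`C^N` norm for some `N`. By homogeneity it is enough to take the suprema over a sphere. -/
def IsContinuousFunctional {r : ℕ} (T : smoothForms r →ₗ[ℝ] ℝ) : Prop :=
  ∃ (N : ℕ) (C : ℝ), ∀ (φ : smoothForms r) (M : ℝ),
    (∀ j ≤ N, ∀ z : CV 3, ‖z‖ = 1 → ‖iteratedFDeriv ℝ j φ.1 z‖ ≤ M) → |T φ| ≤ C * M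

/-- Positivity: `T` is nonnegative on every `2p`-form whose values on the tuples
`(v₁, i v₁, …, vₚ, i vₚ)` are nonnegative. Only the component of bidegree `(p, p)` of a form
contributes to these values, so `T` vanishes on the other components, which means that `T` is of
bidimension `(p, p)`. (On a complex surface all usual notions of positivity agree.) -/
def IsPositiveFunctional {p : ℕ} (T : smoothForms (2 * p) →ₗ[ℝ] ℝ) : Prop :=
  ∀ φ : smoothForms (2 * p),
    (∀ z ≠ 0, ∀ v : Fin p → CV 3, 0 ≤ φ.1 z (complexTuple v)) → 0 ≤ T φ

/-- Closedness: `T` vanishes on exact forms. -/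
def IsClosedFunctional : {p : ℕ} → (smoothForms (2 * p) →ₗ[ℝ] ℝ) → Prop
  | 0, _ => True
  | q + 1, T => ∀ (ψ : smoothForms (2 * q + 1)) (φ : smoothForms (2 * q + 1 + 1)),
      (∀ z ≠ 0, φ.1 z = extDeriv ψ.1 z) → T φ = 0

/-- A positive closed current of bidimension `(p, p)` on `ℙ²`. -/
structure IsPositiveClosedCurrent {p : ℕ} (T : smoothForms (2 * p) →ₗ[ℝ] ℝ) : Prop where
  continuous : IsContinuousFunctional T
  positive : IsPositiveFunctional T
  closed : IsClosedFunctional T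

/-- The (closed) set `A` contains the support of `T`: `T` vanishes on the forms that vanish in a
neighbourhood of `A`. -/
def IsSupportedIn {r : ℕ} (T : smoothForms r →ₗ[ℝ] ℝ) (A : Set (PS 3)) : Prop :=
  ∀ φ : smoothForms r,
    (∃ V : Set (PS 3), IsOpen V ∧ A ⊆ V ∧
      ∀ (z : CV 3) (hz : z ≠ 0), Projectivization.mk ℂ z hz ∈ V → φ.1 z = 0) → T φ = 0

/-- `A` supports a (nonzero) positive closed current of bidimension `(p, p)`. -/
def SupportsCurrent (A : Set (PS 3)) (p : ℕ) : Prop :=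
  ∃ T : smoothForms (2 * p) →ₗ[ℝ] ℝ, IsPositiveClosedCurrent T ∧ IsSupportedIn T A ∧ T ≠ 0

/-- An attracting set `A ⊆ ℙ²` is of dimension `s`: it supports a positive closed current of
bidimension `(s, s)` but none of bidimension `(l, l)` with `l > s` (bidimensions in `ℙ²` are at
most `(2, 2)`). -/
def HasDimension (A : Set (PS 3)) (s : ℕ) : Prop :=
  s ≤ 2 ∧ SupportsCurrent A s ∧ ∀ l, s < l → l ≤ 2 → ¬ SupportsCurrent A l

/-! ### Small topological degree -/

/-- The endomorphism `g` of `ℙ²`, of algebraic degree `δ`, is of small topological degree on `U`: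
`U` is a trapping region whose attracting set has dimension `s`, and every point of `g(U)` has
strictly less than `δ ^ s` preimages in `U`. -/
def IsOfSmallTopologicalDegreeOn (g : PS 3 → PS 3) (U : Set (PS 3)) : Prop :=
  ∃ δ s : ℕ, IsEndomorphism g δ ∧ IsTrappingRegion g U ∧ HasDimension (attractingSet g U) s ∧
    ∀ p ∈ g '' U, (g ⁻¹' {p} ∩ U).encard < ((δ ^ s : ℕ) : ℕ∞)

/-! ### The triples `(P, Q, R)` and the maps they define -/

/-- A triple `(P, Q, R)` of homogeneous polynomials of degree `d` in two variables such that
`(0, 0)` is the single common zero of `P` and `Q`. -/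
structure HomTriple (d : ℕ) where
  P : MvPolynomial (Fin 2) ℂ
  Q : MvPolynomial (Fin 2) ℂ
  R : MvPolynomial (Fin 2) ℂ
  homP : P.IsHomogeneous d
  homQ : Q.IsHomogeneous d
  homR : R.IsHomogeneous d
  common_zero : ∀ x : CV 2, MvPolynomial.eval x P = 0 → MvPolynomial.eval x Q = 0 → x = 0

namespace HomTriple

variable {d : ℕ} (T : HomTriple d)

/-- `f_∞ : [z : w] ↦ [P(z, w) : Q(z, w)]` on `ℙ¹`. -/
def fInf : PS 2 → PS 2 :=
  projMap (d := d) ![T.P, T.Q]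
    (by intro i; fin_cases i; exacts [T.homP, T.homQ])
    (fun x hx => T.common_zero x (hx 0) (hx 1))

/-- `f_∞⁺ : [z : w] ↦ [P(z, w) : Q(z, w) : R(z, w)]` from `ℙ¹` to `ℙ²`. -/
def fInfPlus : PS 2 → PS 3 :=
  projMap (d := d) ![T.P, T.Q, T.R]
    (by intro i; fin_cases i; exacts [T.homP, T.homQ, T.homR])
    (fun x hx => T.common_zero x (hx 0) (hx 1))

/-- The three polynomials `P(z, w)`, `Q(z, w)`, `t ^ d + ε R(z, w)` in the variables `z, w, t`. -/
def poly (ε : ℂ) : Fin 3 → MvPolynomial (Fin 3) ℂ :=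
  ![MvPolynomial.rename Fin.castSucc T.P, MvPolynomial.rename Fin.castSucc T.Q,
    MvPolynomial.X 2 ^ d + MvPolynomial.C ε * MvPolynomial.rename Fin.castSucc T.R]

theorem poly_isHomogeneous (ε : ℂ) (i : Fin 3) : (T.poly ε i).IsHomogeneous d := by
  fin_cases i
  · exact T.homP.rename_isHomogeneous
  · exact T.homQ.rename_isHomogeneous
  · refine MvPolynomial.IsHomogeneous.add ?_ ?_
    · simpa using (MvPolynomial.isHomogeneous_X ℂ (2 : Fin 3)).pow d
    · simpa using (MvPolynomial.isHomogeneous_C (Fin 3) ε).mul T.homR.rename_isHomogeneous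

theorem poly_common_zero (hd : d ≠ 0) (ε : ℂ) (x : CV 3)
    (hx : ∀ i, MvPolynomial.eval x (T.poly ε i) = 0) : x = 0 := by
  have h0 := hx 0
  have h1 := hx 1
  have h2 := hx 2
  simp only [poly, Matrix.cons_val_zero, Matrix.cons_val_one, Matrix.cons_val,
    MvPolynomial.eval_rename, map_add, map_mul, map_pow, MvPolynomial.eval_X,
    MvPolynomial.eval_C] at h0 h1 h2
  have hz := T.common_zero _ h0 h1
  have hR : MvPolynomial.eval (x ∘ Fin.castSucc) T.R = 0 := by
    have := eval_smul_of_isHomogeneous T.homR 0 (x ∘ Fin.castSucc)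
    rw [zero_smul, zero_pow hd, zero_mul] at this
    rw [hz, this]
  rw [hR, mul_zero, add_zero] at h2
  funext i
  fin_cases i
  · exact congrFun hz 0
  · exact congrFun hz 1
  · exact eq_zero_of_pow_eq_zero h2

/-- `f : [z : w : t] ↦ [P(z, w) : Q(z, w) : t ^ d + ε R(z, w)]` on `ℙ²`. -/
def f (hd : d ≠ 0) (ε : ℂ) : PS 3 → PS 3 :=
  projMap (T.poly ε) (T.poly_isHomogeneous ε) (T.poly_common_zero hd ε)

/-- The critical points of `f_∞`. At `[u]`, the differential of `f_∞` is the map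
`ℂ² / ℂ u → ℂ² / ℂ (P, Q)(u)` induced by the Jacobian matrix of `(P, Q)` at `u`, which maps `u`
to `d (P, Q)(u)`; so it vanishes if and only if the Jacobian determinant does. -/
def critical : Set (PS 2) :=
  {p | ∃ (u : CV 2) (hu : u ≠ 0), p = Projectivization.mk ℂ u hu ∧
    MvPolynomial.eval u (MvPolynomial.pderiv 0 T.P * MvPolynomial.pderiv 1 T.Q -
      MvPolynomial.pderiv 1 T.P * MvPolynomial.pderiv 0 T.Q) = 0}

/-- `X₋₁`: the pairs of distinct points with the same image by `f_∞⁺`, and the pairs `(p, p)`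
where `p` is a critical point of `f_∞`. -/
def Xm1 : Set (PS 2 × PS 2) :=
  {pq | pq.1 ≠ pq.2 ∧ T.fInfPlus pq.1 = T.fInfPlus pq.2} ∪
    {pq | pq.1 = pq.2 ∧ pq.1 ∈ T.critical}

/-- `Y₋₂`: the pairs `([u], [v])`, where `u` and `v` are normalized so that
`(P, Q)(u) = (P, Q)(v)`, such that `R(u) = ζ R(v)` for some `d`-th root of unity `ζ ≠ 1`.
For `[u] = [v]` this says that `R(u) = 0`. -/
def Ym2 : Set (PS 2 × PS 2) :=
  {pq | ∃ (u v : CV 2) (hu : u ≠ 0) (hv : v ≠ 0),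
    pq = (Projectivization.mk ℂ u hu, Projectivization.mk ℂ v hv) ∧
    MvPolynomial.eval u T.P = MvPolynomial.eval v T.P ∧
    MvPolynomial.eval u T.Q = MvPolynomial.eval v T.Q ∧
    ∃ ζ : ℂ, ζ ^ d = 1 ∧ ζ ≠ 1 ∧ MvPolynomial.eval u T.R = ζ * MvPolynomial.eval v T.R}

/-- `X = f_∞(pr₁(X₋₁))`. -/
def X : Set (PS 2) := T.fInf '' (Prod.fst '' T.Xm1)

/-- `Y = f_∞²(pr₁(Y₋₂))`. -/
def Y : Set (PS 2) := T.fInf^[2] '' (Prod.fst '' T.Ym2)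

/-- `Z = X ∪ Y`. -/
def Z : Set (PS 2) := T.X ∪ T.Y

end HomTriple

/-- `U_ρ = {[z : w : t] ; |t| < ρ max(|z|, |w|)}`. -/
def regionU (ρ : ℝ) : Set (PS 3) :=
  {p | ∃ (x : CV 3) (hx : x ≠ 0), p = Projectivization.mk ℂ x hx ∧
    ‖x 2‖ < ρ * max ‖x 0‖ ‖x 1‖}

end SmallDegree

end

/-!
Near the line `{t = 0}` the map `f` sends `[z : w : t]` within `O(ρᵈ)` of the point
`[P(z, w) : Q(z, w) : ε R(z, w)]`. With `ρ` a large multiple of `‖ε‖` the region `U = regionU ρ` is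
mapped into `regionU (ρ / 2)`, and the error `O(ρᵈ)` is much smaller than `‖ε‖`.

**Fibres.** Two points of `f(U)` with the same image `p` either have almost the same image by
`f_∞⁺`, or lie on one line through `[0 : 0 : 1]` and then come from two points of `U` whose values
of `R` differ almost by a factor `ζ ≠ 1` with `ζᵈ = 1`. This puts `p` close to `X`, respectively to
`Y`, in terms of the homogeneous lifts. By compactness the hypotheses on `X`, `Y` and `Z` persist
for `η`-neighbourhoods when `η` is small. So `p` has at most `d` preimages in `f(U)`, and at most
one if it is away from `Z`. Among three consecutive points of an orbit one is away from `Z`, whence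
at most `d²` preimages under `f³`, and `d² < d³`.

**Dimension.** The attracting set supports a current of bidimension `(1, 1)`: any cluster value of
the push-forwards, divided by their mass, of the current of integration on the line `{t = 0}`. The
masses are controlled because `f^* ω - d ω` is exact for the Fubini–Study form `ω`. It supports none
of bidimension `(2, 2)`: a form of top degree is dominated by bump forms in the affine charts, and
on `U` each bump form vanishes or coincides with the exterior derivative of a compactly supported
form, since its cut-off function is constant there in the direction transverse to the line.
-/

noncomputable section

namespace SmallDegree

open Filter Topology MeasureTheory

/-! ### The topology of projective space -/

theorem isOpenQuotientMap_mk' (n : ℕ) :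
    IsOpenQuotientMap (Projectivization.mk' ℂ : {v : CV n // v ≠ 0} → PS n) := by
  have hcont : Continuous (Projectivization.mk' ℂ : {v : CV n // v ≠ 0} → PS n) :=
    continuous_coinduced_rng
  refine ⟨fun p => p.ind fun v hv => ⟨⟨v, hv⟩, rfl⟩, hcont, fun U hU => ?_⟩
  let scale (t : ℂˣ) (v : {v : CV n // v ≠ 0}) : {v : CV n // v ≠ 0} :=
    ⟨t • v.1, (smul_ne_zero_iff_ne t).2 v.2⟩
  have hscale (t : ℂˣ) : Continuous (scale t) :=
    (continuous_subtype_val.const_smul (t : ℂ)).subtype_mk _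
  have hsat : (Projectivization.mk' ℂ) ⁻¹' (Projectivization.mk' ℂ '' U) =
      ⋃ t : ℂˣ, scale t ⁻¹' U := by
    ext v
    simp only [Set.mem_preimage, Set.mem_image, Set.mem_iUnion]
    constructor
    · rintro ⟨w, hw, hwv⟩
      obtain ⟨t, ht⟩ := (Projectivization.mk_eq_mk_iff ..).1 hwv
      exact ⟨t, by rwa [show scale t v = w from Subtype.ext ht]⟩
    · rintro ⟨t, ht⟩
      exact ⟨scale t v, ht, (Projectivization.mk_eq_mk_iff ..).2 ⟨t, rfl⟩⟩
  exact isOpen_coinduced.2 (hsat ▸ isOpen_iUnion fun t => hU.preimage (hscale t))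

/-- The cone over a subset of projective space, with the origin removed: the set of homogeneous
coordinates of its points. -/
def cone {n : ℕ} (U : Set (PS n)) : Set (CV n) :=
  {v | ∃ h : v ≠ 0, Projectivization.mk ℂ v h ∈ U}

theorem isOpen_cone_iff {n : ℕ} {U : Set (PS n)} : IsOpen (cone U) ↔ IsOpen U := by
  have hcone : cone U = Subtype.val '' (Projectivization.mk' ℂ ⁻¹' U) := by
    ext v
    simp [cone]
  have hopen : IsOpen {v : CV n | v ≠ 0} := isOpen_compl_singleton
  rw [hcone]
  exact hopen.isOpenEmbedding_subtypeVal.isOpen_iff_image_isOpen.symm.trans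
    (isOpenQuotientMap_mk' n).isQuotientMap.isOpen_preimage

theorem continuous_projMap {n m d : ℕ} (F : Fin m → MvPolynomial (Fin n) ℂ)
    (hF : ∀ i, (F i).IsHomogeneous d)
    (h0 : ∀ x : CV n, (∀ i, MvPolynomial.eval x (F i) = 0) → x = 0) :
    Continuous (projMap F hF h0) := by
  have hlift : Continuous fun v : {v : CV n // v ≠ 0} =>
      (⟨fun i => MvPolynomial.eval v.1 (F i), fun h => v.2 (h0 v.1 fun i => congrFun h i)⟩ :
        {v : CV m // v ≠ 0}) :=
    (continuous_pi fun i =>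
      (MvPolynomial.continuous_eval (F i)).comp continuous_subtype_val).subtype_mk _
  exact continuous_coinduced_dom.2 ((isOpenQuotientMap_mk' m).continuous.comp hlift)

theorem exists_norm_eq_one_mk_eq {n : ℕ} (p : PS n) :
    ∃ (v : CV n) (h : v ≠ 0), ‖v‖ = 1 ∧ Projectivization.mk ℂ v h = p := by
  induction p using Projectivization.ind with
  | h v hv =>
    have hnorm : (‖v‖ : ℂ) ≠ 0 := by exact_mod_cast norm_ne_zero_iff.2 hv
    exact ⟨(‖v‖ : ℂ)⁻¹ • v, smul_ne_zero (inv_ne_zero hnorm) hv, norm_smul_inv_norm hv,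
      (Projectivization.mk_eq_mk_iff' ..).2 ⟨_, rfl⟩⟩

instance instCompactSpacePS (n : ℕ) : CompactSpace (PS n) := by
  have : CompactSpace (Metric.sphere (0 : CV n) 1) :=
    isCompact_iff_compactSpace.1 (isCompact_sphere 0 1)
  let g (v : Metric.sphere (0 : CV n) 1) : PS n :=
    Projectivization.mk' ℂ ⟨v.1, ne_zero_of_mem_unit_sphere v⟩
  have hg : Continuous g :=
    (isOpenQuotientMap_mk' n).continuous.comp (continuous_subtype_val.subtype_mk _)
  have hsurj : Function.Surjective g := fun p => by
    obtain ⟨v, -, hv, rfl⟩ := exists_norm_eq_one_mk_eq p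
    exact ⟨⟨v, mem_sphere_zero_iff_norm.2 hv⟩, rfl⟩
  exact hsurj.compactSpace hg

theorem mk_eq_mk_iff_mul_eq_mul {ι K : Type*} [Field K] {v w : ι → K} (hv : v ≠ 0) (hw : w ≠ 0) :
    Projectivization.mk K v hv = Projectivization.mk K w hw ↔ ∀ i j, v i * w j = v j * w i := by
  rw [Projectivization.mk_eq_mk_iff']
  constructor
  · rintro ⟨a, rfl⟩ i j
    simp only [Pi.smul_apply, smul_eq_mul]
    ring
  · intro h
    obtain ⟨j, hj⟩ := Function.ne_iff.1 hw
    refine ⟨v j / w j, funext fun i => ?_⟩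
    rw [Pi.smul_apply, smul_eq_mul, div_mul_eq_mul_div, ← h i j]
    exact mul_div_cancel_right₀ (v i) hj

instance instT2SpacePS (n : ℕ) : T2Space (PS n) := by
  rw [t2Space_iff_of_isOpenQuotientMap (isOpenQuotientMap_mk' n)]
  simp only [Projectivization.mk'_eq_mk, mk_eq_mk_iff_mul_eq_mul, Set.ofPred_forall]
  have hcoord (k : Fin n) : Continuous fun v : {v : CV n // v ≠ 0} => v.1 k :=
    (continuous_apply k).comp continuous_subtype_val
  exact isClosed_iInter fun i => isClosed_iInter fun j => isClosed_eq
    (((hcoord i).comp continuous_fst).mul ((hcoord j).comp continuous_snd))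
    (((hcoord j).comp continuous_fst).mul ((hcoord i).comp continuous_snd))

/-! ### Homogeneous maps -/

section HomogeneousMap

variable {V E : Type*} [NormedAddCommGroup V] [NormedSpace ℂ V] [NormedAddCommGroup E]
  [NormedSpace ℂ E] {d : ℕ} {g : V → E}

theorem map_zero_of_homogeneous (hd : d ≠ 0) (hg : ∀ (t : ℂ) v, g (t • v) = t ^ d • g v) :
    g 0 = 0 := by
  simpa [hd] using hg 0 0

theorem norm_map_eq_of_homogeneous (hg : ∀ (t : ℂ) v, g (t • v) = t ^ d • g v) {v : V}
    (hv : v ≠ 0) : ‖g v‖ = ‖v‖ ^ d * ‖g ((‖v‖ : ℂ)⁻¹ • v)‖ := by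
  have hnorm : (‖v‖ : ℂ) ≠ 0 := by exact_mod_cast norm_ne_zero_iff.2 hv
  conv_lhs => rw [← smul_inv_smul₀ hnorm v, hg, norm_smul, norm_pow, Complex.norm_real, norm_norm]

variable [ProperSpace V]

theorem exists_pos_forall_norm_map_le_of_homogeneous (hd : d ≠ 0) (hcont : Continuous g)
    (hg : ∀ (t : ℂ) v, g (t • v) = t ^ d • g v) :
    ∃ C : ℝ, 0 < C ∧ ∀ v, ‖g v‖ ≤ C * ‖v‖ ^ d := by
  obtain ⟨C, hC⟩ := ((isCompact_sphere (0 : V) 1).image hcont).isBounded.exists_norm_le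
  refine ⟨max C 1, lt_max_of_lt_right one_pos, fun v => ?_⟩
  rcases eq_or_ne v 0 with rfl | hv
  · simp [map_zero_of_homogeneous hd hg, hd]
  · have hunit : ‖g ((‖v‖ : ℂ)⁻¹ • v)‖ ≤ C :=
      hC _ (Set.mem_image_of_mem g (mem_sphere_zero_iff_norm.2 (norm_smul_inv_norm hv)))
    rw [norm_map_eq_of_homogeneous hg hv, mul_comm]
    gcongr
    exact hunit.trans (le_max_left _ _)

theorem exists_pos_forall_le_norm_map_of_homogeneous (hd : d ≠ 0) (hcont : Continuous g)
    (hg : ∀ (t : ℂ) v, g (t • v) = t ^ d • g v) (h0 : ∀ v, g v = 0 → v = 0) :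
    ∃ c : ℝ, 0 < c ∧ ∀ v, c * ‖v‖ ^ d ≤ ‖g v‖ := by
  obtain ⟨c, hc, hsphere⟩ : ∃ c : ℝ, 0 < c ∧ ∀ v ∈ Metric.sphere (0 : V) 1, c ≤ ‖g v‖ :=
    (isCompact_sphere (0 : V) 1).exists_forall_le' hcont.norm.continuousOn fun v hv =>
      norm_pos_iff.2 fun h => ne_zero_of_mem_unit_sphere ⟨v, hv⟩ (h0 v h)
  refine ⟨c, hc, fun v => ?_⟩
  rcases eq_or_ne v 0 with rfl | hv
  · simp [hd]
  · rw [norm_map_eq_of_homogeneous hg hv, mul_comm]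
    gcongr
    exact hsphere _ (mem_sphere_zero_iff_norm.2 (norm_smul_inv_norm hv))

theorem isProperMap_of_homogeneous (hd : d ≠ 0) (hcont : Continuous g)
    (hg : ∀ (t : ℂ) v, g (t • v) = t ^ d • g v) (h0 : ∀ v, g v = 0 → v = 0) :
    IsProperMap g := by
  obtain ⟨c, hc, hle⟩ := exists_pos_forall_le_norm_map_of_homogeneous hd hcont hg h0
  rw [isProperMap_iff_tendsto_cocompact]
  refine ⟨hcont, ?_⟩
  have hpow : Tendsto (fun v : V => c * ‖v‖ ^ d) (cocompact V) atTop :=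
    ((tendsto_pow_atTop hd).comp tendsto_norm_cocompact_atTop).const_mul_atTop hc
  exact tendsto_norm_atTop_iff_cobounded.1 (tendsto_atTop_mono hle hpow) |>.mono_right
    Metric.cobounded_le_cocompact

/-- By dilation it is enough to look at the unit sphere, which is compact. -/
theorem exists_pos_forall_not_of_forall_nhds {N : ℝ → V → Prop}
    (hmono : ∀ ⦃η η' b⦄, η ≤ η' → N η b → N η' b)
    (hsmul : ∀ ⦃η b⦄ ⦃c : ℂ⦄, c ≠ 0 → N η b → N η (c • b))
    (hloc : ∀ b : V, b ≠ 0 → ∃ η > 0, ∀ᶠ b' in 𝓝 b, ¬ N η b') :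
    ∃ η > 0, ∀ b : V, b ≠ 0 → ¬ N η b := by
  obtain ⟨η, hη, hsphere⟩ : ∃ η > 0, ∀ b ∈ Metric.sphere (0 : V) 1, ¬ N η b := by
    refine (isCompact_sphere (0 : V) 1).induction_on (p := fun s => ∃ η > 0, ∀ b ∈ s, ¬ N η b)
      ⟨1, one_pos, by simp⟩ ?_ ?_ ?_
    · rintro s t hst ⟨η, hη, h⟩
      exact ⟨η, hη, fun b hb => h b (hst hb)⟩
    · rintro s t ⟨η, hη, h⟩ ⟨η', hη', h'⟩
      refine ⟨min η η', lt_min hη hη', ?_⟩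
      rintro b (hb | hb) hN
      · exact h b hb (hmono (min_le_left _ _) hN)
      · exact h' b hb (hmono (min_le_right _ _) hN)
    · intro b hb
      obtain ⟨η, hη, h⟩ := hloc b (ne_zero_of_mem_unit_sphere ⟨b, hb⟩)
      exact ⟨_, mem_nhdsWithin_of_mem_nhds h, η, hη, fun _ h => h⟩
  refine ⟨η, hη, fun b hb hN => ?_⟩
  have hnorm : (‖b‖ : ℂ) ≠ 0 := by exact_mod_cast norm_ne_zero_iff.2 hb
  exact hsphere _ (mem_sphere_zero_iff_norm.2 (norm_smul_inv_norm hb))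
    (hsmul (inv_ne_zero hnorm) hN)

end HomogeneousMap

theorem hasStrictFDerivAt_eval {σ 𝕜 : Type*} [Fintype σ] [NontriviallyNormedField 𝕜]
    (F : MvPolynomial σ 𝕜) (u : σ → 𝕜) :
    HasStrictFDerivAt (fun v : σ → 𝕜 => MvPolynomial.eval v F)
      (∑ i, MvPolynomial.eval u (MvPolynomial.pderiv i F) •
        (ContinuousLinearMap.proj i : (σ → 𝕜) →L[𝕜] 𝕜)) u := by
  classical
  induction F using MvPolynomial.induction_on with
  | C a =>
    simp only [MvPolynomial.eval_C]
    exact (hasStrictFDerivAt_const a u).congr_fderiv (ContinuousLinearMap.ext fun v => by simp)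
  | add p q hp hq =>
    simp only [map_add]
    exact (hp.fun_add hq).congr_fderiv
      (ContinuousLinearMap.ext fun v => by simp [add_mul, Finset.sum_add_distrib])
  | mul_X p i hp =>
    have hX : HasStrictFDerivAt (fun v : σ → 𝕜 => v i)
        (ContinuousLinearMap.proj i : (σ → 𝕜) →L[𝕜] 𝕜) u :=
      (ContinuousLinearMap.proj i : (σ → 𝕜) →L[𝕜] 𝕜).hasStrictFDerivAt
    simp only [map_mul, MvPolynomial.eval_X]
    refine (hp.fun_mul hX).congr_fderiv (ContinuousLinearMap.ext fun v => ?_)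
    simp [Derivation.leibniz, MvPolynomial.pderiv_X, add_mul, Finset.sum_add_distrib,
      Pi.single_apply, Finset.mul_sum, mul_assoc, apply_ite, ite_mul]

theorem exists_mem_nhds_injOn_eval {ι 𝕜 : Type*} [Fintype ι] [DecidableEq ι]
    [NontriviallyNormedField 𝕜] [CompleteSpace 𝕜] (F : ι → MvPolynomial ι 𝕜) {u : ι → 𝕜}
    (hdet : (Matrix.of fun i j => MvPolynomial.eval u (MvPolynomial.pderiv j (F i))).det ≠ 0) :
    ∃ s ∈ 𝓝 u, Set.InjOn (fun v i => MvPolynomial.eval v (F i)) s := by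
  set A : Matrix ι ι 𝕜 := .of fun i j => MvPolynomial.eval u (MvPolynomial.pderiv j (F i)) with hA
  let e : (ι → 𝕜) ≃L[𝕜] (ι → 𝕜) := (LinearMap.equivOfIsUnitDet (f := Matrix.toLin' A)
    (by rwa [LinearMap.det_toLin', isUnit_iff_ne_zero])).toContinuousLinearEquiv
  have he : HasStrictFDerivAt (fun v i => MvPolynomial.eval v (F i)) (e : (ι → 𝕜) →L[𝕜] _) u := by
    refine hasStrictFDerivAt_pi'.2 fun i =>
      (hasStrictFDerivAt_eval (F i) u).congr_fderiv (ContinuousLinearMap.ext fun v => ?_)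
    simp [e, hA, Matrix.mulVec, dotProduct]
  exact ⟨_, (he.toOpenPartialHomeomorph _).open_source.mem_nhds
    he.mem_toOpenPartialHomeomorph_source, (he.toOpenPartialHomeomorph _).injOn⟩

theorem exists_pos_eventually_not_of_ultrafilter {V : Type*} [TopologicalSpace V]
    {N : ℝ → V → Prop} {b : V}
    (h : ∀ F : Ultrafilter (ℝ × V),
      Tendsto Prod.fst (F : Filter (ℝ × V)) (𝓝 0) →
      Tendsto Prod.snd (F : Filter (ℝ × V)) (𝓝 b) →
      ¬ ∀ᶠ p in (F : Filter (ℝ × V)), N p.1 p.2) :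
    ∃ η > 0, ∀ᶠ b' in 𝓝 b, ¬ N η b' := by
  have hev : ∀ᶠ p in 𝓝[>] (0 : ℝ) ×ˢ 𝓝 b, ¬ N p.1 p.2 := by
    by_contra hfreq
    have hne : (𝓝[>] (0 : ℝ) ×ˢ 𝓝 b ⊓ 𝓟 {p | N p.1 p.2}).NeBot :=
      frequently_mem_iff_neBot.1 hfreq
    let F := Ultrafilter.of (𝓝[>] (0 : ℝ) ×ˢ 𝓝 b ⊓ 𝓟 {p | N p.1 p.2})
    have hF : ↑F ≤ 𝓝[>] (0 : ℝ) ×ˢ 𝓝 b ⊓ 𝓟 {p | N p.1 p.2} := Ultrafilter.of_le _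
    have hF' := hF.trans inf_le_left
    exact h F ((tendsto_fst.mono_left hF').mono_right nhdsWithin_le_nhds)
      (tendsto_snd.mono_left hF') (hF.trans inf_le_right (mem_principal_self _))
  obtain ⟨η, hη, hη'⟩ := (eventually_mem_nhdsWithin.and hev.curry).exists
  exact ⟨η, hη, hη'⟩

theorem eq_of_tendsto_of_norm_sub_le {α E : Type*} [NormedAddCommGroup E] {l : Filter α} [l.NeBot]
    {x y : α → E} {η K : α → ℝ} {x₀ y₀ : E} {K₀ : ℝ} (hx : Tendsto x l (𝓝 x₀))
    (hy : Tendsto y l (𝓝 y₀)) (hη : Tendsto η l (𝓝 0)) (hK : Tendsto K l (𝓝 K₀))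
    (h : ∀ᶠ a in l, ‖x a - y a‖ ≤ η a * K a) : x₀ = y₀ := by
  have hle := le_of_tendsto_of_tendsto (hx.sub hy).norm (hη.mul hK) h
  rw [zero_mul] at hle
  exact sub_eq_zero.1 (norm_le_zero_iff.1 hle)

namespace HomTriple

variable {d : ℕ} (T : HomTriple d)

/-- The lift `(P, Q)` of `f_∞` to `ℂ²`. -/
def liftInf (u : CV 2) : CV 2 := fun i => MvPolynomial.eval u (![T.P, T.Q] i)

/-- The polynomial function `R` on `ℂ²`. -/
def evalR (u : CV 2) : ℂ := MvPolynomial.eval u T.R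

theorem isHomogeneous_PQ (i : Fin 2) : (![T.P, T.Q] i).IsHomogeneous d := by
  fin_cases i
  exacts [T.homP, T.homQ]

theorem liftInf_smul (t : ℂ) (u : CV 2) : T.liftInf (t • u) = t ^ d • T.liftInf u :=
  funext fun i => eval_smul_of_isHomogeneous (T.isHomogeneous_PQ i) t u

theorem evalR_smul (t : ℂ) (u : CV 2) : T.evalR (t • u) = t ^ d * T.evalR u :=
  eval_smul_of_isHomogeneous T.homR t u

theorem eq_zero_of_liftInf_eq_zero {u : CV 2} (h : T.liftInf u = 0) : u = 0 :=
  T.common_zero u (congrFun h 0) (congrFun h 1)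

theorem liftInf_ne_zero {u : CV 2} (hu : u ≠ 0) : T.liftInf u ≠ 0 :=
  mt T.eq_zero_of_liftInf_eq_zero hu

theorem ne_zero_of_liftInf_ne_zero (hd : d ≠ 0) {u : CV 2} (h : T.liftInf u ≠ 0) : u ≠ 0 := by
  rintro rfl
  exact h (map_zero_of_homogeneous hd T.liftInf_smul)

theorem continuous_liftInf : Continuous T.liftInf :=
  continuous_pi fun i => MvPolynomial.continuous_eval (![T.P, T.Q] i)

theorem continuous_evalR : Continuous T.evalR := MvPolynomial.continuous_eval T.R

theorem isProperMap_liftInf (hd : d ≠ 0) : IsProperMap T.liftInf :=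
  isProperMap_of_homogeneous hd T.continuous_liftInf T.liftInf_smul
    fun _ => T.eq_zero_of_liftInf_eq_zero

theorem fInf_mk (u : CV 2) (hu : u ≠ 0) :
    T.fInf (Projectivization.mk ℂ u hu) =
      Projectivization.mk ℂ (T.liftInf u) (T.liftInf_ne_zero hu) := rfl

theorem mk_mem_X_of_ne_smul {u v : CV 2} (hu : u ≠ 0) (hv : v ≠ 0)
    (heq : T.liftInf u = T.liftInf v) (huv : ∀ c : ℂ, u ≠ c • v) (hR : T.evalR u = T.evalR v) :
    Projectivization.mk ℂ (T.liftInf u) (T.liftInf_ne_zero hu) ∈ T.X := by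
  refine ⟨_, ⟨(Projectivization.mk ℂ u hu, Projectivization.mk ℂ v hv),
    Or.inl ⟨fun h => ?_, ?_⟩, rfl⟩, rfl⟩
  · obtain ⟨c, hc⟩ := (Projectivization.mk_eq_mk_iff' ..).1 h
    exact huv c hc.symm
  · simp only [fInfPlus, projMap_mk]
    congr 1
    funext i
    fin_cases i
    exacts [congrFun heq 0, congrFun heq 1, hR]

theorem mk_mem_X_of_mk_mem_critical {u : CV 2} (hu : u ≠ 0)
    (h : Projectivization.mk ℂ u hu ∈ T.critical) :
    Projectivization.mk ℂ (T.liftInf u) (T.liftInf_ne_zero hu) ∈ T.X :=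
  ⟨_, ⟨(_, _), Or.inr ⟨rfl, h⟩, rfl⟩, rfl⟩

theorem mk_mem_Y {u v : CV 2} {ξ : ℂ} (hu : u ≠ 0) (hv : v ≠ 0)
    (heq : T.liftInf u = T.liftInf v) (hξ : ξ ^ d = 1) (hξ1 : ξ ≠ 1)
    (hR : T.evalR u = ξ * T.evalR v) :
    Projectivization.mk ℂ (T.liftInf (T.liftInf u)) (T.liftInf_ne_zero (T.liftInf_ne_zero hu)) ∈
      T.Y :=
  ⟨_, ⟨(_, _), ⟨u, v, hu, hv, rfl, congrFun heq 0, congrFun heq 1, ξ, hξ, hξ1, hR⟩, rfl⟩, rfl⟩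

theorem exists_mem_nhds_injOn_liftInf {u : CV 2} (hu : u ≠ 0)
    (h : Projectivization.mk ℂ u hu ∉ T.critical) : ∃ s ∈ 𝓝 u, Set.InjOn T.liftInf s := by
  refine exists_mem_nhds_injOn_eval ![T.P, T.Q] fun hdet => h ⟨u, hu, rfl, ?_⟩
  simpa [Matrix.det_fin_two] using hdet

/-! ### Neighbourhoods of the cones over `X`, `Y` and `Z` -/

/-- A quantitative version of the condition `[b] ∈ X`: `b` has two preimages by `(P, Q)` in
different directions with nearly the same value of `R`. -/
def NearX (η : ℝ) (b : CV 2) : Prop :=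
  ∃ u v : CV 2, T.liftInf u = b ∧ T.liftInf v = b ∧ (∀ c : ℂ, u ≠ c • v) ∧
    ‖T.evalR u - T.evalR v‖ ≤ η * ‖b‖

/-- A quantitative version of the condition `[b] ∈ Y`: `b = (P, Q)²(u) = (P, Q)²(v)` where
`(P, Q)(u) = (P, Q)(v)` and `R(u)` is nearly `ξ R(v)`, with `ξ` a nontrivial root of unity. -/
def NearY (η : ℝ) (b : CV 2) : Prop :=
  ∃ (u v : CV 2) (ξ : ℂ), T.liftInf u = T.liftInf v ∧ T.liftInf (T.liftInf u) = b ∧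
    ξ ^ d = 1 ∧ ξ ≠ 1 ∧ ‖T.evalR u - ξ * T.evalR v‖ ≤ η * ‖T.liftInf u‖

/-- A quantitative version of the condition `[b] ∈ Z`. -/
def NearZ (η : ℝ) (b : CV 2) : Prop := T.NearX η b ∨ T.NearY η b

variable {T}

theorem NearX.mono {η η' : ℝ} (h : η ≤ η') {b : CV 2} : T.NearX η b → T.NearX η' b := by
  rintro ⟨u, v, hu, hv, huv, hR⟩
  exact ⟨u, v, hu, hv, huv, hR.trans (by gcongr)⟩

theorem NearY.mono {η η' : ℝ} (h : η ≤ η') {b : CV 2} : T.NearY η b → T.NearY η' b := by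
  rintro ⟨u, v, ξ, huv, hu, hξ, hξ1, hR⟩
  exact ⟨u, v, ξ, huv, hu, hξ, hξ1, hR.trans (by gcongr)⟩

theorem NearZ.mono {η η' : ℝ} (h : η ≤ η') {b : CV 2} : T.NearZ η b → T.NearZ η' b :=
  Or.imp (NearX.mono h) (NearY.mono h)

theorem NearX.smul (hd : d ≠ 0) {η : ℝ} {b : CV 2} (h : T.NearX η b) {c : ℂ} (hc : c ≠ 0) :
    T.NearX η (c • b) := by
  obtain ⟨t, rfl⟩ := IsAlgClosed.exists_pow_nat_eq c hd.pos
  have ht : t ≠ 0 := (pow_ne_zero_iff hd).1 hc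
  obtain ⟨u, v, hu, hv, huv, hR⟩ := h
  refine ⟨t • u, t • v, by rw [T.liftInf_smul, hu], by rw [T.liftInf_smul, hv],
    fun a ha => huv a ?_, ?_⟩
  · rw [smul_comm] at ha
    exact smul_right_injective _ ht ha
  · rw [T.evalR_smul, T.evalR_smul, ← mul_sub, norm_mul, norm_smul, mul_left_comm]
    gcongr

theorem NearY.smul (hd : d ≠ 0) {η : ℝ} {b : CV 2} (h : T.NearY η b) (c : ℂ) :
    T.NearY η (c • b) := by
  obtain ⟨s, rfl⟩ := IsAlgClosed.exists_pow_nat_eq c hd.pos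
  obtain ⟨t, rfl⟩ := IsAlgClosed.exists_pow_nat_eq s hd.pos
  obtain ⟨u, v, ξ, huv, hu, hξ, hξ1, hR⟩ := h
  refine ⟨t • u, t • v, ξ, by rw [T.liftInf_smul, T.liftInf_smul, huv],
    by rw [T.liftInf_smul, T.liftInf_smul, hu], hξ, hξ1, ?_⟩
  rw [T.evalR_smul, T.evalR_smul, T.liftInf_smul, mul_left_comm, ← mul_sub, norm_mul, norm_smul,
    mul_left_comm]
  gcongr

theorem NearZ.smul (hd : d ≠ 0) {η : ℝ} {b : CV 2} (h : T.NearZ η b) {c : ℂ} (hc : c ≠ 0) :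
    T.NearZ η (c • b) :=
  h.imp (fun h => h.smul hd hc) (fun h => h.smul hd c)

variable (T)

theorem exists_pos_eventually_not_nearX (hd : d ≠ 0) {b : CV 2} (hb : b ≠ 0)
    (hX : Projectivization.mk ℂ b hb ∉ T.X) : ∃ η > 0, ∀ᶠ b' in 𝓝 b, ¬ T.NearX η b' := by
  refine exists_pos_eventually_not_of_ultrafilter fun F hη hb' hN => hX ?_
  choose! u v hu hv huv hR using fun p : ℝ × CV 2 => id (α := T.NearX p.1 p.2)
  have hGu : Tendsto (T.liftInf ∘ u) F (𝓝 b) := hb'.congr' (hN.mono fun p hp => (hu p hp).symm)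
  have hGv : Tendsto (T.liftInf ∘ v) F (𝓝 b) := hb'.congr' (hN.mono fun p hp => (hv p hp).symm)
  obtain ⟨u₀, rfl, hu₀⟩ : ∃ u₀, T.liftInf u₀ = b ∧ Tendsto u F (𝓝 u₀) :=
    (T.isProperMap_liftInf hd).ultrafilter_le_nhds_of_tendsto (𝒰 := F.map u) hGu
  obtain ⟨v₀, hGv₀, hv₀⟩ : ∃ v₀, T.liftInf v₀ = T.liftInf u₀ ∧ Tendsto v F (𝓝 v₀) :=
    (T.isProperMap_liftInf hd).ultrafilter_le_nhds_of_tendsto (𝒰 := F.map v) hGv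
  have hu₀0 := T.ne_zero_of_liftInf_ne_zero hd hb
  have hR₀ : T.evalR u₀ = T.evalR v₀ := by
    refine eq_of_tendsto_of_norm_sub_le (((T.continuous_evalR.tendsto u₀).comp hu₀))
      ((T.continuous_evalR.tendsto v₀).comp hv₀) hη hb'.norm (hN.mono hR)
  by_cases hc : ∃ c : ℂ, u₀ = c • v₀
  · obtain ⟨c, hc⟩ := hc
    have hcd : c ^ d = 1 := smul_left_injective ℂ hb <| by
      simp only [one_smul, ← hGv₀, ← T.liftInf_smul, ← hc]
    refine T.mk_mem_X_of_mk_mem_critical hu₀0 (by_contra fun hcrit => ?_)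
    obtain ⟨s, hs, hinj⟩ := T.exists_mem_nhds_injOn_liftInf hu₀0 hcrit
    have hcv : Tendsto (fun p => c • v p) F (𝓝 u₀) := hc ▸ hv₀.const_smul c
    obtain ⟨p, hp, hup, hvp⟩ :=
      (hN.and ((hu₀.eventually hs).and (hcv.eventually hs))).exists
    refine huv p hp c (hinj hup hvp ?_)
    rw [T.liftInf_smul, hcd, one_smul, hu p hp, hv p hp]
  · push Not at hc
    exact T.mk_mem_X_of_ne_smul hu₀0 (T.ne_zero_of_liftInf_ne_zero hd (hGv₀ ▸ hb)) hGv₀.symm hc hR₀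

theorem exists_pos_eventually_not_nearY (hd : d ≠ 0) {b : CV 2} (hb : b ≠ 0)
    (hY : Projectivization.mk ℂ b hb ∉ T.Y) : ∃ η > 0, ∀ᶠ b' in 𝓝 b, ¬ T.NearY η b' := by
  refine exists_pos_eventually_not_of_ultrafilter fun F hη hb' hN => hY ?_
  choose! u v ξ huv hu hξ hξ1 hR using fun p : ℝ × CV 2 => id (α := T.NearY p.1 p.2)
  have hproper := T.isProperMap_liftInf hd
  have hGu : Tendsto (T.liftInf ∘ T.liftInf ∘ u) F (𝓝 b) :=
    hb'.congr' (hN.mono fun p hp => (hu p hp).symm)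
  obtain ⟨u₀, rfl, hu₀⟩ : ∃ u₀, (T.liftInf ∘ T.liftInf) u₀ = b ∧ Tendsto u F (𝓝 u₀) :=
    (hproper.comp hproper).ultrafilter_le_nhds_of_tendsto (𝒰 := F.map u) hGu
  have hGu₀ : Tendsto (T.liftInf ∘ u) F (𝓝 (T.liftInf u₀)) :=
    (T.continuous_liftInf.tendsto u₀).comp hu₀
  have hGv : Tendsto (T.liftInf ∘ v) F (𝓝 (T.liftInf u₀)) :=
    hGu₀.congr' (hN.mono fun p hp => huv p hp)
  obtain ⟨v₀, hGv₀, hv₀⟩ : ∃ v₀, T.liftInf v₀ = T.liftInf u₀ ∧ Tendsto v F (𝓝 v₀) :=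
    hproper.ultrafilter_le_nhds_of_tendsto (𝒰 := F.map v) hGv
  have hfin : {ξ : ℂ | ξ ^ d = 1 ∧ ξ ≠ 1}.Finite := by
    refine (Polynomial.nthRoots d (1 : ℂ)).toFinset.finite_toSet.subset fun ξ hξ => ?_
    simpa [Polynomial.mem_nthRoots hd.pos] using hξ.1
  obtain ⟨ξ₀, ⟨hξ₀, hξ₀1⟩, hξlim⟩ : ∃ ξ₀ ∈ {ξ : ℂ | ξ ^ d = 1 ∧ ξ ≠ 1}, Tendsto ξ F (𝓝 ξ₀) :=
    hfin.isCompact.ultrafilter_le_nhds' (F.map ξ) (hN.mono fun p hp => ⟨hξ p hp, hξ1 p hp⟩)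
  have hGu₀0 := T.ne_zero_of_liftInf_ne_zero hd hb
  refine T.mk_mem_Y (T.ne_zero_of_liftInf_ne_zero hd hGu₀0)
    (T.ne_zero_of_liftInf_ne_zero hd (hGv₀ ▸ hGu₀0)) hGv₀.symm hξ₀ hξ₀1 ?_
  exact eq_of_tendsto_of_norm_sub_le ((T.continuous_evalR.tendsto u₀).comp hu₀)
    (hξlim.mul ((T.continuous_evalR.tendsto v₀).comp hv₀)) hη hGu₀.norm (hN.mono hR)

theorem exists_pos_eventually_not_nearZ (hd : d ≠ 0) {b : CV 2} (hb : b ≠ 0)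
    (hZ : Projectivization.mk ℂ b hb ∉ T.Z) : ∃ η > 0, ∀ᶠ b' in 𝓝 b, ¬ T.NearZ η b' := by
  obtain ⟨η₁, hη₁, hX⟩ := T.exists_pos_eventually_not_nearX hd hb fun h => hZ (Or.inl h)
  obtain ⟨η₂, hη₂, hY⟩ := T.exists_pos_eventually_not_nearY hd hb fun h => hZ (Or.inr h)
  refine ⟨min η₁ η₂, lt_min hη₁ hη₂, ?_⟩
  filter_upwards [hX, hY] with b' hX' hY'
  rintro (h | h)
  exacts [hX' (h.mono (min_le_left _ _)), hY' (h.mono (min_le_right _ _))]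

theorem exists_pos_forall_not_nearX_and_nearY (hd : d ≠ 0) (hXY : Disjoint T.X T.Y) :
    ∃ η > 0, ∀ b : CV 2, b ≠ 0 → ¬ (T.NearX η b ∧ T.NearY η b) := by
  refine exists_pos_forall_not_of_forall_nhds
    (fun η η' b h => And.imp (NearX.mono h) (NearY.mono h))
    (fun η b c hc => And.imp (fun h => h.smul hd hc) (fun h => h.smul hd c)) fun b hb => ?_
  by_cases hX : Projectivization.mk ℂ b hb ∈ T.X
  · obtain ⟨η, hη, h⟩ := T.exists_pos_eventually_not_nearY hd hb (Set.disjoint_left.1 hXY hX)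
    exact ⟨η, hη, h.mono fun _ h h' => h h'.2⟩
  · obtain ⟨η, hη, h⟩ := T.exists_pos_eventually_not_nearX hd hb hX
    exact ⟨η, hη, h.mono fun _ h h' => h h'.1⟩

theorem exists_pos_forall_not_nearZ_iterate (hd : d ≠ 0)
    (hZ : T.fInf^[2] ⁻¹' T.Z ∩ T.fInf ⁻¹' T.Z ∩ T.Z = ∅) :
    ∃ η > 0, ∀ b : CV 2, b ≠ 0 →
      ¬ (T.NearZ η b ∧ T.NearZ η (T.liftInf b) ∧ T.NearZ η (T.liftInf (T.liftInf b))) := by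
  refine exists_pos_forall_not_of_forall_nhds (fun η η' b h => And.imp (NearZ.mono h)
    (And.imp (NearZ.mono h) (NearZ.mono h))) (fun η b c hc => ?_) fun b hb => ?_
  · rintro ⟨h₀, h₁, h₂⟩
    rw [T.liftInf_smul, T.liftInf_smul]
    exact ⟨h₀.smul hd hc, h₁.smul hd (pow_ne_zero _ hc),
      h₂.smul hd (pow_ne_zero _ (pow_ne_zero _ hc))⟩
  have hb₁ := T.liftInf_ne_zero hb
  by_cases h₀ : Projectivization.mk ℂ b hb ∈ T.Z
  · by_cases h₁ : Projectivization.mk ℂ _ hb₁ ∈ T.Z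
    · have h₂ : Projectivization.mk ℂ _ (T.liftInf_ne_zero hb₁) ∉ T.Z := fun h₂ =>
        (Set.ext_iff.1 hZ (Projectivization.mk ℂ b hb)).1 ⟨⟨h₂, h₁⟩, h₀⟩
      obtain ⟨η, hη, h⟩ := T.exists_pos_eventually_not_nearZ hd _ h₂
      exact ⟨η, hη, (((T.continuous_liftInf.comp T.continuous_liftInf).tendsto b).eventually
        h).mono fun _ h h' => h h'.2.2⟩
    · obtain ⟨η, hη, h⟩ := T.exists_pos_eventually_not_nearZ hd _ h₁
      exact ⟨η, hη, ((T.continuous_liftInf.tendsto b).eventually h).mono fun _ h h' => h h'.2.1⟩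
  · obtain ⟨η, hη, h⟩ := T.exists_pos_eventually_not_nearZ hd _ h₀
    exact ⟨η, hη, h.mono fun _ h h' => h h'.1⟩

end HomTriple

/-! ### Fibres of the map on the line at infinity -/

/-- The restriction of a polynomial to the line `ζ ↦ ζ a + c`, as a polynomial in `ζ`. -/
def linePoly {σ R : Type*} [CommSemiring R] (F : MvPolynomial σ R) (a c : σ → R) : Polynomial R :=
  MvPolynomial.aeval (fun i => Polynomial.C (a i) * Polynomial.X + Polynomial.C (c i)) F

theorem eval_linePoly {σ R : Type*} [CommSemiring R] (F : MvPolynomial σ R) (a c : σ → R) (ζ : R) :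
    (linePoly F a c).eval ζ = MvPolynomial.eval (ζ • a + c) F := by
  rw [linePoly, MvPolynomial.aeval_def, MvPolynomial.polynomial_eval_eval₂, MvPolynomial.eval,
    MvPolynomial.coe_eval₂Hom]
  congr 1
  · exact RingHom.ext fun k => Polynomial.eval_C
  · funext i
    rw [Polynomial.eval_add, Polynomial.eval_C_mul, Polynomial.eval_X, Polynomial.eval_C, mul_comm]
    rfl

theorem natDegree_linePoly_le {σ R : Type*} [CommSemiring R] {d : ℕ} {F : MvPolynomial σ R}
    (hF : F.IsHomogeneous d) (a c : σ → R) : (linePoly F a c).natDegree ≤ d :=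
  (MvPolynomial.aeval_natDegree_le F hF.totalDegree_le _
    fun _ => Polynomial.natDegree_linear_le).trans_eq (mul_one d)

theorem linePoly_swap_of_eq_C {n d : ℕ} {F : MvPolynomial (Fin n) ℂ} (hF : F.IsHomogeneous d)
    {a c : CV n} {k : ℂ} (h : linePoly F a c = Polynomial.C k) :
    linePoly F c a = Polynomial.C k * Polynomial.X ^ d := by
  refine Polynomial.eq_of_infinite_eval_eq _ _
    ((Set.finite_singleton (0 : ℂ)).infinite_compl.mono fun ζ (hζ : ζ ≠ 0) => ?_)
  have hline : ζ • c + a = ζ • (ζ⁻¹ • a + c) := by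
    rw [smul_add, smul_inv_smul₀ hζ, add_comm]
  rw [Set.mem_ofPred_eq, eval_linePoly, hline, eval_smul_of_isHomogeneous hF, ← eval_linePoly, h,
    Polynomial.eval_C, Polynomial.eval_C_mul, Polynomial.eval_pow, Polynomial.eval_X, mul_comm]

theorem exists_ne_zero_eval_eq_zero {d : ℕ} (hd : d ≠ 0) {F : MvPolynomial (Fin 2) ℂ}
    (hF : F.IsHomogeneous d) : ∃ u : CV 2, u ≠ 0 ∧ MvPolynomial.eval u F = 0 := by
  by_cases hdeg : (linePoly F ![1, 0] ![0, 1]).degree = 0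
  · have hM := linePoly_swap_of_eq_C hF (Polynomial.eq_C_of_degree_eq_zero hdeg)
    refine ⟨![1, 0], fun h => one_ne_zero (congrFun h 0), ?_⟩
    have hM₀ := congrArg (Polynomial.eval 0) hM
    rwa [eval_linePoly, zero_smul, zero_add, Polynomial.eval_C_mul, Polynomial.eval_pow,
      Polynomial.eval_X, zero_pow hd, mul_zero] at hM₀
  · obtain ⟨ζ, hζ⟩ := IsAlgClosed.exists_root _ hdeg
    rw [Polynomial.IsRoot.def, eval_linePoly] at hζ
    exact ⟨_, fun h => by simpa using congrFun h 1, hζ⟩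

section Plane

variable {K : Type*} [Field K] {a c : Fin 2 → K}

theorem exists_mul_sub_mul_ne_zero (ha : a ≠ 0) :
    ∃ c : Fin 2 → K, a 0 * c 1 - a 1 * c 0 ≠ 0 := by
  by_contra! h
  refine ha (funext fun i => ?_)
  fin_cases i
  · simpa using h ![0, 1]
  · simpa using h ![1, 0]

theorem eq_smul_add_smul (hac : a 0 * c 1 - a 1 * c 0 ≠ 0) (u : Fin 2 → K) :
    u = ((u 0 * c 1 - u 1 * c 0) / (a 0 * c 1 - a 1 * c 0)) • a +
      ((a 0 * u 1 - a 1 * u 0) / (a 0 * c 1 - a 1 * c 0)) • c := by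
  funext i
  rw [Pi.add_apply, Pi.smul_apply, Pi.smul_apply, smul_eq_mul, smul_eq_mul, div_mul_eq_mul_div,
    div_mul_eq_mul_div, ← add_div, eq_div_iff hac]
  obtain rfl | rfl : i = 0 ∨ i = 1 := by clear * -; decide +revert
  all_goals ring

theorem smul_add_ne_zero (hac : a 0 * c 1 - a 1 * c 0 ≠ 0) (ζ : K) : ζ • a + c ≠ 0 := by
  intro h
  have h₀ := congrFun h 0
  have h₁ := congrFun h 1
  simp only [Pi.add_apply, Pi.smul_apply, smul_eq_mul, Pi.zero_apply] at h₀ h₁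
  exact hac (by linear_combination a 0 * h₁ - a 1 * h₀)

theorem mk_smul_add_injective (hac : a 0 * c 1 - a 1 * c 0 ≠ 0) :
    Function.Injective fun ζ => Projectivization.mk K (ζ • a + c) (smul_add_ne_zero hac ζ) := by
  intro ζ ξ h
  have h₀₁ := (mk_eq_mk_iff_mul_eq_mul ..).1 h 0 1
  simp only [Pi.add_apply, Pi.smul_apply, smul_eq_mul] at h₀₁
  refine mul_right_cancel₀ hac ?_
  linear_combination h₀₁

end Plane

theorem encard_setOf_eval_eq_zero_le {d : ℕ} {F : MvPolynomial (Fin 2) ℂ} (hF : F.IsHomogeneous d)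
    {a : CV 2} (ha : a ≠ 0) (hFa : MvPolynomial.eval a F ≠ 0) :
    {p : PS 2 | ∃ (u : CV 2) (hu : u ≠ 0), p = Projectivization.mk ℂ u hu ∧
      MvPolynomial.eval u F = 0}.encard ≤ d := by
  obtain ⟨c, hac⟩ := exists_mul_sub_mul_ne_zero ha
  have hL : linePoly F a c ≠ 0 := fun h => hFa <| by
    have hM := linePoly_swap_of_eq_C hF (h.trans (map_zero _).symm)
    simpa [eval_linePoly] using congrArg (Polynomial.eval 0) hM
  have hsub : {p : PS 2 | ∃ (u : CV 2) (hu : u ≠ 0), p = Projectivization.mk ℂ u hu ∧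
      MvPolynomial.eval u F = 0} ⊆
      (fun ζ => Projectivization.mk ℂ (ζ • a + c) (smul_add_ne_zero hac ζ)) ''
        ((linePoly F a c).roots.toFinset : Set ℂ) := by
    rintro _ ⟨u, hu, rfl, hFu⟩
    obtain ⟨α, β, rfl⟩ : ∃ α β : ℂ, u = α • a + β • c := ⟨_, _, eq_smul_add_smul hac u⟩
    have hβ : β ≠ 0 := by
      rintro rfl
      rw [zero_smul, add_zero] at hFu hu
      rw [eval_smul_of_isHomogeneous hF] at hFu
      exact mul_ne_zero (pow_ne_zero _ (left_ne_zero_of_smul hu)) hFa hFu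
    have hline : α • a + β • c = β • ((α / β) • a + c) := by
      rw [smul_add, smul_smul, mul_div_cancel₀ _ hβ]
    rw [hline, eval_smul_of_isHomogeneous hF, mul_eq_zero_iff_left (pow_ne_zero _ hβ),
      ← eval_linePoly] at hFu
    refine ⟨α / β, by simpa [hL] using hFu, (Projectivization.mk_eq_mk_iff' ..).2 ⟨β⁻¹, ?_⟩⟩
    rw [hline, inv_smul_smul₀ hβ]
  calc
    _ ≤ ((linePoly F a c).roots.toFinset : Set ℂ).encard :=
      (Set.encard_le_encard hsub).trans (Set.encard_image_le _ _)
    _ ≤ d := by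
      rw [Set.encard_coe_eq_coe_finsetCard]
      exact_mod_cast (Multiset.toFinset_card_le _).trans
        ((Polynomial.card_roots' _).trans (natDegree_linePoly_le hF a c))

theorem eq_smul_of_div_eq_div {K : Type*} [Field K] {x y : Fin 2 → K} {i : Fin 2} (hx : x i ≠ 0)
    (hy : y i ≠ 0) (h : x (i + 1) / x i = y (i + 1) / y i) : x = (x i / y i) • y := by
  funext k
  rw [Pi.smul_apply, smul_eq_mul]
  obtain rfl | rfl : k = i ∨ k = i + 1 := by clear * -; decide +revert
  · rw [div_mul_cancel₀ _ hy]
  · rw [div_mul_eq_mul_div, mul_div_assoc, ← h, mul_div_cancel₀ _ hx]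

/-- If `b = t g(v)` with `b` and `g(v)` close to `g(u)`, then `t` is close to `1`, hence is the
`d`-th power of some `s` close to `1`, and `b = g(s v)`. -/
theorem nhds_le_map_of_homogeneous {ι V : Type*} [TopologicalSpace V] [AddCommGroup V] [Module ℂ V]
    [ContinuousSMul ℂ V] {d : ℕ} (hd : d ≠ 0) {g : V → ι → ℂ} {u : V} (hcont : ContinuousAt g u)
    (hg : ∀ (t : ℂ) v, g (t • v) = t ^ d • g v) (hu : g u ≠ 0)
    (hopen : ∀ B ∈ 𝓝 u, ∀ᶠ b in 𝓝 (g u), ∃ v ∈ B, ∃ t : ℂ, b = t • g v) :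
    𝓝 (g u) ≤ map g (𝓝 u) := by
  obtain ⟨i, hi⟩ : ∃ i, g u i ≠ 0 := Function.ne_iff.1 hu
  have hgi : ContinuousAt (fun v => g v i) u := (continuous_apply i).continuousAt.comp hcont
  intro W hW
  have hsmul : ∀ᶠ p : ℂ × V in 𝓝 1 ×ˢ 𝓝 u, p.1 • p.2 ∈ g ⁻¹' W := by
    have htendsto : Tendsto (fun p : ℂ × V => p.1 • p.2) (𝓝 1 ×ˢ 𝓝 u) (𝓝 u) := by
      simpa [nhds_prod_eq] using (continuous_smul (M := ℂ) (X := V)).tendsto (1, u)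
    exact htendsto hW
  obtain ⟨A, hA, B, hB, hAB⟩ := eventually_prod_iff.1 hsmul
  have : NeZero d := ⟨hd⟩
  have hroot : (fun s : ℂ => s ^ d) '' {s | A s} ∈ 𝓝 (1 : ℂ) := by
    simpa using (Complex.isOpenQuotientMap_pow d).isOpenMap.image_mem_nhds hA
  have hratio : ∀ᶠ p : (ι → ℂ) × V in 𝓝 (g u) ×ˢ 𝓝 u,
      p.1 i / g p.2 i ∈ (fun s : ℂ => s ^ d) '' {s | A s} := by
    have htendsto : Tendsto (fun p : (ι → ℂ) × V => p.1 i / g p.2 i) (𝓝 (g u) ×ˢ 𝓝 u) (𝓝 1) := by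
      rw [← div_self hi]
      exact (((continuous_apply i).tendsto _).comp tendsto_fst).div
        (hgi.tendsto.comp tendsto_snd) hi
    exact htendsto hroot
  obtain ⟨A', hA', B', hB', hAB'⟩ := eventually_prod_iff.1 hratio
  filter_upwards [hA', hopen _ (inter_mem (inter_mem hB hB') (hgi.eventually_ne hi))]
    with b hb ⟨v, ⟨⟨hvB, hvB'⟩, hvi⟩, t, hbt⟩
  obtain ⟨s, hs, hst⟩ := hAB' hb hvB'
  have hsd : s ^ d = t := hst.trans (by simp [hbt, mul_div_cancel_right₀ t hvi])
  rw [hbt, ← hsd, ← hg]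
  exact hAB hs hvB

namespace HomTriple

variable {d : ℕ} (T : HomTriple d)

theorem exists_mul_liftInf_sub_mul_liftInf_ne_zero (hd : d ≠ 0) {b : CV 2} (hb : b ≠ 0) :
    ∃ a : CV 2, b 1 * T.liftInf a 0 - b 0 * T.liftInf a 1 ≠ 0 := by
  by_contra! h
  obtain ⟨i, hi⟩ := Function.ne_iff.1 hb
  obtain ⟨u, hu, hui⟩ : ∃ u : CV 2, u ≠ 0 ∧ T.liftInf u i = 0 :=
    exists_ne_zero_eval_eq_zero hd (T.isHomogeneous_PQ i)
  have hpar := h u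
  refine hu (T.eq_zero_of_liftInf_eq_zero (funext fun j => ?_))
  obtain rfl | rfl : j = i ∨ j = i + 1 := by clear * -; decide +revert
  · exact hui
  · refine (mul_eq_zero.1 (?_ : b i * T.liftInf u (i + 1) = 0)).resolve_left hi
    fin_cases i
    · have hui : T.liftInf u 0 = 0 := hui
      simpa [hui] using hpar
    · have hui : T.liftInf u 1 = 0 := hui
      simpa [hui] using hpar

theorem encard_fInf_fibre_le (hd : d ≠ 0) (p : PS 2) : (T.fInf ⁻¹' {p}).encard ≤ d := by
  induction p using Projectivization.ind with
  | h b hb =>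
    let H : MvPolynomial (Fin 2) ℂ := MvPolynomial.C (b 1) * T.P - MvPolynomial.C (b 0) * T.Q
    have hH : H.IsHomogeneous d := (T.homP.C_mul _).sub (T.homQ.C_mul _)
    have hHe (u : CV 2) : MvPolynomial.eval u H = b 1 * T.liftInf u 0 - b 0 * T.liftInf u 1 := by
      simp [H, liftInf]
    obtain ⟨a, ha⟩ := T.exists_mul_liftInf_sub_mul_liftInf_ne_zero hd hb
    have ha0 : a ≠ 0 := T.ne_zero_of_liftInf_ne_zero hd fun h => ha (by simp [h])
    refine (Set.encard_le_encard fun p hp => ?_).trans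
      (encard_setOf_eval_eq_zero_le hH ha0 (by rwa [hHe]))
    induction p using Projectivization.ind with
    | h u hu =>
      refine ⟨u, hu, rfl, ?_⟩
      rw [hHe]
      have h₀₁ : T.liftInf u 0 * b 1 = T.liftInf u 1 * b 0 :=
        (mk_eq_mk_iff_mul_eq_mul ..).1 (Set.mem_singleton_iff.1 hp) 0 1
      linear_combination h₀₁

/-! ### Openness of the lift of `f_∞` -/

theorem nhds_le_map_liftInf_line (hd : d ≠ 0) {u c : CV 2} (huc : c 0 * u 1 - c 1 * u 0 ≠ 0)
    {i : Fin 2} (hi : T.liftInf u i ≠ 0) :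
    𝓝 (T.liftInf u (i + 1) / T.liftInf u i) ≤
      map (fun ζ : ℂ => T.liftInf (ζ • c + u) (i + 1) / T.liftInf (ζ • c + u) i) (𝓝 0) := by
  have han (k : Fin 2) : AnalyticAt ℂ (fun ζ : ℂ => T.liftInf (ζ • c + u) k) 0 :=
    (AnalyticOnNhd.eval_mvPolynomial (𝕜 := ℂ) (![T.P, T.Q] k) _ (Set.mem_univ _)).fun_comp
      (by fun_prop : AnalyticAt ℂ (fun ζ : ℂ => ζ • c + u) 0)
  have hi₀ : T.liftInf ((0 : ℂ) • c + u) i ≠ 0 := by rwa [zero_smul, zero_add]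
  have hquot := (han (i + 1)).fun_div (han i) hi₀
  have hopen := hquot.eventually_constant_or_nhds_le_map_nhds.resolve_left fun hconst => by
    let p := Projectivization.mk ℂ ((0 : ℂ) • c + u) (smul_add_ne_zero huc 0)
    have hfin : (T.fInf ⁻¹' {T.fInf p}).Finite :=
      Set.finite_of_encard_le_coe (T.encard_fInf_fibre_le hd _)
    refine infinite_of_mem_nhds (0 : ℂ) ?_ (hfin.preimage (mk_smul_add_injective huc).injOn)
    filter_upwards [hconst, (han i).continuousAt.eventually_ne hi₀] with ζ hζ hζi
    refine (Projectivization.mk_eq_mk_iff' ..).2 ⟨_, (eq_smul_of_div_eq_div hζi hi₀ hζ).symm⟩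
  simpa only [zero_smul, zero_add] using hopen

theorem eventually_exists_eq_smul_liftInf (hd : d ≠ 0) {u : CV 2} (hu : u ≠ 0) {B : Set (CV 2)}
    (hB : B ∈ 𝓝 u) : ∀ᶠ b in 𝓝 (T.liftInf u), ∃ v ∈ B, ∃ t : ℂ, b = t • T.liftInf v := by
  obtain ⟨c, hc⟩ := exists_mul_sub_mul_ne_zero hu
  have huc : c 0 * u 1 - c 1 * u 0 ≠ 0 := fun h => hc (by linear_combination -h)
  obtain ⟨i, hi⟩ : ∃ i, T.liftInf u i ≠ 0 := Function.ne_iff.1 (T.liftInf_ne_zero hu)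
  have hline : Tendsto (fun ζ : ℂ => ζ • c + u) (𝓝 0) (𝓝 u) := by
    have : Continuous fun ζ : ℂ => ζ • c + u := by fun_prop
    simpa using this.tendsto 0
  have hcoord : ContinuousAt (fun b : CV 2 => b i) (T.liftInf u) :=
    (continuous_apply i).continuousAt
  have hquot : Tendsto (fun b : CV 2 => b (i + 1) / b i) (𝓝 (T.liftInf u))
      (𝓝 (T.liftInf u (i + 1) / T.liftInf u i)) :=
    ContinuousAt.div (continuous_apply (i + 1)).continuousAt hcoord hi
  have hne : ∀ᶠ v in 𝓝 u, T.liftInf v i ≠ 0 :=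
    (T.continuous_liftInf.continuousAt.eventually (hcoord.eventually_ne hi))
  have himage := hquot (T.nhds_le_map_liftInf_line hd huc hi
    (image_mem_map (hline (inter_mem hB hne))))
  filter_upwards [himage, hcoord.eventually_ne hi] with b ⟨ζ, ⟨hζB, hζi⟩, hζ⟩ hbi
  exact ⟨_, hζB, _, eq_smul_of_div_eq_div hbi hζi hζ.symm⟩

theorem nhds_le_map_liftInf (hd : d ≠ 0) {u : CV 2} (hu : u ≠ 0) :
    𝓝 (T.liftInf u) ≤ map T.liftInf (𝓝 u) :=
  nhds_le_map_of_homogeneous hd T.continuous_liftInf.continuousAt T.liftInf_smul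
    (T.liftInf_ne_zero hu) fun _ hB => T.eventually_exists_eq_smul_liftInf hd hu hB

end HomTriple

/-! ### The regions `U_ρ` -/

/-- The first two coordinates of a point of `ℂ³`, that is, its projection from `[0 : 0 : 1]` to
the line at infinity. -/
def head (x : CV 3) : CV 2 := x ∘ Fin.castSucc

/-- The point of `ℂ³` with given `head` and given last coordinate. -/
def glue (u : CV 2) (t : ℂ) : CV 3 := ![u 0, u 1, t]

theorem head_glue (u : CV 2) (t : ℂ) : head (glue u t) = u := by
  funext i; fin_cases i <;> rfl

theorem glue_two (u : CV 2) (t : ℂ) : glue u t 2 = t := rfl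

theorem glue_head (x : CV 3) : glue (head x) (x 2) = x := by
  funext i; fin_cases i <;> rfl

theorem ext_head {x y : CV 3} (h : head x = head y) (h₂ : x 2 = y 2) : x = y := by
  rw [← glue_head x, ← glue_head y, h, h₂]

theorem head_zero : head 0 = 0 := rfl

theorem head_smul (c : ℂ) (x : CV 3) : head (c • x) = c • head x := rfl

@[fun_prop]
theorem continuous_head : Continuous head := by
  unfold head; fun_prop

/-- `glue` as a homeomorphism. -/
def glueHomeomorph : CV 2 × ℂ ≃ₜ CV 3 where
  toFun p := glue p.1 p.2
  invFun x := (head x, x 2)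
  left_inv p := Prod.ext (head_glue p.1 p.2) (glue_two p.1 p.2)
  right_inv := glue_head
  continuous_toFun := by
    refine continuous_pi fun i => ?_
    fin_cases i
    · exact (continuous_apply (0 : Fin 2)).comp continuous_fst
    · exact (continuous_apply (1 : Fin 2)).comp continuous_fst
    · exact continuous_snd
  continuous_invFun := by fun_prop

theorem norm_head (x : CV 3) : ‖head x‖ = max ‖x 0‖ ‖x 1‖ := by
  refine le_antisymm ((pi_norm_le_iff_of_nonneg (by positivity)).2 fun i => ?_)
    (max_le (norm_le_pi_norm (head x) 0) (norm_le_pi_norm (head x) 1))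
  fin_cases i
  · exact le_max_left _ _
  · exact le_max_right _ _

theorem ne_zero_of_head_ne_zero {x : CV 3} (h : head x ≠ 0) : x ≠ 0 := by
  rintro rfl; exact h head_zero

theorem glue_ne_zero {u : CV 2} (hu : u ≠ 0) (t : ℂ) : glue u t ≠ 0 :=
  ne_zero_of_head_ne_zero (by rwa [head_glue])

theorem head_ne_zero_of_norm_lt {ρ : ℝ} {x : CV 3} (h : ‖x 2‖ < ρ * ‖head x‖) : head x ≠ 0 := by
  intro h₀
  rw [h₀, norm_zero, mul_zero] at h
  exact (norm_nonneg _).not_gt h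

theorem head_ne_zero_of_norm_le {ρ : ℝ} {x : CV 3} (hx : x ≠ 0) (h : ‖x 2‖ ≤ ρ * ‖head x‖) :
    head x ≠ 0 := by
  intro h₀
  rw [h₀, norm_zero, mul_zero, norm_le_zero_iff] at h
  exact hx (ext_head h₀ h)

theorem mk_mem_regionU {ρ : ℝ} {x : CV 3} (hx : x ≠ 0) :
    Projectivization.mk ℂ x hx ∈ regionU ρ ↔ ‖x 2‖ < ρ * ‖head x‖ := by
  constructor
  · rintro ⟨y, hy, hxy, h⟩
    obtain ⟨c, rfl⟩ := (Projectivization.mk_eq_mk_iff' ..).1 hxy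
    have hc : 0 < ‖c‖ := norm_pos_iff.2 (left_ne_zero_of_smul hx)
    rw [← norm_head] at h
    rw [head_smul, Pi.smul_apply, smul_eq_mul, norm_mul, norm_smul, mul_left_comm]
    exact mul_lt_mul_of_pos_left h hc
  · intro h
    exact ⟨x, hx, rfl, by rwa [← norm_head]⟩

theorem head_ne_zero_of_mem_cone_regionU {ρ : ℝ} {x : CV 3} (h : x ∈ cone (regionU ρ)) :
    head x ≠ 0 :=
  let ⟨hx, hxU⟩ := h
  head_ne_zero_of_norm_lt ((mk_mem_regionU hx).1 hxU)

theorem isOpen_regionU (ρ : ℝ) : IsOpen (regionU ρ) := by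
  have hcone : cone (regionU ρ) = {x : CV 3 | ‖x 2‖ < ρ * ‖head x‖} := by
    ext x
    refine ⟨fun ⟨hx, h⟩ => (mk_mem_regionU hx).1 h, fun h => ?_⟩
    have hx := ne_zero_of_head_ne_zero (head_ne_zero_of_norm_lt h)
    exact ⟨hx, (mk_mem_regionU hx).2 h⟩
  rw [← isOpen_cone_iff, hcone]
  exact isOpen_lt (by fun_prop) (by fun_prop)

/-- The closed region `|t| ≤ ρ max(|z|, |w|)`. -/
def closedRegion (ρ : ℝ) : Set (PS 3) :=
  {p | ∀ (x : CV 3) (hx : x ≠ 0), p = Projectivization.mk ℂ x hx → ‖x 2‖ ≤ ρ * ‖head x‖}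

theorem mk_mem_closedRegion {ρ : ℝ} {x : CV 3} (hx : x ≠ 0) :
    Projectivization.mk ℂ x hx ∈ closedRegion ρ ↔ ‖x 2‖ ≤ ρ * ‖head x‖ := by
  refine ⟨fun h => h x hx rfl, fun h y hy hxy => ?_⟩
  obtain ⟨c, rfl⟩ := (Projectivization.mk_eq_mk_iff' ..).1 hxy
  have hc : 0 < ‖c‖ := norm_pos_iff.2 (left_ne_zero_of_smul hx)
  rw [head_smul, Pi.smul_apply, smul_eq_mul, norm_mul, norm_smul, mul_left_comm] at h
  exact le_of_mul_le_mul_left h hc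

theorem isClosed_closedRegion (ρ : ℝ) : IsClosed (closedRegion ρ) := by
  have hcone : cone (closedRegion ρ)ᶜ = {x : CV 3 | ρ * ‖head x‖ < ‖x 2‖} := by
    ext x
    refine ⟨fun ⟨hx, h⟩ => not_le.1 ((mk_mem_closedRegion hx).not.1 h), fun h => ?_⟩
    have hx : x ≠ 0 := by
      rintro rfl
      simp [head_zero] at h
    exact ⟨hx, (mk_mem_closedRegion hx).not.2 (not_le.2 h)⟩
  rw [← isOpen_compl_iff, ← isOpen_cone_iff, hcone]
  exact isOpen_lt (by fun_prop) (by fun_prop)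

theorem closedRegion_subset_regionU {ρ ρ' : ℝ} (h : ρ < ρ') : closedRegion ρ ⊆ regionU ρ' := by
  intro p hp
  induction p using Projectivization.ind with
  | h x hx =>
    rw [mk_mem_closedRegion hx] at hp
    rw [mk_mem_regionU hx]
    have := norm_pos_iff.2 (head_ne_zero_of_norm_le hx hp)
    exact hp.trans_lt (by gcongr)

theorem isTrappingRegion_iterate_image {n : ℕ} {g : PS n → PS n} {U : Set (PS n)}
    (hg : Continuous g) (hU : IsTrappingRegion g U) (hopen : IsOpen (g '' U)) (k : ℕ) :
    IsTrappingRegion g^[k + 1] (g '' U) := by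
  obtain ⟨-, hcompact, hclosure⟩ := hU
  have hmaps : Set.MapsTo g (g '' U) (g '' U) := fun p hp => ⟨p, hclosure (subset_closure hp), rfl⟩
  have himage : g^[k + 1] '' (g '' U) ⊆ g '' closure (g '' U) := by
    rintro _ ⟨p, hp, rfl⟩
    rw [Function.iterate_succ_apply']
    exact ⟨_, subset_closure (hmaps.iterate k hp), rfl⟩
  exact ⟨hopen, isClosed_closure.isCompact,
    (closure_minimal himage (hcompact.image hg).isClosed).trans (Set.image_mono hclosure)⟩

/-! ### The map `f` on the regions `U_ρ` -/

theorem nhds_le_map_prodMk_add {A B C E : Type*} [TopologicalSpace A] [TopologicalSpace B]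
    [TopologicalSpace C] [TopologicalSpace E] [AddGroup E] [ContinuousSub E]
    {g : A → C} {h : B → E} {k : A → E} {a : A} {b : B} (hg : 𝓝 (g a) ≤ map g (𝓝 a))
    (hh : 𝓝 (h b) ≤ map h (𝓝 b)) (hk : ContinuousAt k a) :
    𝓝 (g a, h b + k a) ≤ map (fun p : A × B => (g p.1, h p.2 + k p.1)) (𝓝 (a, b)) := by
  intro W hW
  rw [mem_map, nhds_prod_eq] at hW
  obtain ⟨M, hM, N, hN, hMN⟩ := mem_prod_iff.1 hW
  have hsub : Tendsto (fun p : A × E => p.2 - k p.1) (𝓝 (a, h b + k a)) (𝓝 (h b)) := by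
    have : ContinuousAt (fun p : A × E => p.2 - k p.1) (a, h b + k a) :=
      continuousAt_snd.sub (hk.comp continuousAt_fst)
    simpa [ContinuousAt] using this
  rw [nhds_prod_eq] at hsub
  obtain ⟨M', hM', N', hN', hMN'⟩ := mem_prod_iff.1 (hsub (hh (image_mem_map hN)))
  rw [nhds_prod_eq]
  filter_upwards [prod_mem_prod (hg (image_mem_map (inter_mem hM hM'))) hN']
  rintro ⟨_, e⟩ ⟨⟨a', ⟨haM, haM'⟩, rfl⟩, he⟩
  obtain ⟨b', hbN, hb'⟩ := hMN' (Set.mk_mem_prod haM' he)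
  have hbe : h b' + k a' = e := by rw [hb', sub_add_cancel]
  exact hbe ▸ hMN (Set.mk_mem_prod haM hbN)

namespace HomTriple

variable {d : ℕ} (T : HomTriple d)

/-- The lift `(z, w, t) ↦ (P(z, w), Q(z, w), t ^ d + ε R(z, w))` of `f` to `ℂ³`. -/
def lift (ε : ℂ) (x : CV 3) : CV 3 := fun i => MvPolynomial.eval x (T.poly ε i)

theorem lift_smul (ε t : ℂ) (x : CV 3) : T.lift ε (t • x) = t ^ d • T.lift ε x :=
  funext fun i => eval_smul_of_isHomogeneous (T.poly_isHomogeneous ε i) t x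

theorem lift_ne_zero (hd : d ≠ 0) (ε : ℂ) {x : CV 3} (hx : x ≠ 0) : T.lift ε x ≠ 0 := fun h =>
  hx (T.poly_common_zero hd ε x fun i => congrFun h i)

theorem f_mk (hd : d ≠ 0) (ε : ℂ) (x : CV 3) (hx : x ≠ 0) :
    T.f hd ε (Projectivization.mk ℂ x hx) =
      Projectivization.mk ℂ (T.lift ε x) (T.lift_ne_zero hd ε hx) :=
  rfl

theorem continuous_f (hd : d ≠ 0) (ε : ℂ) : Continuous (T.f hd ε) := continuous_projMap _ _ _

theorem head_lift (ε : ℂ) (x : CV 3) : head (T.lift ε x) = T.liftInf (head x) := by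
  funext i
  fin_cases i <;> simp [head, lift, liftInf, poly, MvPolynomial.eval_rename]

theorem lift_two (ε : ℂ) (x : CV 3) : T.lift ε x 2 = x 2 ^ d + ε * T.evalR (head x) := by
  simp [head, lift, evalR, poly, MvPolynomial.eval_rename]

theorem nhds_le_map_lift (hd : d ≠ 0) (ε : ℂ) {x : CV 3} (hx : head x ≠ 0) :
    𝓝 (T.lift ε x) ≤ map (T.lift ε) (𝓝 x) := by
  have : NeZero d := ⟨hd⟩
  have hglue : T.lift ε = glueHomeomorph ∘
      (fun p : CV 2 × ℂ => (T.liftInf p.1, p.2 ^ d + ε * T.evalR p.1)) ∘ glueHomeomorph.symm :=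
    funext fun y => by
      rw [← glue_head (T.lift ε y), head_lift, lift_two]
      rfl
  rw [hglue, ← map_map, ← map_map, Homeomorph.map_nhds_eq, Function.comp_apply,
    ← Homeomorph.map_nhds_eq]
  exact map_mono (nhds_le_map_prodMk_add (k := fun u => ε * T.evalR u)
    (T.nhds_le_map_liftInf hd hx) ((Complex.isOpenQuotientMap_pow d).isOpenMap.nhds_le (x 2))
    (continuous_const.mul T.continuous_evalR).continuousAt)

theorem exists_mk_eq_lift_eq (hd : d ≠ 0) {ε : ℂ} {p : PS 3} {y : CV 3} (hy : y ≠ 0)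
    (h : T.f hd ε p = Projectivization.mk ℂ y hy) :
    ∃ (x : CV 3) (hx : x ≠ 0), Projectivization.mk ℂ x hx = p ∧ T.lift ε x = y := by
  induction p using Projectivization.ind with
  | h x hx =>
    obtain ⟨a, ha⟩ := (Projectivization.mk_eq_mk_iff' ..).1 h.symm
    obtain ⟨t, rfl⟩ := IsAlgClosed.exists_pow_nat_eq a hd.pos
    have ht : t ≠ 0 := by
      rintro rfl
      rw [zero_pow hd, zero_smul] at ha
      exact hy ha.symm
    exact ⟨t • x, smul_ne_zero ht hx, (Projectivization.mk_eq_mk_iff' ..).2 ⟨t, rfl⟩,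
      (T.lift_smul ε t x).trans ha⟩

theorem cone_image_f (hd : d ≠ 0) (ε : ℂ) (V : Set (PS 3)) :
    cone (T.f hd ε '' V) = T.lift ε '' cone V := by
  ext y
  constructor
  · rintro ⟨hy, p, hp, hpy⟩
    obtain ⟨x, hx, rfl, hxy⟩ := T.exists_mk_eq_lift_eq hd hy hpy
    exact ⟨x, ⟨hx, hp⟩, hxy⟩
  · rintro ⟨x, ⟨hx, hp⟩, rfl⟩
    exact ⟨T.lift_ne_zero hd ε hx, _, hp, T.f_mk hd ε x hx⟩

theorem isOpen_image_f (hd : d ≠ 0) (ε : ℂ) {V : Set (PS 3)} (hV : IsOpen V)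
    (hhead : ∀ x ∈ cone V, head x ≠ 0) : IsOpen (T.f hd ε '' V) := by
  rw [← isOpen_cone_iff] at *
  rw [cone_image_f, isOpen_iff_mem_nhds]
  rintro _ ⟨x, hx, rfl⟩
  exact T.nhds_le_map_lift hd ε (hhead x hx) (image_mem_map (hV.mem_nhds hx))

theorem image_f_regionU_subset {c C ρ : ℝ} {ε : ℂ} (hd : d ≠ 0) (hρ : 0 ≤ ρ)
    (hG : ∀ u, c * ‖u‖ ^ d ≤ ‖T.liftInf u‖) (hR : ∀ u, ‖T.evalR u‖ ≤ C * ‖u‖ ^ d)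
    (h : 2 * (ρ ^ d + ‖ε‖ * C) ≤ c * ρ) :
    T.f hd ε '' regionU ρ ⊆ closedRegion (ρ / 2) := by
  rintro _ ⟨p, hp, rfl⟩
  induction p using Projectivization.ind with
  | h x hx =>
    rw [mk_mem_regionU] at hp
    rw [f_mk, mk_mem_closedRegion, head_lift, lift_two]
    calc ‖x 2 ^ d + ε * T.evalR (head x)‖
      _ ≤ ‖x 2‖ ^ d + ‖ε‖ * ‖T.evalR (head x)‖ := by
        simpa only [norm_pow, norm_mul] using norm_add_le (x 2 ^ d) (ε * T.evalR (head x))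
      _ ≤ (ρ * ‖head x‖) ^ d + ‖ε‖ * (C * ‖head x‖ ^ d) := by
        gcongr
        exact hR _
      _ = (ρ ^ d + ‖ε‖ * C) * ‖head x‖ ^ d := by ring
      _ ≤ c * ρ / 2 * ‖head x‖ ^ d := by
        gcongr
        linarith
      _ = ρ / 2 * (c * ‖head x‖ ^ d) := by ring
      _ ≤ ρ / 2 * ‖T.liftInf (head x)‖ := by
        gcongr
        exact hG _

theorem isTrappingRegion_regionU (hd : d ≠ 0) {ε : ℂ} {ρ : ℝ} (hρ : 0 < ρ)
    (h : T.f hd ε '' regionU ρ ⊆ closedRegion (ρ / 2)) :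
    IsTrappingRegion (T.f hd ε) (regionU ρ) :=
  ⟨isOpen_regionU ρ, isClosed_closure.isCompact,
    (closure_minimal h (isClosed_closedRegion _)).trans
      (closedRegion_subset_regionU (half_lt_self hρ))⟩

end HomTriple

/-! ### Counting preimages -/

section Fibres

variable {α β γ : Type*}

theorem encard_biUnion_le_mul {S : Set α} {U : α → Set β} {m k : ℕ}
    (hS : S.encard ≤ m) (hU : ∀ x ∈ S, (U x).encard ≤ k) :
    (⋃ x ∈ S, U x).encard ≤ (m * k : ℕ) := by
  have hSfin : S.Finite := Set.finite_of_encard_le_coe hS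
  have hcard : hSfin.toFinset.card ≤ m := by
    rwa [hSfin.encard_eq_coe_toFinset_card, Nat.cast_le] at hS
  calc (⋃ x ∈ S, U x).encard
    _ = (⋃ x ∈ hSfin.toFinset, U x).encard := by simp only [hSfin.mem_toFinset]
    _ ≤ ∑ x ∈ hSfin.toFinset, (U x).encard := Finset.set_encard_biUnion_le _ _
    _ ≤ hSfin.toFinset.card • (k : ℕ∞) :=
      Finset.sum_le_card_nsmul _ _ _ fun x hx => hU x (hSfin.mem_toFinset.1 hx)
    _ ≤ (m * k : ℕ) := by
      rw [nsmul_eq_mul]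
      exact_mod_cast Nat.mul_le_mul_right k hcard

theorem encard_comp_fibre_le_mul {φ : α → β} {ψ : β → γ} {V : Set α} {W : Set β}
    (hφ : Set.MapsTo φ V W) {c : γ} {m k : ℕ} (hψ : (ψ ⁻¹' {c} ∩ W).encard ≤ m)
    (hfib : ∀ b ∈ ψ ⁻¹' {c} ∩ W, (φ ⁻¹' {b} ∩ V).encard ≤ k) :
    (ψ ∘ φ ⁻¹' {c} ∩ V).encard ≤ (m * k : ℕ) := by
  refine (Set.encard_le_encard fun a ha => ?_).trans (encard_biUnion_le_mul hψ hfib)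
  exact Set.mem_biUnion (show φ a ∈ ψ ⁻¹' {c} ∩ W from ⟨ha.1, hφ ha.2⟩) ⟨rfl, ha.2⟩

/-- Among three consecutive points of an orbit one is outside `N`, so passing to the preimages
of that point does not increase their number. -/
theorem encard_iterate_three_fibre_le {φ : α → α} {W N : Set α} {d : ℕ} (hφ : Set.MapsTo φ W W)
    (hle : ∀ p, (φ ⁻¹' {p} ∩ W).encard ≤ d) (hone : ∀ p ∉ N, (φ ⁻¹' {p} ∩ W).encard ≤ 1)
    (hN : ∀ q ∈ W, ¬ (q ∈ N ∧ φ q ∈ N ∧ φ (φ q) ∈ N)) (p : α) :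
    (φ^[3] ⁻¹' {p} ∩ W).encard ≤ (d * d : ℕ) := by
  have hone' : ∀ p ∉ N, (φ ⁻¹' {p} ∩ W).encard ≤ (1 : ℕ) := by simpa using hone
  have hcomp : φ^[3] = φ ∘ φ ∘ φ := rfl
  rw [hcomp]
  by_cases hp : p ∈ N
  · refine encard_comp_fibre_le_mul (hφ.comp hφ) (hle p) fun x hx => ?_
    by_cases hxN : x ∈ N
    · refine (encard_comp_fibre_le_mul hφ (hle x) fun y hy => hone' y fun hyN => ?_).trans_eq
        (congrArg _ (mul_one d))
      obtain ⟨rfl, hyW⟩ := hy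
      obtain ⟨rfl, -⟩ := hx
      exact hN y hyW ⟨hyN, hxN, hp⟩
    · exact (encard_comp_fibre_le_mul hφ (hone' x hxN) fun y _ => hle y).trans_eq
        (congrArg _ (one_mul d))
  · exact (encard_comp_fibre_le_mul (hφ.comp hφ) (hone' p hp) fun x _ =>
      encard_comp_fibre_le_mul hφ (hle x) fun y _ => hle y).trans_eq (congrArg _ (one_mul _))

end Fibres

theorem norm_le_mul_of_norm_mul_le {ε a : ℂ} {κ η r : ℝ} (hε : ε ≠ 0) (hr : 0 ≤ r)
    (hκ : 2 * κ ≤ η * ‖ε‖) (h : ‖ε * a‖ ≤ 2 * κ * r) : ‖a‖ ≤ η * r := by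
  rw [norm_mul] at h
  refine le_of_mul_le_mul_left ?_ (norm_pos_iff.2 hε)
  calc ‖ε‖ * ‖a‖ ≤ 2 * κ * r := h
    _ ≤ η * ‖ε‖ * r := by gcongr
    _ = ‖ε‖ * (η * r) := by ring

namespace HomTriple

variable {d : ℕ} (T : HomTriple d)

/-- `x` is a lift of a preimage of `[y]` by `f`, and satisfies the estimates that are available
when `[x]` is in `f(U_ρ)`, with `κ` of the order of `ρ ^ d`. -/
structure IsNearPreimage (ε : ℂ) (κ : ℝ) (y x : CV 3) : Prop where
  head_ne_zero : head x ≠ 0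
  lift_eq : T.lift ε x = y
  norm_two_sub_le : ‖y 2 - ε * T.evalR (head x)‖ ≤ κ * ‖head y‖
  exists_norm_sub_le : ∃ v : CV 2, T.liftInf v = head x ∧ ‖x 2 - ε * T.evalR v‖ ≤ κ * ‖head x‖

theorem norm_lift_two_sub_le {ε : ℂ} {ρ c : ℝ} (hc : 0 < c)
    (hG : ∀ u, c * ‖u‖ ^ d ≤ ‖T.liftInf u‖) {x : CV 3} (hx : ‖x 2‖ < ρ * ‖head x‖) :
    ‖T.lift ε x 2 - ε * T.evalR (head x)‖ ≤ ρ ^ d / c * ‖head (T.lift ε x)‖ := by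
  have hρ : 0 ≤ ρ := (pos_of_mul_pos_left ((norm_nonneg _).trans_lt hx) (norm_nonneg _)).le
  rw [lift_two, head_lift, add_sub_cancel_right, norm_pow]
  calc ‖x 2‖ ^ d
    _ ≤ (ρ * ‖head x‖) ^ d := by gcongr
    _ = ρ ^ d / c * (c * ‖head x‖ ^ d) := by rw [mul_pow, ← mul_assoc, div_mul_cancel₀ _ hc.ne']
    _ ≤ ρ ^ d / c * ‖T.liftInf (head x)‖ := by
      gcongr
      exact hG _

theorem exists_mk_eq_isNearPreimage (hd : d ≠ 0) {ε : ℂ} {ρ c : ℝ} (hc : 0 < c)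
    (hG : ∀ u, c * ‖u‖ ^ d ≤ ‖T.liftInf u‖) (hU : T.f hd ε '' regionU ρ ⊆ regionU ρ)
    {y : CV 3} (hy : y ≠ 0) {p : PS 3}
    (hp : p ∈ T.f hd ε ⁻¹' {Projectivization.mk ℂ y hy} ∩ T.f hd ε '' regionU ρ) :
    ∃ (x : CV 3) (hx : x ≠ 0), Projectivization.mk ℂ x hx = p ∧
      T.IsNearPreimage ε (ρ ^ d / c) y x := by
  obtain ⟨hpy, hpU⟩ := hp
  obtain ⟨x, hx, rfl, rfl⟩ := T.exists_mk_eq_lift_eq hd hy hpy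
  have hxU : ‖x 2‖ < ρ * ‖head x‖ := (mk_mem_regionU hx).1 (hU hpU)
  obtain ⟨q, hq, hqx⟩ := hpU
  obtain ⟨w, hw, rfl, rfl⟩ := T.exists_mk_eq_lift_eq hd hx hqx
  exact ⟨_, hx, rfl, head_ne_zero_of_norm_lt hxU, rfl, T.norm_lift_two_sub_le hc hG hxU, head w,
    (T.head_lift ε w).symm, T.norm_lift_two_sub_le hc hG ((mk_mem_regionU hw).1 hq)⟩

namespace IsNearPreimage

variable {T} {ε : ℂ} {κ η : ℝ} {y x x' : CV 3}

theorem smul (hd : d ≠ 0) (h : T.IsNearPreimage ε κ y x) {c : ℂ} (hc : c ^ d = 1) :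
    T.IsNearPreimage ε κ y (c • x) := by
  have hc₀ : c ≠ 0 := by
    rintro rfl
    exact zero_ne_one ((zero_pow hd).symm.trans hc)
  obtain ⟨t, rfl⟩ := IsAlgClosed.exists_pow_nat_eq c hd.pos
  obtain ⟨v, hv, hv'⟩ := h.exists_norm_sub_le
  refine ⟨smul_ne_zero hc₀ h.head_ne_zero, ?_, ?_, t • v, ?_, ?_⟩
  · rw [T.lift_smul, hc, one_smul, h.lift_eq]
  · rw [head_smul, T.evalR_smul, hc, one_mul]
    exact h.norm_two_sub_le
  · rw [T.liftInf_smul, hv, head_smul]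
  · rw [T.evalR_smul, head_smul, norm_smul, Pi.smul_apply, smul_eq_mul, mul_left_comm, ← mul_sub,
      norm_mul, mul_left_comm]
    gcongr

theorem liftInf_head (h : T.IsNearPreimage ε κ y x) : T.liftInf (head x) = head y := by
  rw [← h.lift_eq, head_lift]

theorem pow_eq_one (h : T.IsNearPreimage ε κ y x) (h' : T.IsNearPreimage ε κ y x') {c : ℂ}
    (hc : head x = c • head x') : c ^ d = 1 := by
  have : c ^ d • T.liftInf (head x') = (1 : ℂ) • T.liftInf (head x') := by
    rw [one_smul, ← T.liftInf_smul, ← hc, h.liftInf_head, h'.liftInf_head]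
  exact smul_left_injective ℂ (T.liftInf_ne_zero h'.head_ne_zero) this

theorem exists_head_eq_smul_of_not_nearX (hε : ε ≠ 0) (hκ : 2 * κ ≤ η * ‖ε‖)
    (h : T.IsNearPreimage ε κ y x) (h' : T.IsNearPreimage ε κ y x')
    (hX : ¬ T.NearX η (head y)) : ∃ c : ℂ, head x = c • head x' := by
  by_contra! hne
  refine hX ⟨head x, head x', h.liftInf_head, h'.liftInf_head, hne,
    norm_le_mul_of_norm_mul_le hε (norm_nonneg _) hκ ?_⟩
  calc ‖ε * (T.evalR (head x) - T.evalR (head x'))‖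
    _ = ‖(y 2 - ε * T.evalR (head x')) - (y 2 - ε * T.evalR (head x))‖ := by congr 1; ring
    _ ≤ κ * ‖head y‖ + κ * ‖head y‖ :=
      (norm_sub_le _ _).trans (add_le_add h'.norm_two_sub_le h.norm_two_sub_le)
    _ = 2 * κ * ‖head y‖ := by ring

theorem pow_two_eq (h : T.IsNearPreimage ε κ y x) (h' : T.IsNearPreimage ε κ y x')
    (hh : head x = head x') : x 2 ^ d = x' 2 ^ d := by
  have h₂ := congrFun (h.lift_eq.trans h'.lift_eq.symm) 2
  rw [lift_two, lift_two, hh] at h₂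
  exact add_right_cancel h₂

theorem eq_of_not_nearY (hd : d ≠ 0) (hε : ε ≠ 0) (hκ : 2 * κ ≤ η * ‖ε‖)
    (h : T.IsNearPreimage ε κ y x) (h' : T.IsNearPreimage ε κ y x')
    (hY : ¬ T.NearY η (head y)) (hh : head x = head x') : x = x' := by
  refine ext_head hh ?_
  by_contra hne
  have hpow := h.pow_two_eq h' hh
  have hx' : x' 2 ≠ 0 := fun h₀ => hne <| by
    rw [h₀, zero_pow hd] at hpow
    rw [h₀, eq_zero_of_pow_eq_zero hpow]
  obtain ⟨v, hv, hv'⟩ := h.exists_norm_sub_le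
  obtain ⟨w, hw, hw'⟩ := h'.exists_norm_sub_le
  let ξ := x 2 / x' 2
  have hξ : ξ ^ d = 1 := by rw [div_pow, hpow, div_self (pow_ne_zero _ hx')]
  have hξx' : ξ * x' 2 = x 2 := div_mul_cancel₀ _ hx'
  refine hY ⟨v, w, ξ, by rw [hv, hw, hh], by rw [hv, h.liftInf_head], hξ,
    fun h₁ => hne ((div_eq_one_iff_eq hx').1 h₁),
    norm_le_mul_of_norm_mul_le hε (norm_nonneg _) hκ ?_⟩
  rw [hv]
  calc ‖ε * (T.evalR v - ξ * T.evalR w)‖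
    _ = ‖ξ * (x' 2 - ε * T.evalR w) - (x 2 - ε * T.evalR v)‖ := by
      congr 1
      linear_combination -hξx'
    _ ≤ κ * ‖head x'‖ + κ * ‖head x‖ := by
      refine (norm_sub_le _ _).trans (add_le_add ?_ hv')
      rwa [norm_mul, Complex.norm_eq_one_of_pow_eq_one hξ hd, one_mul]
    _ = 2 * κ * ‖head x‖ := by rw [hh]; ring

theorem eq_smul_of_not_nearY (hd : d ≠ 0) (hε : ε ≠ 0) (hκ : 2 * κ ≤ η * ‖ε‖)
    (h : T.IsNearPreimage ε κ y x) (h' : T.IsNearPreimage ε κ y x')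
    (hY : ¬ T.NearY η (head y)) {c : ℂ} (hc : head x = c • head x') : x = c • x' :=
  h.eq_of_not_nearY hd hε hκ (h'.smul hd (h.pow_eq_one h' hc)) hY (by rw [hc, head_smul])

end IsNearPreimage

variable {ε : ℂ} {ρ c η : ℝ}

theorem encard_f_fibre_le_of_not_nearY (hd : d ≠ 0) (hc : 0 < c) (hε : ε ≠ 0)
    (hG : ∀ u, c * ‖u‖ ^ d ≤ ‖T.liftInf u‖) (hU : T.f hd ε '' regionU ρ ⊆ regionU ρ)
    (hκ : 2 * (ρ ^ d / c) ≤ η * ‖ε‖) {y : CV 3} (hy : head y ≠ 0)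
    (hY : ¬ T.NearY η (head y)) :
    (T.f hd ε ⁻¹' {Projectivization.mk ℂ y (ne_zero_of_head_ne_zero hy)} ∩
      T.f hd ε '' regionU ρ).encard ≤ d := by
  choose x hx hxp hnear using fun p : ↥(T.f hd ε ⁻¹' {Projectivization.mk ℂ y
    (ne_zero_of_head_ne_zero hy)} ∩ T.f hd ε '' regionU ρ) =>
      T.exists_mk_eq_isNearPreimage hd hc hG hU (ne_zero_of_head_ne_zero hy) p.2
  let e : _ → T.fInf ⁻¹' {Projectivization.mk ℂ (head y) hy} := fun p =>
    ⟨Projectivization.mk ℂ (head (x p)) (hnear p).head_ne_zero, by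
      simp only [Set.mem_preimage, Set.mem_singleton_iff, T.fInf_mk, (hnear p).liftInf_head]⟩
  have he : e.Injective := fun p q hpq => by
    obtain ⟨a, ha⟩ := (Projectivization.mk_eq_mk_iff' ..).1 (congrArg Subtype.val hpq)
    have hxpq := (hnear p).eq_smul_of_not_nearY hd hε hκ (hnear q) hY ha.symm
    exact Subtype.ext ((hxp p).symm.trans
      (((Projectivization.mk_eq_mk_iff' ..).2 ⟨a, hxpq.symm⟩).trans (hxp q)))
  exact (Function.Embedding.encard_le ⟨e, he⟩).trans (T.encard_fInf_fibre_le hd _)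

theorem encard_f_fibre_le_of_not_nearX (hd : d ≠ 0) (hc : 0 < c) (hε : ε ≠ 0)
    (hG : ∀ u, c * ‖u‖ ^ d ≤ ‖T.liftInf u‖) (hU : T.f hd ε '' regionU ρ ⊆ regionU ρ)
    (hκ : 2 * (ρ ^ d / c) ≤ η * ‖ε‖) {y : CV 3} (hy : y ≠ 0) (hX : ¬ T.NearX η (head y)) :
    (T.f hd ε ⁻¹' {Projectivization.mk ℂ y hy} ∩ T.f hd ε '' regionU ρ).encard ≤ d := by
  obtain hempty | ⟨q, hq⟩ := (T.f hd ε ⁻¹' {Projectivization.mk ℂ y hy} ∩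
    T.f hd ε '' regionU ρ).eq_empty_or_nonempty
  · simp [hempty]
  obtain ⟨x₀, -, -, h₀⟩ := T.exists_mk_eq_isNearPreimage hd hc hG hU hy hq
  let roots := (Polynomial.nthRoots d (y 2 - ε * T.evalR (head x₀))).toFinset
  have hsub : T.f hd ε ⁻¹' {Projectivization.mk ℂ y hy} ∩ T.f hd ε '' regionU ρ ⊆
      (fun t => Projectivization.mk ℂ (glue (head x₀) t) (glue_ne_zero h₀.head_ne_zero t)) ''
        (roots : Set ℂ) := by
    intro p hp
    obtain ⟨x, hx, rfl, h⟩ := T.exists_mk_eq_isNearPreimage hd hc hG hU hy hp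
    obtain ⟨a, ha⟩ := h₀.exists_head_eq_smul_of_not_nearX hε hκ h hX
    have hax : head x₀ = head (a • x) := ha.trans (head_smul a x).symm
    have hlift := (h.smul hd (h₀.pow_eq_one h ha)).lift_eq
    refine ⟨(a • x) 2, ?_, (Projectivization.mk_eq_mk_iff' ..).2 ⟨a, ?_⟩⟩
    · rw [Finset.mem_coe, Multiset.mem_toFinset, Polynomial.mem_nthRoots hd.pos, ← hlift, lift_two,
        hax, add_sub_cancel_right]
    · rw [hax, glue_head]
  calc _ ≤ (roots : Set ℂ).encard := (Set.encard_le_encard hsub).trans (Set.encard_image_le _ _)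
    _ ≤ d := by
      rw [Set.encard_coe_eq_coe_finsetCard]
      exact Nat.cast_le.2 ((Multiset.toFinset_card_le _).trans (Polynomial.card_nthRoots _ _))

theorem encard_f_fibre_le (hd : d ≠ 0) (hc : 0 < c) (hε : ε ≠ 0)
    (hG : ∀ u, c * ‖u‖ ^ d ≤ ‖T.liftInf u‖) (hU : T.f hd ε '' regionU ρ ⊆ regionU ρ)
    (hκ : 2 * (ρ ^ d / c) ≤ η * ‖ε‖)
    (hXY : ∀ b : CV 2, b ≠ 0 → ¬ (T.NearX η b ∧ T.NearY η b)) (p : PS 3) :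
    (T.f hd ε ⁻¹' {p} ∩ T.f hd ε '' regionU ρ).encard ≤ d := by
  induction p using Projectivization.ind with
  | h y hy =>
    by_cases hX : T.NearX η (head y)
    · by_cases hy₀ : head y = 0
      · have hempty : T.f hd ε ⁻¹' {Projectivization.mk ℂ y hy} ∩ T.f hd ε '' regionU ρ = ∅ := by
          refine Set.eq_empty_of_forall_notMem fun p hp => ?_
          obtain ⟨x, -, -, h⟩ := T.exists_mk_eq_isNearPreimage hd hc hG hU hy hp
          exact T.liftInf_ne_zero h.head_ne_zero (h.liftInf_head.trans hy₀)
        simp [hempty]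
      · exact T.encard_f_fibre_le_of_not_nearY hd hc hε hG hU hκ hy₀ fun hY => hXY _ hy₀ ⟨hX, hY⟩
    · exact T.encard_f_fibre_le_of_not_nearX hd hc hε hG hU hκ hy hX

/-- The points `[z : w : t]` such that `(z, w)` is near the cone over `Z`. -/
def nearZSet (η : ℝ) : Set (PS 3) :=
  {p | ∃ (y : CV 3) (hy : y ≠ 0), p = Projectivization.mk ℂ y hy ∧ T.NearZ η (head y)}

theorem mk_mem_nearZSet_iff (hd : d ≠ 0) {y : CV 3} (hy : y ≠ 0) :
    Projectivization.mk ℂ y hy ∈ T.nearZSet η ↔ T.NearZ η (head y) := by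
  refine ⟨?_, fun h => ⟨y, hy, rfl, h⟩⟩
  rintro ⟨z, hz, hyz, h⟩
  obtain ⟨a, rfl⟩ := (Projectivization.mk_eq_mk_iff' ..).1 hyz
  exact h.smul hd (left_ne_zero_of_smul hy)

theorem encard_f_fibre_le_one (hd : d ≠ 0) (hc : 0 < c) (hε : ε ≠ 0)
    (hG : ∀ u, c * ‖u‖ ^ d ≤ ‖T.liftInf u‖) (hU : T.f hd ε '' regionU ρ ⊆ regionU ρ)
    (hκ : 2 * (ρ ^ d / c) ≤ η * ‖ε‖) {p : PS 3} (hp : p ∉ T.nearZSet η) :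
    (T.f hd ε ⁻¹' {p} ∩ T.f hd ε '' regionU ρ).encard ≤ 1 := by
  induction p using Projectivization.ind with
  | h y hy =>
    obtain ⟨hX, hY⟩ := not_or.1 ((T.mk_mem_nearZSet_iff hd hy).not.1 hp)
    rw [Set.encard_le_one_iff]
    intro q q' hq hq'
    obtain ⟨x, hx, rfl, h⟩ := T.exists_mk_eq_isNearPreimage hd hc hG hU hy hq
    obtain ⟨x', hx', rfl, h'⟩ := T.exists_mk_eq_isNearPreimage hd hc hG hU hy hq'
    obtain ⟨a, ha⟩ := h.exists_head_eq_smul_of_not_nearX hε hκ h' hX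
    exact (Projectivization.mk_eq_mk_iff' ..).2
      ⟨a, (h.eq_smul_of_not_nearY hd hε hκ h' hY ha).symm⟩

theorem encard_f_iterate_three_fibre_le (hd : d ≠ 0) (hc : 0 < c) (hε : ε ≠ 0)
    (hG : ∀ u, c * ‖u‖ ^ d ≤ ‖T.liftInf u‖) (hU : T.f hd ε '' regionU ρ ⊆ regionU ρ)
    (hκ : 2 * (ρ ^ d / c) ≤ η * ‖ε‖)
    (hXY : ∀ b : CV 2, b ≠ 0 → ¬ (T.NearX η b ∧ T.NearY η b))
    (hZ : ∀ b : CV 2, b ≠ 0 →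
      ¬ (T.NearZ η b ∧ T.NearZ η (T.liftInf b) ∧ T.NearZ η (T.liftInf (T.liftInf b))))
    (p : PS 3) :
    ((T.f hd ε)^[3] ⁻¹' {p} ∩ T.f hd ε '' regionU ρ).encard ≤ (d * d : ℕ) := by
  have hmaps : Set.MapsTo (T.f hd ε) (T.f hd ε '' regionU ρ) (T.f hd ε '' regionU ρ) :=
    fun q hq => ⟨q, hU hq, rfl⟩
  refine encard_iterate_three_fibre_le (N := T.nearZSet η) hmaps
    (T.encard_f_fibre_le hd hc hε hG hU hκ hXY)
    (fun q hq => T.encard_f_fibre_le_one hd hc hε hG hU hκ hq) (fun q hq => ?_) p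
  induction q using Projectivization.ind with
  | h y hy =>
    simp only [f_mk, T.mk_mem_nearZSet_iff hd, head_lift]
    exact hZ _ (head_ne_zero_of_norm_lt ((mk_mem_regionU hy).1 (hU hq)))

end HomTriple

/-! ### Iterates and attracting sets -/

section Dynamics

variable {n a b : ℕ} {g h : PS n → PS n} {U V : Set (PS n)}

theorem isEndomorphism_id : IsEndomorphism (id : PS n → PS n) 1 := by
  refine ⟨MvPolynomial.X, MvPolynomial.isHomogeneous_X ℂ, fun x hx => funext fun i => ?_, ?_⟩
  · exact (MvPolynomial.eval_X i).symm.trans (hx i)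
  · funext p
    induction p using Projectivization.ind with
    | h x hx => simp only [id, projMap_mk, MvPolynomial.eval_X]

theorem IsEndomorphism.comp (hg : IsEndomorphism g a) (hh : IsEndomorphism h b) :
    IsEndomorphism (g ∘ h) (b * a) := by
  obtain ⟨A, hA, hA₀, rfl⟩ := hg
  obtain ⟨B, hB, hB₀, rfl⟩ := hh
  have heval : ∀ x i, MvPolynomial.eval x (MvPolynomial.aeval B (A i)) =
      MvPolynomial.eval (fun j => MvPolynomial.eval x (B j)) (A i) := fun x i => by
    rw [MvPolynomial.aeval_def, MvPolynomial.eval_eval₂, MvPolynomial.algebraMap_eq,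
      show (MvPolynomial.eval x).comp MvPolynomial.C = RingHom.id ℂ from
        RingHom.ext MvPolynomial.eval_C]
    rfl
  refine ⟨fun i => MvPolynomial.aeval B (A i), fun i => (hA i).aeval B hB, fun x hx => ?_, ?_⟩
  · simp only [heval] at hx
    exact hB₀ x fun i => congrFun (hA₀ _ hx) i
  · funext p
    induction p using Projectivization.ind with
    | h x hx => simp only [Function.comp, projMap_mk, heval]

theorem IsEndomorphism.iterate (hg : IsEndomorphism g a) (k : ℕ) :
    IsEndomorphism g^[k] (a ^ k) := by
  induction k with
  | zero => exact isEndomorphism_id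
  | succ k ih =>
    rw [Function.iterate_succ, pow_succ']
    exact ih.comp hg

theorem attractingSet_subset (g : PS n → PS n) (U : Set (PS n)) : attractingSet g U ⊆ U :=
  Set.iInter_subset_of_subset 0 (Set.image_id U).subset

theorem antitone_iterate_image (hU : g '' U ⊆ U) : Antitone fun k => g^[k] '' U :=
  antitone_nat_of_succ_le fun k => by
    rw [Function.iterate_succ, Set.image_comp]
    exact Set.image_mono hU

theorem IsTrappingRegion.image_subset (hU : IsTrappingRegion g U) : g '' U ⊆ U :=
  subset_closure.trans hU.2.2

theorem IsTrappingRegion.attractingSet_iterate_image (hU : IsTrappingRegion g U) (k : ℕ) :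
    attractingSet g^[k + 1] (g '' U) = attractingSet g U := by
  have himage : ∀ m, (g^[k + 1])^[m] '' (g '' U) = g^[(k + 1) * m + 1] '' U := fun m => by
    rw [← Function.iterate_mul, Function.iterate_succ, Set.image_comp]
  simp only [attractingSet, himage]
  refine subset_antisymm (Set.iInter_mono fun m => antitone_iterate_image hU.image_subset ?_)
    (Set.iInter_mono' fun m => ⟨_, subset_rfl⟩)
  exact (Nat.le_mul_of_pos_left m k.succ_pos).trans (Nat.le_succ _)

theorem IsTrappingRegion.exists_forall_iterate_image_subset (hg : Continuous g)
    (hU : IsTrappingRegion g U) (hV : IsOpen V) (hAV : attractingSet g U ⊆ V) :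
    ∃ N, ∀ k ≥ N, g^[k] '' U ⊆ V := by
  obtain ⟨-, hcomp, hsub⟩ := hU
  have hanti : Antitone fun k => g^[k] '' closure (g '' U) :=
    antitone_iterate_image ((Set.image_mono hsub).trans subset_closure)
  obtain ⟨N, hN⟩ := exists_subset_nhds_of_isCompact hanti.directed_ge
    (fun k => hcomp.image (hg.iterate k)) (U := V) fun x hx =>
      hV.mem_nhds (hAV (Set.iInter_mono (fun k => Set.image_mono hsub) hx))
  refine ⟨N + 1, fun k hk => ?_⟩
  obtain ⟨m, rfl⟩ := Nat.exists_eq_add_of_le' hk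
  calc g^[m + N + 1] '' U
    _ = g^[m + N] '' (g '' U) := by rw [Function.iterate_succ, Set.image_comp]
    _ ⊆ g^[m + N] '' closure (g '' U) := Set.image_mono subset_closure
    _ ⊆ V := (hanti (Nat.le_add_left N m)).trans hN

end Dynamics

/-! ### Pull-back of forms -/

section SmoothAlternating

variable {X E F : Type*} [NormedAddCommGroup X] [NormedSpace ℝ X] [NormedAddCommGroup E]
  [NormedSpace ℝ E] [NormedAddCommGroup F] [NormedSpace ℝ F] {n : WithTop ℕ∞} {r : ℕ}
  {s : Set X} {φ : X → E [⋀^Fin r]→L[ℝ] F}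

theorem contDiffOn_alternating_apply {v : Fin r → X → E} (hφ : ContDiffOn ℝ n φ s)
    (hv : ∀ i, ContDiffOn ℝ n (v i) s) : ContDiffOn ℝ n (fun x => φ x fun i => v i x) s :=
  let L : (E [⋀^Fin r]→L[ℝ] F) →L[ℝ] ContinuousMultilinearMap ℝ (fun _ : Fin r => E) F :=
    ContinuousAlternatingMap.toContinuousMultilinearMapCLM ℝ
  (L.analyticOnNhd_uncurry_of_multilinear.contDiffOn uniqueDiffOn_univ).comp
      (hφ.prodMk (contDiffOn_pi.2 hv)) (Set.mapsTo_univ _ _)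

theorem contDiffOn_alternating_iff [FiniteDimensional ℝ E] [FiniteDimensional ℝ F] :
    ContDiffOn ℝ n φ s ↔ ∀ v, ContDiffOn ℝ n (fun x => φ x v) s := by
  refine ⟨fun h v => contDiffOn_alternating_apply h fun _ => contDiffOn_const, fun h => ?_⟩
  let b := Module.finBasis ℝ E
  let coords : (E [⋀^Fin r]→L[ℝ] F) →ₗ[ℝ] ((Fin r → Fin (Module.finrank ℝ E)) → F) :=
    { toFun := fun ψ k => ψ fun i => b (k i)
      map_add' := fun _ _ => rfl
      map_smul' := fun _ _ => rfl }
  have hcoords : Function.Injective coords := fun ψ χ hψχ =>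
    ContinuousAlternatingMap.toContinuousMultilinearMap_injective
      (ContinuousMultilinearMap.toMultilinearMap_injective
        (Module.Basis.ext_multilinear (fun _ => b) (congrFun hψχ)))
  obtain ⟨L, hL⟩ :=
    LinearMap.exists_leftInverse_of_injective coords (LinearMap.ker_eq_bot.2 hcoords)
  have hφ : φ = fun x => LinearMap.toContinuousLinearMap L (coords (φ x)) :=
    funext fun x => (LinearMap.congr_fun hL (φ x)).symm
  rw [hφ]
  exact (LinearMap.toContinuousLinearMap L).contDiff.comp_contDiffOn (contDiffOn_pi.2 fun k => h _)

end SmoothAlternating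

section PullbackForm

variable {E F G : Type*} [NormedAddCommGroup E] [NormedSpace ℝ E] [NormedAddCommGroup F]
  [NormedSpace ℝ F] [NormedAddCommGroup G] [NormedSpace ℝ G] {r : ℕ} {H : E → F}
  {φ : F → F [⋀^Fin r]→L[ℝ] G}

/-- The pull-back `H^* φ` of a differential form. -/
def pullbackForm (H : E → F) (φ : F → F [⋀^Fin r]→L[ℝ] G) : E → E [⋀^Fin r]→L[ℝ] G :=
  fun z => (φ (H z)).compContinuousLinearMap (fderiv ℝ H z)

theorem pullbackForm_apply (z : E) (v : Fin r → E) :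
    pullbackForm H φ z v = φ (H z) fun i => fderiv ℝ H z (v i) := rfl

theorem contDiffOn_pullbackForm [FiniteDimensional ℝ E] [FiniteDimensional ℝ G] {s : Set E}
    {t : Set F} (hφ : ContDiffOn ℝ ∞ φ t) (hs : IsOpen s) (hH : ContDiffOn ℝ ∞ H s)
    (hst : Set.MapsTo H s t) : ContDiffOn ℝ ∞ (pullbackForm H φ) s :=
  contDiffOn_alternating_iff.2 fun v =>
    contDiffOn_alternating_apply (v := fun i z => fderiv ℝ H z (v i)) (hφ.comp hH hst) fun _ =>
      (hH.fderiv_of_isOpen hs (m := ∞) (by simp)).clm_apply contDiffOn_const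

theorem minSmoothness_real_two_le_infty : minSmoothness ℝ 2 ≤ ∞ := by
  rw [minSmoothness_of_isRCLikeNormedField]
  exact WithTop.coe_le_coe.2 le_top

theorem differentiableAt_of_contDiffOn_compl_zero {f : E → G} (hf : ContDiffOn ℝ ∞ f {0}ᶜ)
    {z : E} (hz : z ≠ 0) : DifferentiableAt ℝ f z :=
  (hf.contDiffAt (isOpen_compl_singleton.mem_nhds hz)).differentiableAt (by simp)

theorem extDeriv_pullbackForm {z : E} (hφ : DifferentiableAt ℝ φ (H z))
    (hH : ContDiffAt ℝ ∞ H z) : extDeriv (pullbackForm H φ) z = pullbackForm H (extDeriv φ) z :=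
  extDeriv_pullback hφ hH minSmoothness_real_two_le_infty

end PullbackForm

/-- A homogeneous holomorphic map of `ℂ³` without zeros outside the origin. -/
structure IsHomMap (δ : ℕ) (H : CV 3 → CV 3) : Prop where
  contDiff_complex : ContDiff ℂ ∞ H
  map_zero : H 0 = 0
  ne_zero : ∀ z, z ≠ 0 → H z ≠ 0
  map_smul : ∀ (c : ℂ) z, H (c • z) = c ^ δ • H z

namespace IsHomMap

variable {δ : ℕ} {H : CV 3 → CV 3}

theorem contDiff (hH : IsHomMap δ H) : ContDiff ℝ ∞ H := hH.contDiff_complex.restrict_scalars ℝ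

theorem hasFDerivAt_complex (hH : IsHomMap δ H) (z : CV 3) : HasFDerivAt H (fderiv ℂ H z) z :=
  (hH.contDiff_complex.differentiable (by simp) z).hasFDerivAt

theorem fderiv_real_apply (hH : IsHomMap δ H) (z v : CV 3) :
    fderiv ℝ H z v = fderiv ℂ H z v := by
  rw [(hH.hasFDerivAt_complex z).differentiableAt.fderiv_restrictScalars ℝ]
  rfl

theorem fderiv_apply_smul (hH : IsHomMap δ H) (c : ℂ) (z v : CV 3) :
    fderiv ℝ H z (c • v) = c • fderiv ℝ H z v := by
  rw [hH.fderiv_real_apply, hH.fderiv_real_apply, _root_.map_smul]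

theorem fderiv_apply_self (hH : IsHomMap δ H) (z : CV 3) :
    fderiv ℝ H z z = (δ : ℂ) • H z := by
  have hline : HasDerivAt (fun t : ℂ => t • z) z 1 := by
    simpa only [id, one_smul] using (hasDerivAt_id (1 : ℂ)).smul_const z
  have hchain : HasDerivAt (fun t : ℂ => H (t • z)) (fderiv ℂ H z z) 1 := by
    refine HasFDerivAt.comp_hasDerivAt (1 : ℂ) ?_ hline
    simpa only [one_smul] using hH.hasFDerivAt_complex z
  have hpow : HasDerivAt (fun t : ℂ => H (t • z)) ((δ : ℂ) • H z) 1 := by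
    simpa only [hH.map_smul, one_pow, mul_one] using (hasDerivAt_pow δ (1 : ℂ)).smul_const (H z)
  rw [hH.fderiv_real_apply, hchain.unique hpow]

theorem fderiv_smul_apply_smul (hH : IsHomMap δ H) (c : ℂ) (z v : CV 3) :
    fderiv ℝ H (c • z) (c • v) = c ^ δ • fderiv ℝ H z v := by
  have hchain : HasFDerivAt (fun x => H (c • x))
      ((fderiv ℂ H (c • z)).comp (c • ContinuousLinearMap.id ℂ (CV 3))) z :=
    (hH.hasFDerivAt_complex (c • z)).comp z ((hasFDerivAt_id (𝕜 := ℂ) z).const_smul c)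
  have hpow : HasFDerivAt (fun x => H (c • x)) (c ^ δ • fderiv ℂ H z) z := by
    simpa only [hH.map_smul] using (hH.hasFDerivAt_complex z).fun_const_smul (c ^ δ)
  rw [hH.fderiv_real_apply, hH.fderiv_real_apply]
  exact DFunLike.congr_fun (hchain.unique hpow) v

theorem contDiffOn_pullbackForm (hH : IsHomMap δ H) {r : ℕ}
    {φ : CV 3 → CV 3 [⋀^Fin r]→L[ℝ] ℝ} (hφ : ContDiffOn ℝ ∞ φ {0}ᶜ) :
    ContDiffOn ℝ ∞ (pullbackForm H φ) {0}ᶜ :=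
  SmallDegree.contDiffOn_pullbackForm hφ isOpen_compl_singleton hH.contDiff.contDiffOn hH.ne_zero

theorem extDeriv_pullbackForm (hH : IsHomMap δ H) {r : ℕ} {φ : CV 3 → CV 3 [⋀^Fin r]→L[ℝ] ℝ}
    (hφ : ContDiffOn ℝ ∞ φ {0}ᶜ) {z : CV 3} (hz : z ≠ 0) :
    extDeriv (pullbackForm H φ) z = pullbackForm H (extDeriv φ) z :=
  SmallDegree.extDeriv_pullbackForm
    (differentiableAt_of_contDiffOn_compl_zero hφ (hH.ne_zero z hz)) hH.contDiff.contDiffAt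

/-- The pull-back operator `H^*` on the forms of `ℙ²`. -/
def pull (hH : IsHomMap δ H) (r : ℕ) : smoothForms r →ₗ[ℝ] smoothForms r where
  toFun φ := ⟨pullbackForm H φ.1, by
    obtain ⟨φ, hzero, hsmooth, hkill, hinv⟩ := φ
    refine ⟨?_, hH.contDiffOn_pullbackForm hsmooth, ?_, ?_⟩
    · ext v
      simp only [pullbackForm_apply, hH.map_zero, hzero]
      rfl
    · rintro z hz v ⟨i, c, hv⟩
      refine hkill (H z) (hH.ne_zero z hz) _ ⟨i, c * δ, ?_⟩
      rw [← smul_smul, ← hH.fderiv_apply_self, ← hH.fderiv_apply_smul, ← hv]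
      rfl
    · intro z hz c hc v
      simp only [pullbackForm_apply, hH.fderiv_smul_apply_smul, hH.map_smul]
      exact hinv (H z) (hH.ne_zero z hz) (c ^ δ) (pow_ne_zero _ hc) _⟩
  map_add' _ _ := rfl
  map_smul' _ _ := rfl

theorem pull_apply (hH : IsHomMap δ H) {r : ℕ} (φ : smoothForms r) (z : CV 3)
    (v : Fin r → CV 3) : (hH.pull r φ).1 z v = φ.1 (H z) fun i => fderiv ℝ H z (v i) := rfl

theorem pull_eq_extDeriv_pull (hH : IsHomMap δ H) {r : ℕ} {ψ : smoothForms r}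
    {φ : smoothForms (r + 1)} (h : ∀ z ≠ 0, φ.1 z = extDeriv ψ.1 z) {z : CV 3} (hz : z ≠ 0) :
    (hH.pull (r + 1) φ).1 z = extDeriv (hH.pull r ψ).1 z := by
  refine Eq.trans ?_ (hH.extDeriv_pullbackForm ψ.2.2.1 hz).symm
  exact congrArg (·.compContinuousLinearMap (fderiv ℝ H z)) (h _ (hH.ne_zero z hz))

end IsHomMap

theorem HomTriple.isHomMap_lift {d : ℕ} (T : HomTriple d) (hd : d ≠ 0) (ε : ℂ) :
    IsHomMap d (T.lift ε) where
  contDiff_complex := contDiff_pi.2 fun i =>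
    (AnalyticOnNhd.eval_mvPolynomial (𝕜 := ℂ) (T.poly ε i)).contDiff
  map_zero := by simpa only [zero_smul, zero_pow hd] using T.lift_smul ε 0 0
  ne_zero _ := T.lift_ne_zero hd ε
  map_smul := T.lift_smul ε

/-! ### The Fubini–Study form -/

section Hermitian

variable {n : ℕ}

open ComplexConjugate

/-- The standard Hermitian product of `ℂⁿ`, conjugate linear in the first variable. The norm of
`CV n` is the sup norm, so that this is not an `inner`. -/
def hermitian : CV n →L[ℝ] CV n →L[ℝ] ℂ :=
  ∑ i, (ContinuousLinearMap.mul ℝ ℂ).bilinearComp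
    (Complex.conjCLE.toContinuousLinearMap ∘L ContinuousLinearMap.proj i)
    (ContinuousLinearMap.proj i)

/-- The square of the standard Hermitian norm of `ℂⁿ`. -/
def sqNorm (z : CV n) : ℝ := ∑ i, ‖z i‖ ^ 2

theorem hermitian_apply (z v : CV n) : hermitian z v = ∑ i, conj (z i) * v i := by
  simp [hermitian]

theorem conj_hermitian (z v : CV n) : conj (hermitian z v) = hermitian v z := by
  simp only [hermitian_apply, map_sum, map_mul, Complex.conj_conj, mul_comm]

theorem hermitian_smul_right (c : ℂ) (z v : CV n) :
    hermitian z (c • v) = c * hermitian z v := by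
  simp only [hermitian_apply, Pi.smul_apply, smul_eq_mul, mul_left_comm, Finset.mul_sum]

theorem hermitian_smul_left (c : ℂ) (z v : CV n) :
    hermitian (c • z) v = conj c * hermitian z v := by
  rw [← conj_hermitian, hermitian_smul_right, map_mul, conj_hermitian]

theorem hermitian_self (z : CV n) : hermitian z z = sqNorm z := by
  simp only [hermitian_apply, sqNorm, Complex.conj_mul', Complex.ofReal_sum, Complex.ofReal_pow]

theorem sqNorm_smul (c : ℂ) (z : CV n) : sqNorm (c • z) = ‖c‖ ^ 2 * sqNorm z := by
  simp only [sqNorm, Pi.smul_apply, smul_eq_mul, norm_mul, mul_pow, Finset.mul_sum]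

theorem sq_norm_le_sqNorm (z : CV n) : ‖z‖ ^ 2 ≤ sqNorm z := by
  have hnonneg : 0 ≤ sqNorm z := Finset.sum_nonneg fun _ _ => sq_nonneg _
  refine (Real.le_sqrt (norm_nonneg z) hnonneg).1 ?_
  refine (pi_norm_le_iff_of_nonneg (Real.sqrt_nonneg _)).2 fun i => Real.le_sqrt_of_sq_le ?_
  exact Finset.single_le_sum (f := fun i => ‖z i‖ ^ 2) (fun _ _ => sq_nonneg _)
    (Finset.mem_univ i)

theorem sqNorm_le (z : CV n) : sqNorm z ≤ n * ‖z‖ ^ 2 := by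
  calc ∑ i, ‖z i‖ ^ 2
    _ ≤ ∑ _i : Fin n, ‖z‖ ^ 2 := by
      gcongr with i
      exact norm_le_pi_norm z i
    _ = n * ‖z‖ ^ 2 := by rw [Fin.sum_const, nsmul_eq_mul]

theorem sqNorm_nonneg (z : CV n) : 0 ≤ sqNorm z := (sq_nonneg _).trans (sq_norm_le_sqNorm z)

theorem sqNorm_pos {z : CV n} (hz : z ≠ 0) : 0 < sqNorm z :=
  (pow_pos (norm_pos_iff.2 hz) 2).trans_le (sq_norm_le_sqNorm z)

theorem sqNorm_eq_re (z : CV n) : sqNorm z = (hermitian z z).re := by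
  rw [hermitian_self, Complex.ofReal_re]

theorem contDiff_hermitian_left (v : CV n) : ContDiff ℝ ∞ fun z => hermitian z v :=
  hermitian.contDiff.clm_apply contDiff_const

theorem contDiff_hermitian_right (v : CV n) : ContDiff ℝ ∞ (hermitian v) := (hermitian v).contDiff

theorem hasFDerivAt_sqNorm (z : CV n) :
    HasFDerivAt sqNorm ((2 : ℝ) • (Complex.reCLM ∘L hermitian z)) z := by
  have h := Complex.reCLM.hasFDerivAt.comp z
    ((hermitian.hasFDerivAt (x := z)).clm_apply (hasFDerivAt_id z))
  refine (h.congr_fderiv (ContinuousLinearMap.ext fun v => ?_)).congr_of_eventuallyEq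
    (Eventually.of_forall sqNorm_eq_re)
  simp [← conj_hermitian v z, two_mul]

theorem contDiff_sqNorm : ContDiff ℝ ∞ (sqNorm (n := n)) := by
  simp only [funext sqNorm_eq_re]
  exact Complex.reCLM.contDiff.comp (hermitian.contDiff.clm_apply contDiff_id)

/-- The connection form `Im ⟨z, dz⟩ / ‖z‖²` of the bundle `ℂⁿ ∖ {0} → ℙ(ℂⁿ)`. -/
def conn (z : CV n) : CV n [⋀^Fin 1]→L[ℝ] ℝ :=
  ContinuousAlternatingMap.ofSubsingleton ℝ (CV n) ℝ 0
    ((sqNorm z)⁻¹ • (Complex.imCLM ∘L hermitian z))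

theorem conn_apply (z : CV n) (v : Fin 1 → CV n) :
    conn z v = (hermitian z (v 0)).im / sqNorm z := by
  simp [conn, div_eq_inv_mul]

theorem conn_smul_self {z : CV n} (hz : z ≠ 0) (c : ℂ) {v : Fin 1 → CV n} (hv : v 0 = c • z) :
    conn z v = c.im := by
  rw [conn_apply, hv, hermitian_smul_right, hermitian_self, Complex.im_mul_ofReal,
    mul_div_cancel_right₀ _ (sqNorm_pos hz).ne']

theorem conn_smul_smul (z : CV n) {c : ℂ} (hc : c ≠ 0) (v : Fin 1 → CV n) :
    conn (c • z) (fun i => c • v i) = conn z v := by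
  rw [conn_apply, conn_apply, hermitian_smul_left, hermitian_smul_right, sqNorm_smul, ← mul_assoc,
    Complex.conj_mul', ← Complex.ofReal_pow, Complex.im_ofReal_mul,
    mul_div_mul_left _ _ (pow_ne_zero 2 (norm_ne_zero_iff.2 hc))]

theorem contDiffOn_conn : ContDiffOn ℝ ∞ (conn (n := n)) {0}ᶜ := by
  rw [contDiffOn_alternating_iff]
  intro v
  simp only [conn_apply]
  exact (Complex.imCLM.contDiff.comp (contDiff_hermitian_left _)).contDiffOn.div
    contDiff_sqNorm.contDiffOn fun z hz => (sqNorm_pos hz).ne'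

theorem fderiv_im_hermitian_div_sqNorm {z : CV n} (hz : z ≠ 0) (v w : CV n) :
    fderiv ℝ (fun x => (hermitian x v).im / sqNorm x) z w =
      (hermitian w v).im / sqNorm z -
        2 * (hermitian z v).im * (hermitian z w).re / sqNorm z ^ 2 := by
  have hz' := (sqNorm_pos hz).ne'
  have hnum : HasFDerivAt (fun x => (hermitian x v).im) (Complex.imCLM ∘L hermitian.flip v) z :=
    (Complex.imCLM ∘L hermitian.flip v).hasFDerivAt
  have hinv : HasFDerivAt (fun x => (sqNorm x)⁻¹)
      ((-(sqNorm z ^ 2)⁻¹) • ((2 : ℝ) • (Complex.reCLM ∘L hermitian z))) z :=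
    (hasDerivAt_inv hz').comp_hasFDerivAt z (hasFDerivAt_sqNorm z)
  simp only [div_eq_mul_inv]
  rw [(hnum.fun_mul hinv).fderiv]
  simp
  field_simp
  ring

theorem extDeriv_conn_apply {z : CV n} (hz : z ≠ 0) (v : Fin 2 → CV n) :
    extDeriv conn z v = 2 * (hermitian (v 0) (v 1) * hermitian z z -
      hermitian (v 0) z * hermitian z (v 1)).im / sqNorm z ^ 2 := by
  have hz' := (sqNorm_pos hz).ne'
  have hrem : (Fin.removeNth 0 v : Fin 1 → CV n) 0 = v 1 ∧
    (Fin.removeNth 1 v : Fin 1 → CV n) 0 = v 0 := ⟨rfl, rfl⟩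
  rw [extDeriv_apply (differentiableAt_of_contDiffOn_compl_zero contDiffOn_conn hz),
    Fin.sum_univ_two]
  simp only [conn_apply, hrem, fderiv_im_hermitian_div_sqNorm hz, hermitian_self,
    ← conj_hermitian z (v 0), ← conj_hermitian (v 0) (v 1)]
  simp
  field_simp
  ring

theorem extDeriv_conn_smul_smul {z : CV n} (hz : z ≠ 0) {c : ℂ} (hc : c ≠ 0)
    (v : Fin 2 → CV n) : extDeriv conn (c • z) (fun i => c • v i) = extDeriv conn z v := by
  let L : CV n →L[ℝ] CV n := c • ContinuousLinearMap.id ℝ (CV n)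
  have hL : pullbackForm L conn = conn := funext fun x => ContinuousAlternatingMap.ext fun w => by
    rw [pullbackForm_apply, L.fderiv]
    exact conn_smul_smul x hc w
  have h := extDeriv_pullbackForm (H := L)
    (differentiableAt_of_contDiffOn_compl_zero contDiffOn_conn (smul_ne_zero hc hz))
    L.contDiff.contDiffAt
  rw [hL] at h
  rw [h, pullbackForm_apply, L.fderiv]
  rfl

end Hermitian

/-- The Fubini–Study form: the differential of the connection form. -/
def fubiniStudy : smoothForms 2 := ⟨Set.indicator {0}ᶜ (extDeriv conn), by
  refine ⟨Set.indicator_of_notMem (by simp) _, ?_, fun z hz => ?_, fun z hz c hc v => ?_⟩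
  · refine contDiffOn_alternating_iff.2 fun v => ContDiffOn.congr (f := fun z =>
      2 * (hermitian (v 0) (v 1) * hermitian z z -
        hermitian (v 0) z * hermitian z (v 1)).im / sqNorm z ^ 2) ?_ fun z hz => ?_
    · refine ContDiffOn.div (ContDiff.contDiffOn ?_) (contDiff_sqNorm.pow 2).contDiffOn
        fun z hz => (pow_pos (sqNorm_pos hz) 2).ne'
      exact contDiff_const.mul (Complex.imCLM.contDiff.comp
        ((contDiff_const.mul (hermitian.contDiff.clm_apply contDiff_id)).sub
          ((contDiff_hermitian_right _).mul (contDiff_hermitian_left _))))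
    · rw [Set.indicator_of_mem hz, extDeriv_conn_apply hz]
  · rw [Set.indicator_of_mem (Set.mem_compl_singleton_iff.2 hz)]
    rintro v ⟨i, c, hv⟩
    rw [extDeriv_conn_apply hz]
    fin_cases i
    · rw [show v 0 = c • z from hv, hermitian_smul_left, hermitian_smul_left]
      ring_nf
      simp
    · rw [show v 1 = c • z from hv, hermitian_smul_right, hermitian_smul_right]
      ring_nf
      simp
  · rw [Set.indicator_of_mem (Set.mem_compl_singleton_iff.2 hz),
      Set.indicator_of_mem (Set.mem_compl_singleton_iff.2 (smul_ne_zero hc hz)),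
      extDeriv_conn_smul_smul hz hc]⟩

theorem fubiniStudy_eq_extDeriv_conn {z : CV 3} (hz : z ≠ 0) :
    fubiniStudy.1 z = extDeriv conn z :=
  Set.indicator_of_mem (Set.mem_compl_singleton_iff.2 hz) _

theorem complexTuple_zero (v : Fin 1 → CV 3) : complexTuple v 0 = v 0 := by
  simp [complexTuple]

theorem complexTuple_one (v : Fin 1 → CV 3) : complexTuple v 1 = Complex.I • v 0 := by
  simp [complexTuple]

theorem fubiniStudy_complexTuple_of_hermitian_eq_zero {z : CV 3} (hz : z ≠ 0) {v : Fin 1 → CV 3}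
    (hv : hermitian z (v 0) = 0) :
    fubiniStudy.1 z (complexTuple v) = 2 * sqNorm (v 0) / sqNorm z := by
  have hz' := (sqNorm_pos hz).ne'
  rw [fubiniStudy_eq_extDeriv_conn hz, extDeriv_conn_apply hz, complexTuple_zero,
    complexTuple_one, hermitian_smul_right, hermitian_smul_right, hv, hermitian_self,
    hermitian_self]
  simp
  field_simp

/-! ### Bounds for positive functionals -/

section FormBounds

variable {p r : ℕ}

theorem exists_norm_form_le (φ : smoothForms r) :
    ∃ M : ℝ, ∀ z : CV 3, ‖z‖ = 1 → ‖φ.1 z‖ ≤ M := by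
  have hφ : ContinuousOn φ.1 (Metric.sphere 0 1) :=
    φ.2.2.1.continuousOn.mono fun z hz => ne_zero_of_mem_unit_sphere ⟨z, hz⟩
  obtain ⟨M, hM⟩ := (isCompact_sphere (0 : CV 3) 1).exists_bound_of_continuousOn hφ
  exact ⟨M, fun z hz => hM z (mem_sphere_zero_iff_norm.2 hz)⟩

theorem nonneg_of_forall_norm_form_le {φ : smoothForms r} {M : ℝ}
    (hM : ∀ z : CV 3, ‖z‖ = 1 → ‖φ.1 z‖ ≤ M) : 0 ≤ M := by
  obtain ⟨z, hz⟩ := exists_norm_eq (CV 3) zero_le_one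
  exact (norm_nonneg _).trans (hM z hz)

theorem abs_form_apply_le (φ : smoothForms r) {M : ℝ}
    (hM : ∀ z : CV 3, ‖z‖ = 1 → ‖φ.1 z‖ ≤ M) {z : CV 3} (hz : z ≠ 0) (v : Fin r → CV 3) :
    |φ.1 z v| ≤ M * ∏ i, (‖v i‖ / ‖z‖) := by
  have hz' : ‖z‖ ≠ 0 := norm_ne_zero_iff.2 hz
  have hc : (‖z‖ : ℂ)⁻¹ ≠ 0 := inv_ne_zero (Complex.ofReal_ne_zero.2 hz')
  have hunit : ‖(‖z‖ : ℂ)⁻¹ • z‖ = 1 := by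
    rw [norm_smul, norm_inv, Complex.norm_real, norm_norm, inv_mul_cancel₀ hz']
  calc |φ.1 z v|
    _ = ‖φ.1 ((‖z‖ : ℂ)⁻¹ • z) fun i => (‖z‖ : ℂ)⁻¹ • v i‖ := by
      rw [φ.2.2.2.2 z hz _ hc v, Real.norm_eq_abs]
    _ ≤ ‖φ.1 ((‖z‖ : ℂ)⁻¹ • z)‖ * ∏ i, ‖(‖z‖ : ℂ)⁻¹ • v i‖ := (φ.1 _).le_opNorm _
    _ ≤ M * ∏ i, ‖(‖z‖ : ℂ)⁻¹ • v i‖ :=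
      mul_le_mul_of_nonneg_right (hM _ hunit) (Finset.prod_nonneg fun _ _ => norm_nonneg _)
    _ = M * ∏ i, (‖v i‖ / ‖z‖) := by
      simp only [norm_smul, norm_inv, Complex.norm_real, norm_norm, div_eq_inv_mul]

theorem form_apply_add_smul (φ : smoothForms r) {z : CV 3} (hz : z ≠ 0) (v : Fin r → CV 3)
    (c : Fin r → ℂ) : φ.1 z (fun i => v i + c i • z) = φ.1 z v := by
  refine ((φ.1 z).toMultilinearMap.map_add_univ v (fun i => c i • z)).trans ?_
  rw [Finset.sum_eq_single Finset.univ, Finset.piecewise_univ]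
  · rfl
  · intro s _ hs
    obtain ⟨i, hi⟩ := not_forall.1 (mt Finset.eq_univ_iff_forall.2 hs)
    exact φ.2.2.2.1 z hz _ ⟨i, c i, Finset.piecewise_eq_of_notMem s _ _ hi⟩
  · exact fun h => absurd (Finset.mem_univ _) h

theorem form_complexTuple_add_smul (φ : smoothForms (2 * p)) {z : CV 3} (hz : z ≠ 0)
    (v : Fin p → CV 3) (c : Fin p → ℂ) :
    φ.1 z (complexTuple fun i => v i + c i • z) = φ.1 z (complexTuple v) := by
  refine Eq.trans ?_ (form_apply_add_smul φ hz (complexTuple v)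
    fun i => (if i.val % 2 = 0 then 1 else Complex.I) * c ⟨i.val / 2, by omega⟩)
  refine congrArg (φ.1 z) (funext fun i => ?_)
  simp only [complexTuple, smul_add, smul_smul]

theorem abs_form_le_fubiniStudy (φ : smoothForms (2 * 1)) {M : ℝ}
    (hM : ∀ z : CV 3, ‖z‖ = 1 → ‖φ.1 z‖ ≤ M) {z : CV 3} (hz : z ≠ 0) (v : Fin 1 → CV 3) :
    |φ.1 z (complexTuple v)| ≤ 3 / 2 * M * fubiniStudy.1 z (complexTuple v) := by
  have hsq := sqNorm_pos hz
  have hnorm : 0 < ‖z‖ := norm_pos_iff.2 hz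
  have hM₀ : 0 ≤ M := nonneg_of_forall_norm_form_le hM
  -- Both sides only depend on `v` modulo `ℂ z`, so that `v` may be taken orthogonal to `z`.
  wlog horth : hermitian z (v 0) = 0 generalizing v
  · let c : ℂ := hermitian z (v 0) / hermitian z z
    have hself : hermitian z z ≠ 0 := by
      rw [hermitian_self]
      exact Complex.ofReal_ne_zero.2 hsq.ne'
    have h := this (fun i => v i + (fun _ => -c) i • z) (by
      simp only [map_add, hermitian_smul_right, c]
      field_simp
      ring)
    rwa [form_complexTuple_add_smul φ hz v,
      form_complexTuple_add_smul (p := 1) fubiniStudy hz v] at h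
  have hprod : ∏ i, (‖complexTuple v i‖ / ‖z‖) = ‖v 0‖ ^ 2 / ‖z‖ ^ 2 := by
    change ∏ i : Fin 2, _ = _
    rw [Fin.prod_univ_two, complexTuple_zero, complexTuple_one, norm_smul, Complex.norm_I,
      one_mul, ← sq, div_pow]
  have hcompare : ‖v 0‖ ^ 2 / ‖z‖ ^ 2 ≤ 3 * (sqNorm (v 0) / sqNorm z) := by
    rw [← mul_div_assoc, div_le_div_iff₀ (pow_pos hnorm 2) hsq]
    calc ‖v 0‖ ^ 2 * sqNorm z
      _ ≤ sqNorm (v 0) * (3 * ‖z‖ ^ 2) :=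
        mul_le_mul (sq_norm_le_sqNorm _) (mod_cast sqNorm_le z) hsq.le (sqNorm_nonneg _)
      _ = 3 * sqNorm (v 0) * ‖z‖ ^ 2 := by ring
  calc |φ.1 z (complexTuple v)|
    _ ≤ M * (‖v 0‖ ^ 2 / ‖z‖ ^ 2) := hprod ▸ abs_form_apply_le φ hM hz _
    _ ≤ M * (3 * (sqNorm (v 0) / sqNorm z)) := mul_le_mul_of_nonneg_left hcompare hM₀
    _ = 3 / 2 * M * fubiniStudy.1 z (complexTuple v) := by
      rw [fubiniStudy_complexTuple_of_hermitian_eq_zero hz horth]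
      ring

theorem IsPositiveFunctional.abs_apply_le {T : smoothForms (2 * p) →ₗ[ℝ] ℝ}
    (hT : IsPositiveFunctional T) {φ Ω : smoothForms (2 * p)} {M : ℝ}
    (h : ∀ z ≠ 0, ∀ v : Fin p → CV 3,
      |φ.1 z (complexTuple v)| ≤ M * Ω.1 z (complexTuple v)) : |T φ| ≤ M * T Ω := by
  have hlower : 0 ≤ T (M • Ω + φ) := hT _ fun z hz v =>
    neg_le_iff_add_nonneg'.1 (abs_le.1 (h z hz v)).1
  have hupper : 0 ≤ T (M • Ω + (-1 : ℝ) • φ) := hT _ fun z hz v => by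
    change 0 ≤ M * Ω.1 z _ + -1 * φ.1 z _
    linarith [(abs_le.1 (h z hz v)).2]
  simp only [map_add, map_smul, smul_eq_mul] at hlower hupper
  exact abs_le.2 ⟨by linarith, by linarith⟩

end FormBounds

/-! ### The pull-back of the Fubini–Study form -/

namespace IsHomMap

variable {δ : ℕ} {H : CV 3 → CV 3}

/-- `H^* α - δ α`, where `α` is the connection form: it descends to `ℙ²`, unlike `α`. -/
def connDiff (hH : IsHomMap δ H) : smoothForms 1 :=
  ⟨pullbackForm H conn + (-δ : ℝ) • conn, by
    have hself : ∀ z ≠ 0, ∀ v : Fin 1 → CV 3, ∀ c : ℂ, v 0 = c • z →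
        pullbackForm H conn z v = δ * c.im := fun z hz v c hv => by
      rw [pullbackForm_apply, conn_smul_self (hH.ne_zero z hz) (c * δ), mul_comm c,
        ← Complex.ofReal_natCast, Complex.im_ofReal_mul]
      rw [hv, hH.fderiv_apply_smul, hH.fderiv_apply_self, smul_smul]
    refine ⟨?_, ?_, fun z hz v => ?_, fun z _ c hc v => ?_⟩
    · ext v
      simp [pullbackForm_apply, conn_apply, hH.map_zero]
    · exact (hH.contDiffOn_pullbackForm contDiffOn_conn).add
        (contDiffOn_conn.const_smul (-δ : ℝ))
    · rintro ⟨i, c, hv⟩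
      obtain rfl : i = 0 := Subsingleton.elim _ _
      change pullbackForm H conn z v + -δ * conn z v = 0
      rw [hself z hz v c hv, conn_smul_self hz c hv, neg_mul, add_neg_cancel]
    · change pullbackForm H conn (c • z) _ + -δ * conn (c • z) _ =
        pullbackForm H conn z v + -δ * conn z v
      simp only [pullbackForm_apply, hH.fderiv_smul_apply_smul, hH.map_smul,
        conn_smul_smul _ hc, conn_smul_smul _ (pow_ne_zero δ hc)]⟩

theorem pull_fubiniStudy_add (hH : IsHomMap δ H) {z : CV 3} (hz : z ≠ 0) :
    (hH.pull 2 fubiniStudy + (-δ : ℝ) • fubiniStudy).1 z = extDeriv hH.connDiff.1 z := by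
  have hpull : DifferentiableAt ℝ (pullbackForm H conn) z :=
    differentiableAt_of_contDiffOn_compl_zero (hH.contDiffOn_pullbackForm contDiffOn_conn) hz
  have hconn := (differentiableAt_of_contDiffOn_compl_zero contDiffOn_conn hz).const_smul (-δ : ℝ)
  refine Eq.trans ?_ (extDeriv_add hpull hconn).symm
  rw [extDeriv_smul, hH.extDeriv_pullbackForm contDiffOn_conn hz,
    ← fubiniStudy_eq_extDeriv_conn hz]
  refine congrArg (· + (-δ : ℝ) • fubiniStudy.1 z) ?_
  exact congrArg (·.compContinuousLinearMap (fderiv ℝ H z))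
    (fubiniStudy_eq_extDeriv_conn (hH.ne_zero z hz))

theorem apply_pull_fubiniStudy_of_closed (hH : IsHomMap δ H) {T : smoothForms (2 * 1) →ₗ[ℝ] ℝ}
    (hT : IsClosedFunctional T) : T (hH.pull (2 * 1) fubiniStudy) = δ * T fubiniStudy := by
  have h : T (hH.pull 2 fubiniStudy + (-δ : ℝ) • fubiniStudy) = 0 :=
    hT hH.connDiff _ fun _ hz => hH.pull_fubiniStudy_add hz
  rwa [_root_.map_add, _root_.map_smul, smul_eq_mul, neg_mul, ← sub_eq_add_neg, sub_eq_zero] at h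

end IsHomMap

/-! ### The current of integration on the line `t = 0` -/

section Divergence

variable {E : Type*} [NormedAddCommGroup E] [NormedSpace ℝ E]

theorem tendsto_integral_square {f : ℝ × ℝ → E} (hf : Integrable f) :
    Tendsto (fun n : ℕ => ∫ x in (-n : ℝ)..n, ∫ y in (-n : ℝ)..n, f (x, y)) atTop
      (𝓝 (∫ p, f p)) := by
  set square : ℕ → Set (ℝ × ℝ) := fun n => Set.Ioc (-n : ℝ) n ×ˢ Set.Ioc (-n : ℝ) n
  have hunion : ⋃ n, square n = Set.univ := by
    refine Set.eq_univ_of_forall fun p => Set.mem_iUnion.2 ?_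
    obtain ⟨n, hn⟩ := exists_nat_gt (max |p.1| |p.2|)
    have h₁ := abs_lt.1 ((le_max_left _ _).trans_lt hn)
    have h₂ := abs_lt.1 ((le_max_right _ _).trans_lt hn)
    exact ⟨n, ⟨h₁.1, h₁.2.le⟩, ⟨h₂.1, h₂.2.le⟩⟩
  have hmono : Monotone square := fun m n hmn =>
    have hmn' : (m : ℝ) ≤ n := Nat.cast_le.2 hmn
    Set.prod_mono (Set.Ioc_subset_Ioc (neg_le_neg hmn') hmn')
      (Set.Ioc_subset_Ioc (neg_le_neg hmn') hmn')
  have hlim := tendsto_setIntegral_of_monotone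
    (fun n => (measurableSet_Ioc.prod measurableSet_Ioc : MeasurableSet (square n))) hmono
    (hf.integrableOn (s := ⋃ n, square n))
  rw [hunion, setIntegral_univ] at hlim
  refine hlim.congr fun n => ?_
  have hn : (-n : ℝ) ≤ n := neg_le_self n.cast_nonneg
  simp only [intervalIntegral.integral_of_le hn]
  exact setIntegral_prod _ hf.integrableOn

variable {f g : ℝ × ℝ → E} {f' g' : ℝ × ℝ → ℝ × ℝ →L[ℝ] E}

theorem norm_integral_square_divergence_le (hf : ∀ p, HasFDerivAt f (f' p) p)
    (hg : ∀ p, HasFDerivAt g (g' p) p) (hdiv : Integrable fun p => f' p (1, 0) + g' p (0, 1))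
    {B R : ℝ} (hR : 0 ≤ R) (hfB : ∀ p, ‖p‖ = R → ‖f p‖ ≤ B) (hgB : ∀ p, ‖p‖ = R → ‖g p‖ ≤ B) :
    ‖∫ x in -R..R, ∫ y in -R..R, f' (x, y) (1, 0) + g' (x, y) (0, 1)‖ ≤ 8 * (R * B) := by
  have hle : -R ≤ R := neg_le_self hR
  have hside : ∀ u : ℝ → E, (∀ s ∈ Set.uIoc (-R) R, ‖u s‖ ≤ B) →
      ‖∫ s in -R..R, u s‖ ≤ 2 * (R * B) := fun u hu => by
    refine (intervalIntegral.norm_integral_le_of_norm_le_const hu).trans_eq ?_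
    rw [sub_neg_eq_add, abs_of_nonneg (add_nonneg hR hR)]
    ring
  have hright : ∀ s ∈ Set.uIoc (-R) R, |s| ≤ R := fun s hs => by
    rw [Set.uIoc_of_le hle] at hs
    exact abs_le.2 ⟨hs.1.le, hs.2⟩
  have hvert : ∀ s ∈ Set.uIoc (-R) R, ∀ a : ℝ, |a| = R → ‖(a, s)‖ = R := fun s hs a ha => by
    rw [Prod.norm_def, Real.norm_eq_abs, Real.norm_eq_abs, ha, max_eq_left (hright s hs)]
  have hhor : ∀ s ∈ Set.uIoc (-R) R, ∀ a : ℝ, |a| = R → ‖(s, a)‖ = R := fun s hs a ha => by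
    rw [Prod.norm_def, Real.norm_eq_abs, Real.norm_eq_abs, ha, max_eq_right (hright s hs)]
  have hpos : |R| = R := abs_of_nonneg hR
  have hneg : |-R| = R := (abs_neg R).trans hpos
  rw [integral2_divergence_prod_of_hasFDerivAt f g f' g' (-R) (-R) R R
    (fun p _ => (hf p).continuousAt.continuousWithinAt)
    (fun p _ => (hg p).continuousAt.continuousWithinAt)
    (fun p _ => hf p) (fun p _ => hg p) hdiv.integrableOn]
  refine (norm_sub_le_of_le (norm_add_le_of_le (norm_sub_le_of_le
    (hside (fun x => g (x, R)) fun s hs => hgB _ (hhor s hs _ hpos))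
    (hside (fun x => g (x, -R)) fun s hs => hgB _ (hhor s hs _ hneg)))
    (hside (fun y => f (R, y)) fun s hs => hfB _ (hvert s hs _ hpos)))
    (hside (fun y => f (-R, y)) fun s hs => hfB _ (hvert s hs _ hneg))).trans_eq ?_
  ring

theorem integral_divergence_eq_zero_of_norm_le (hf : ∀ p, HasFDerivAt f (f' p) p)
    (hg : ∀ p, HasFDerivAt g (g' p) p) (hdiv : Integrable fun p => f' p (1, 0) + g' p (0, 1))
    {M : ℝ} (hfM : ∀ p ≠ 0, ‖f p‖ ≤ M / ‖p‖ ^ 2) (hgM : ∀ p ≠ 0, ‖g p‖ ≤ M / ‖p‖ ^ 2) :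
    ∫ p, (f' p (1, 0) + g' p (0, 1)) = 0 := by
  refine tendsto_nhds_unique (tendsto_integral_square hdiv) (squeeze_zero_norm' ?_
    (tendsto_const_div_atTop_nhds_zero_nat (8 * M)))
  filter_upwards [eventually_gt_atTop 0] with n hn
  have hn' : (0 : ℝ) < n := Nat.cast_pos.2 hn
  have hne : ∀ p : ℝ × ℝ, ‖p‖ = n → p ≠ 0 := fun p hp => norm_pos_iff.1 (hp ▸ hn')
  refine (norm_integral_square_divergence_le hf hg hdiv hn'.le (B := M / n ^ 2)
    (fun p hp => hp ▸ hfM p (hne p hp)) (fun p hp => hp ▸ hgM p (hne p hp))).trans_eq ?_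
  field_simp

end Divergence

/-- The direction of the line `t = 0` in the chart `w = 1`. -/
def lineDir : CV 3 := ![1, 0, 0]

/-- The parametrization `(x, y) ↦ (x + i y, 1, 0)` of the line `t = 0`, minus a point. -/
def linePt (p : ℝ × ℝ) : CV 3 := ![p.1 + p.2 * Complex.I, 1, 0]

theorem linePt_ne_zero (p : ℝ × ℝ) : linePt p ≠ 0 := fun h => one_ne_zero (congrFun h 1)

theorem hasFDerivAt_linePt (p : ℝ × ℝ) : HasFDerivAt linePt
    ((ContinuousLinearMap.fst ℝ ℝ ℝ).smulRight lineDir +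
      (ContinuousLinearMap.snd ℝ ℝ ℝ).smulRight (Complex.I • lineDir)) p := by
  refine (ContinuousLinearMap.hasFDerivAt _).add_const ![0, 1, 0] |>.congr_of_eventuallyEq
    (Eventually.of_forall fun q => ?_)
  funext i
  fin_cases i <;> simp [linePt, lineDir]

theorem continuous_linePt : Continuous linePt :=
  continuous_iff_continuousAt.2 fun p => (hasFDerivAt_linePt p).continuousAt

theorem sqNorm_linePt (p : ℝ × ℝ) : sqNorm (linePt p) = 1 + p.1 ^ 2 + p.2 ^ 2 := by
  simp only [sqNorm, Fin.sum_univ_three, linePt, Matrix.cons_val, Complex.sq_norm,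
    Complex.normSq_add_mul_I, map_one, map_zero]
  ring

/-- The density of the restriction of a form to the line, in the coordinates of `linePt`. -/
def lineForm (φ : smoothForms (2 * 1)) (p : ℝ × ℝ) : ℝ :=
  φ.1 (linePt p) (complexTuple fun _ => lineDir)

theorem lineForm_fubiniStudy (p : ℝ × ℝ) :
    lineForm fubiniStudy p = 2 / (1 + p.1 ^ 2 + p.2 ^ 2) ^ 2 := by
  rw [lineForm, fubiniStudy_eq_extDeriv_conn (linePt_ne_zero p),
    extDeriv_conn_apply (linePt_ne_zero p), complexTuple_zero, complexTuple_one, hermitian_self,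
    sqNorm_linePt]
  simp [hermitian_apply, Fin.sum_univ_three, linePt, lineDir, sq]

theorem continuous_lineForm (φ : smoothForms (2 * 1)) : Continuous (lineForm φ) :=
  (contDiffOn_alternating_iff.1 φ.2.2.1 _).continuousOn.comp_continuous continuous_linePt
    linePt_ne_zero

theorem integrable_lineForm_fubiniStudy : Integrable (lineForm fubiniStudy) := by
  have hmajorant : Integrable fun p : ℝ × ℝ => 2 * ((1 + p.1 ^ 2)⁻¹ * (1 + p.2 ^ 2)⁻¹) :=
    (integrable_inv_one_add_sq.mul_prod integrable_inv_one_add_sq).const_mul 2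
  refine hmajorant.mono' (continuous_lineForm fubiniStudy).aestronglyMeasurable
    (Eventually.of_forall fun p => ?_)
  rw [lineForm_fubiniStudy, Real.norm_of_nonneg (by positivity), div_eq_mul_inv, ← mul_inv]
  gcongr
  nlinarith [sq_nonneg p.1, sq_nonneg p.2, mul_nonneg (sq_nonneg p.1) (sq_nonneg p.2)]

theorem integrable_lineForm (φ : smoothForms (2 * 1)) : Integrable (lineForm φ) := by
  obtain ⟨M, hM⟩ := exists_norm_form_le φ
  exact (integrable_lineForm_fubiniStudy.const_mul (3 / 2 * M)).mono'
    (continuous_lineForm φ).aestronglyMeasurable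
    (Eventually.of_forall fun p => abs_form_le_fubiniStudy φ hM (linePt_ne_zero p) _)

/-- The current of integration on the line `t = 0`. -/
def lineCurrent : smoothForms (2 * 1) →ₗ[ℝ] ℝ where
  toFun φ := ∫ p, lineForm φ p
  map_add' φ ψ := integral_add (integrable_lineForm φ) (integrable_lineForm ψ)
  map_smul' a φ := integral_const_mul a (lineForm φ)

theorem isPositiveFunctional_lineCurrent : IsPositiveFunctional lineCurrent := fun _ hφ =>
  integral_nonneg fun p => hφ _ (linePt_ne_zero p) _

theorem lineCurrent_fubiniStudy_pos : 0 < lineCurrent fubiniStudy := by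
  have hpos : ∀ p, 0 < lineForm fubiniStudy p := fun p => by
    rw [lineForm_fubiniStudy]
    positivity
  refine (integral_pos_iff_support_of_nonneg (fun p => (hpos p).le)
    integrable_lineForm_fubiniStudy).2 ?_
  rw [Function.support_eq_univ fun p => (hpos p).ne']
  exact Measure.measure_univ_pos.2 (NeZero.ne _)

theorem abs_apply_linePt_le (ψ : smoothForms 1) {M : ℝ}
    (hM : ∀ z : CV 3, ‖z‖ = 1 → ‖ψ.1 z‖ ≤ M) {c : ℂ} (hc : ‖c‖ = 1) {p : ℝ × ℝ} (hp : p ≠ 0) :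
    |ψ.1 (linePt p) fun _ => c • lineDir| ≤ M / ‖p‖ ^ 2 := by
  have hM₀ : 0 ≤ M := nonneg_of_forall_norm_form_le hM
  set ζ : ℂ := p.1 + p.2 * Complex.I with hζ
  have hζ₀ : ζ ≠ 0 := fun h => hp (Prod.ext (by simpa [hζ] using congrArg Complex.re h)
    (by simpa [hζ] using congrArg Complex.im h))
  have hle : ‖p‖ ≤ ‖ζ‖ := max_le (by simpa [hζ] using Complex.abs_re_le_norm ζ)
    (by simpa [hζ] using Complex.abs_im_le_norm ζ)
  -- Subtracting a multiple of `linePt p` makes the vector small, hence the quadratic decay.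
  have hvec : c • lineDir + -(c * ζ⁻¹) • linePt p = (c * ζ⁻¹) • Pi.single 1 (-1) := by
    funext i
    fin_cases i <;> simp [lineDir, linePt, ← hζ, hζ₀]
  rw [← form_apply_add_smul ψ (linePt_ne_zero p) _ fun _ => -(c * ζ⁻¹)]
  refine (abs_form_apply_le ψ hM (linePt_ne_zero p) _).trans ?_
  rw [Fin.prod_univ_one, hvec, norm_smul, norm_mul, hc, one_mul, norm_inv, Pi.norm_single,
    norm_neg, norm_one, mul_one, div_eq_mul_inv M]
  refine mul_le_mul_of_nonneg_left ?_ hM₀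
  have := norm_pos_iff.2 hp
  calc ‖ζ‖⁻¹ / ‖linePt p‖
    _ ≤ ‖p‖⁻¹ / ‖p‖ := by
      gcongr
      exact hle.trans (norm_le_pi_norm (linePt p) 0)
    _ = (‖p‖ ^ 2)⁻¹ := by rw [div_eq_mul_inv, ← mul_inv, sq]

theorem exists_hasFDerivAt_divergence_eq_lineForm {ψ : smoothForms 1} {φ : smoothForms (2 * 1)}
    (h : ∀ z ≠ 0, φ.1 z = extDeriv ψ.1 z) (p : ℝ × ℝ) :
    ∃ f' g' : ℝ × ℝ →L[ℝ] ℝ,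
      HasFDerivAt (fun q => ψ.1 (linePt q) fun _ => Complex.I • lineDir) f' p ∧
      HasFDerivAt (fun q => -ψ.1 (linePt q) fun _ => lineDir) g' p ∧
      f' (1, 0) + g' (0, 1) = lineForm φ p := by
  have hdiff : ∀ v : Fin 1 → CV 3, DifferentiableAt ℝ (fun z => ψ.1 z v) (linePt p) := fun v =>
    differentiableAt_of_contDiffOn_compl_zero (contDiffOn_alternating_iff.1 ψ.2.2.1 v)
      (linePt_ne_zero p)
  have hf := (hdiff fun _ => Complex.I • lineDir).hasFDerivAt.comp p (hasFDerivAt_linePt p)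
  have hg := ((hdiff fun _ => lineDir).hasFDerivAt.comp p (hasFDerivAt_linePt p)).neg
  refine ⟨_, _, hf, hg, ?_⟩
  have hrem₀ : Fin.removeNth 0 (complexTuple fun _ : Fin 1 => lineDir) =
      fun _ : Fin 1 => Complex.I • lineDir := by
    funext i
    obtain rfl : i = 0 := Subsingleton.elim _ _
    exact complexTuple_one _
  have hrem₁ : Fin.removeNth 1 (complexTuple fun _ : Fin 1 => lineDir) =
      fun _ : Fin 1 => lineDir := by
    funext i
    obtain rfl : i = 0 := Subsingleton.elim _ _
    exact complexTuple_zero _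
  rw [lineForm, h _ (linePt_ne_zero p), extDeriv_apply
    (differentiableAt_of_contDiffOn_compl_zero ψ.2.2.1 (linePt_ne_zero p))]
  change _ = ∑ i : Fin 2, _
  rw [Fin.sum_univ_two, hrem₀, hrem₁, complexTuple_zero, complexTuple_one]
  simp

theorem isClosedFunctional_lineCurrent : IsClosedFunctional lineCurrent := by
  intro ψ φ h
  obtain ⟨M, hM⟩ := exists_norm_form_le ψ
  choose f' g' hf hg hdiv using exists_hasFDerivAt_divergence_eq_lineForm h
  have hzero := integral_divergence_eq_zero_of_norm_le hf hg
    (by simpa only [hdiv] using integrable_lineForm φ)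
    (fun p hp => abs_apply_linePt_le ψ hM Complex.norm_I hp)
    (fun p hp => by simpa using abs_apply_linePt_le ψ hM norm_one hp)
  simp only [hdiv] at hzero
  exact hzero

/-! ### Limits of the push-forwards of the line -/

section PushForward

variable {δ : ℕ} {H : CV 3 → CV 3} {p : ℕ} {T : smoothForms (2 * 1) →ₗ[ℝ] ℝ}

theorem IsPositiveFunctional.comp_pull {T : smoothForms (2 * p) →ₗ[ℝ] ℝ}
    (hT : IsPositiveFunctional T) (hH : IsHomMap δ H) :
    IsPositiveFunctional (T ∘ₗ hH.pull (2 * p)) := fun φ hφ => hT _ fun z hz v => by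
  rw [hH.pull_apply]
  convert hφ (H z) (hH.ne_zero z hz) (fun i => fderiv ℝ H z (v i)) using 2
  funext i
  exact hH.fderiv_apply_smul _ _ _

theorem IsClosedFunctional.comp_pull {T : smoothForms (2 * (p + 1)) →ₗ[ℝ] ℝ}
    (hT : IsClosedFunctional T) (hH : IsHomMap δ H) :
    IsClosedFunctional (T ∘ₗ hH.pull (2 * (p + 1))) := fun ψ φ h =>
  hT (hH.pull (2 * p + 1) ψ) (hH.pull (2 * p + 1 + 1) φ) fun _ => hH.pull_eq_extDeriv_pull h

theorem IsPositiveFunctional.abs_apply_le_fubiniStudy (hT : IsPositiveFunctional T)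
    (φ : smoothForms (2 * 1)) {M : ℝ} (hM : ∀ z : CV 3, ‖z‖ = 1 → ‖φ.1 z‖ ≤ M) :
    |T φ| ≤ 3 / 2 * M * T fubiniStudy :=
  hT.abs_apply_le fun _ hz => abs_form_le_fubiniStudy φ hM hz

theorem IsPositiveFunctional.isContinuousFunctional (hT : IsPositiveFunctional T) :
    IsContinuousFunctional T := by
  refine ⟨0, 3 / 2 * T fubiniStudy, fun φ M hM => ?_⟩
  refine (hT.abs_apply_le_fubiniStudy φ (M := M) fun z hz => ?_).trans_eq (by ring)
  simpa only [norm_iteratedFDeriv_zero] using hM 0 le_rfl z hz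

theorem isPositiveClosedCurrent_lineCurrent : IsPositiveClosedCurrent lineCurrent :=
  ⟨isPositiveFunctional_lineCurrent.isContinuousFunctional, isPositiveFunctional_lineCurrent,
    isClosedFunctional_lineCurrent⟩

/-- The push-forward `δ⁻¹ H_* T` of a current of bidimension `(1, 1)`; the factor `δ⁻¹` makes it
preserve the mass. -/
def IsHomMap.push (hH : IsHomMap δ H) (T : smoothForms (2 * 1) →ₗ[ℝ] ℝ) :
    smoothForms (2 * 1) →ₗ[ℝ] ℝ :=
  (δ : ℝ)⁻¹ • (T ∘ₗ hH.pull (2 * 1))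

theorem IsHomMap.push_apply (hH : IsHomMap δ H) (φ : smoothForms (2 * 1)) :
    hH.push T φ = (δ : ℝ)⁻¹ * T (hH.pull (2 * 1) φ) := rfl

theorem IsPositiveClosedCurrent.push (hT : IsPositiveClosedCurrent T) (hH : IsHomMap δ H) :
    IsPositiveClosedCurrent (hH.push T) := by
  have hpos : IsPositiveFunctional (hH.push T) := fun φ hφ =>
    mul_nonneg (inv_nonneg.2 δ.cast_nonneg) (hT.positive.comp_pull hH φ hφ)
  refine ⟨hpos.isContinuousFunctional, hpos, fun ψ φ h => ?_⟩
  exact mul_eq_zero_of_right _ (hT.closed.comp_pull hH ψ φ h)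

theorem IsPositiveClosedCurrent.iterate_push (hT : IsPositiveClosedCurrent T)
    (hH : IsHomMap δ H) (n : ℕ) : IsPositiveClosedCurrent (hH.push^[n] T) :=
  Function.Iterate.rec _ hT (fun _ hS => hS.push hH) n

theorem IsPositiveClosedCurrent.iterate_push_fubiniStudy (hT : IsPositiveClosedCurrent T)
    (hH : IsHomMap δ H) (hδ : δ ≠ 0) (n : ℕ) :
    hH.push^[n] T fubiniStudy = T fubiniStudy := by
  induction n with
  | zero => rfl
  | succ n ih =>
    rw [Function.iterate_succ_apply', hH.push_apply,
      hH.apply_pull_fubiniStudy_of_closed (hT.iterate_push hH n).closed, ih,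
      inv_mul_cancel_left₀ (Nat.cast_ne_zero.2 hδ)]

theorem IsPositiveClosedCurrent.exists_tendsto_iterate_push (hT : IsPositiveClosedCurrent T)
    (hH : IsHomMap δ H) (hδ : δ ≠ 0) (φ : smoothForms (2 * 1)) :
    ∃ x, Tendsto (fun n => hH.push^[n] T φ) (hyperfilter ℕ) (𝓝 x) := by
  obtain ⟨M, hM⟩ := exists_norm_form_le φ
  have hmem : ∀ n, hH.push^[n] T φ ∈
      Metric.closedBall 0 (3 / 2 * M * T fubiniStudy) := fun n => by
    rw [mem_closedBall_zero_iff, ← hT.iterate_push_fubiniStudy hH hδ n]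
    exact (hT.iterate_push hH n).positive.abs_apply_le_fubiniStudy φ hM
  obtain ⟨x, -, hx⟩ := (isCompact_closedBall (0 : ℝ) _).ultrafilter_le_nhds
    ((hyperfilter ℕ).map fun n => hH.push^[n] T φ)
    (tendsto_principal.2 (Eventually.of_forall hmem))
  exact ⟨x, hx⟩

theorem IsPositiveClosedCurrent.exists_limit_iterate_push (hT : IsPositiveClosedCurrent T)
    (hH : IsHomMap δ H) (hδ : δ ≠ 0) : ∃ S : smoothForms (2 * 1) →ₗ[ℝ] ℝ,
      IsPositiveClosedCurrent S ∧ S fubiniStudy = T fubiniStudy ∧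
      ∀ φ, (∀ᶠ n in atTop, hH.push^[n] T φ = 0) → S φ = 0 := by
  choose s hs using hT.exists_tendsto_iterate_push hH hδ
  let S : smoothForms (2 * 1) →ₗ[ℝ] ℝ := linearMapOfTendsto s _ (tendsto_pi_nhds.2 hs)
  have hlim : ∀ φ, Tendsto (fun n => hH.push^[n] T φ) (hyperfilter ℕ) (𝓝 (S φ)) := hs
  have hzero : ∀ φ, (∀ᶠ n in atTop, hH.push^[n] T φ = 0) → S φ = 0 := fun φ hφ =>
    tendsto_nhds_unique (hlim φ) (tendsto_const_nhds.congr'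
      ((hφ.filter_mono Nat.hyperfilter_le_atTop).mono fun n hn => hn.symm))
  have hpos : IsPositiveFunctional S := fun φ hφ =>
    ge_of_tendsto' (hlim φ) fun n => (hT.iterate_push hH n).positive φ hφ
  refine ⟨S, ⟨hpos.isContinuousFunctional, hpos, fun ψ φ h => ?_⟩, ?_, hzero⟩
  · exact hzero φ (Eventually.of_forall fun n => (hT.iterate_push hH n).closed ψ φ h)
  · exact tendsto_nhds_unique (hlim fubiniStudy)
      (tendsto_const_nhds.congr fun n => (hT.iterate_push_fubiniStudy hH hδ n).symm)

theorem iterate_push_lineCurrent_eq_zero (hH : IsHomMap δ H) (n : ℕ) {φ : smoothForms (2 * 1)}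
    (h : ∀ p, φ.1 (H^[n] (linePt p)) = 0) : hH.push^[n] lineCurrent φ = 0 := by
  induction n generalizing φ with
  | zero =>
    have hform : ∀ p, lineForm φ p = 0 := fun p => DFunLike.congr_fun (h p) _
    exact integral_eq_zero_of_ae (Eventually.of_forall hform)
  | succ n ih =>
    rw [Function.iterate_succ_apply', hH.push_apply, ih, mul_zero]
    intro p
    ext v
    rw [hH.pull_apply, ← Function.iterate_succ_apply' H, h p]
    rfl

end PushForward

namespace HomTriple

variable {d : ℕ} (T : HomTriple d) (hd : d ≠ 0) (ε : ℂ)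

theorem iterate_f_mk (n : ℕ) {z : CV 3} (hz : z ≠ 0) : ∃ h : (T.lift ε)^[n] z ≠ 0,
    (T.f hd ε)^[n] (Projectivization.mk ℂ z hz) = Projectivization.mk ℂ ((T.lift ε)^[n] z) h := by
  induction n generalizing z with
  | zero => exact ⟨hz, rfl⟩
  | succ n ih =>
    rw [Function.iterate_succ_apply, Function.iterate_succ_apply, T.f_mk]
    exact ih _

theorem supportsCurrent_one_attractingSet {ρ : ℝ} (hρ : 0 < ρ)
    (hU : IsTrappingRegion (T.f hd ε) (regionU ρ)) :
    SupportsCurrent (attractingSet (T.f hd ε) (regionU ρ)) 1 := by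
  have hH := T.isHomMap_lift hd ε
  obtain ⟨S, hS, hmass, hzero⟩ :=
    isPositiveClosedCurrent_lineCurrent.exists_limit_iterate_push hH hd
  have hline : ∀ p, Projectivization.mk ℂ (linePt p) (linePt_ne_zero p) ∈ regionU ρ := fun p => by
    have hhead : head (linePt p) ≠ 0 := fun h => one_ne_zero (congrFun h 1)
    rw [mk_mem_regionU, show linePt p 2 = 0 from rfl, norm_zero]
    exact mul_pos hρ (norm_pos_iff.2 hhead)
  refine ⟨S, hS, ?_, fun h => ?_⟩
  · rintro φ ⟨V, hV, hAV, hφ⟩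
    obtain ⟨N, hN⟩ := hU.exists_forall_iterate_image_subset (T.continuous_f hd ε) hV hAV
    refine hzero φ ((eventually_ge_atTop N).mono fun n hn => ?_)
    refine iterate_push_lineCurrent_eq_zero hH n fun p => ?_
    obtain ⟨hne, hmk⟩ := T.iterate_f_mk hd ε n (linePt_ne_zero p)
    exact hφ _ hne (hN n hn ⟨_, hline p, hmk⟩)
  · rw [h] at hmass
    exact lineCurrent_fubiniStudy_pos.ne hmass

end HomTriple

/-! ### Forms with compact support in an affine chart -/

/-- The identification of `ℂ²` with `ℝ⁴` through real and imaginary parts. -/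
def realCoords : ℂ × ℂ →L[ℝ] (Fin 4 → ℝ) :=
  ContinuousLinearMap.pi ![Complex.reCLM ∘L ContinuousLinearMap.fst ℝ ℂ ℂ,
    Complex.imCLM ∘L ContinuousLinearMap.fst ℝ ℂ ℂ, Complex.reCLM ∘L ContinuousLinearMap.snd ℝ ℂ ℂ,
    Complex.imCLM ∘L ContinuousLinearMap.snd ℝ ℂ ℂ]

theorem realCoords_apply (a b : ℂ) : realCoords (a, b) = ![a.re, a.im, b.re, b.im] := by
  funext l
  fin_cases l <;> rfl

/-- The first complex coordinate of `ℝ⁴ = ℂ²`. -/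
def fstC : (Fin 4 → ℝ) →L[ℝ] ℂ :=
  Complex.equivRealProdCLM.symm.toContinuousLinearMap ∘L
    (ContinuousLinearMap.proj 0).prod (ContinuousLinearMap.proj 1)

/-- The second complex coordinate of `ℝ⁴ = ℂ²`. -/
def sndC : (Fin 4 → ℝ) →L[ℝ] ℂ :=
  Complex.equivRealProdCLM.symm.toContinuousLinearMap ∘L
    (ContinuousLinearMap.proj 2).prod (ContinuousLinearMap.proj 3)

theorem fstC_apply (x : Fin 4 → ℝ) : fstC x = ⟨x 0, x 1⟩ := rfl

theorem sndC_apply (x : Fin 4 → ℝ) : sndC x = ⟨x 2, x 3⟩ := rfl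

theorem fstC_realCoords (w : ℂ × ℂ) : fstC (realCoords w) = w.1 := rfl

theorem sndC_realCoords (w : ℂ × ℂ) : sndC (realCoords w) = w.2 := rfl

theorem norm_le_max_fstC_sndC (x : Fin 4 → ℝ) : ‖x‖ ≤ max ‖fstC x‖ ‖sndC x‖ := by
  refine (pi_norm_le_iff_of_nonneg (le_max_of_le_left (norm_nonneg _))).2 fun l => ?_
  fin_cases l
  · exact le_max_of_le_left (Complex.abs_re_le_norm (fstC x))
  · exact le_max_of_le_left (Complex.abs_im_le_norm (fstC x))
  · exact le_max_of_le_right (Complex.abs_re_le_norm (sndC x))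
  · exact le_max_of_le_right (Complex.abs_im_le_norm (sndC x))

section Chart

/-- The value at `v` of the differential of `z k / z i` at `z`. -/
def ratioDeriv {n : ℕ} (i k : Fin n) (z v : CV n) : ℂ := (v k * z i - z k * v i) / z i ^ 2

theorem exists_hasFDerivAt_ratio {n : ℕ} (i k : Fin n) {z : CV n} (hz : z i ≠ 0) :
    ∃ L : CV n →L[ℝ] ℂ, HasFDerivAt (fun z : CV n => z k / z i) L z ∧
      ∀ v, L v = ratioDeriv i k z v := by
  have hcoord (l : Fin n) : HasFDerivAt (fun z : CV n => z l)
      (ContinuousLinearMap.proj l : CV n →L[ℂ] ℂ) z :=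
    (ContinuousLinearMap.proj l : CV n →L[ℂ] ℂ).hasFDerivAt
  have hinv : HasFDerivAt (fun x : CV n => (x i)⁻¹)
      ((-(z i ^ 2)⁻¹) • (ContinuousLinearMap.proj i : CV n →L[ℂ] ℂ)) z :=
    (hasDerivAt_inv hz).comp_hasFDerivAt z (hcoord i)
  simp only [div_eq_mul_inv]
  refine ⟨_, ((hcoord k).fun_mul hinv).restrictScalars ℝ, fun v => ?_⟩
  simp [ratioDeriv]
  field_simp
  ring

theorem ratioDeriv_smul_self {n : ℕ} (i k : Fin n) (z : CV n) (c : ℂ) :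
    ratioDeriv i k z (c • z) = 0 :=
  div_eq_zero_iff.2 (Or.inl (by simp only [Pi.smul_apply, smul_eq_mul]; ring))

theorem ratioDeriv_smul_smul {n : ℕ} (i k : Fin n) {c : ℂ} (hc : c ≠ 0) (z v : CV n) :
    ratioDeriv i k (c • z) (c • v) = ratioDeriv i k z v := by
  simp only [ratioDeriv, Pi.smul_apply, smul_eq_mul]
  rw [← mul_div_mul_left (v k * z i - z k * v i) (z i ^ 2) (pow_ne_zero 2 hc)]
  ring

theorem ratioDeriv_smul_right {n : ℕ} (i k : Fin n) (c : ℂ) (z v : CV n) :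
    ratioDeriv i k z (c • v) = c * ratioDeriv i k z v := by
  simp only [ratioDeriv, Pi.smul_apply, smul_eq_mul]
  ring

variable (σ : Equiv.Perm (Fin 3))

/-- The affine chart `(z (σ 1) / z (σ 0), z (σ 2) / z (σ 0))` of `ℙ²`, in real coordinates. -/
def chartMap (z : CV 3) : Fin 4 → ℝ := realCoords (z (σ 1) / z (σ 0), z (σ 2) / z (σ 0))

/-- The value at `v` of the differential of `chartMap σ` at `z`. -/
def chartDeriv (z v : CV 3) : Fin 4 → ℝ :=
  realCoords (ratioDeriv (σ 0) (σ 1) z v, ratioDeriv (σ 0) (σ 2) z v)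

/-- The domain of `chartMap σ`. -/
def chartDomain : Set (CV 3) := {z | z (σ 0) ≠ 0}

variable {σ}

theorem isOpen_chartDomain : IsOpen (chartDomain σ) :=
  isOpen_ne_fun (continuous_apply _) continuous_const

theorem smul_mem_chartDomain_iff {c : ℂ} (hc : c ≠ 0) {z : CV 3} :
    c • z ∈ chartDomain σ ↔ z ∈ chartDomain σ := by
  simp [chartDomain, hc]

theorem contDiffOn_chartMap : ContDiffOn ℝ ∞ (chartMap σ) (chartDomain σ) := by
  have hratio (l : Fin 3) : ContDiffOn ℝ ∞ (fun z : CV 3 => z l / z (σ 0)) (chartDomain σ) :=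
    ContDiffOn.restrict_scalars ℝ
      ((contDiff_apply ℂ ℂ l).contDiffOn.div (contDiff_apply ℂ ℂ (σ 0)).contDiffOn fun _ hz => hz)
  exact realCoords.contDiff.comp_contDiffOn ((hratio (σ 1)).prodMk (hratio (σ 2)))

theorem contDiffAt_chartMap {z : CV 3} (hz : z ∈ chartDomain σ) : ContDiffAt ℝ ∞ (chartMap σ) z :=
  contDiffOn_chartMap.contDiffAt (isOpen_chartDomain.mem_nhds hz)

theorem fderiv_chartMap {z : CV 3} (hz : z ∈ chartDomain σ) (v : CV 3) :
    fderiv ℝ (chartMap σ) z v = chartDeriv σ z v := by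
  obtain ⟨A, hA, hAv⟩ := exists_hasFDerivAt_ratio (σ 0) (σ 1) hz
  obtain ⟨B, hB, hBv⟩ := exists_hasFDerivAt_ratio (σ 0) (σ 2) hz
  have h : HasFDerivAt (chartMap σ) (realCoords ∘L A.prod B) z :=
    realCoords.hasFDerivAt.comp z (hA.prodMk hB)
  rw [h.fderiv, chartDeriv, ← hAv, ← hBv]
  rfl

theorem chartMap_smul {c : ℂ} (hc : c ≠ 0) (z : CV 3) : chartMap σ (c • z) = chartMap σ z := by
  simp only [chartMap, Pi.smul_apply, smul_eq_mul, mul_div_mul_left _ _ hc]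

theorem chartDeriv_smul_self (z : CV 3) (c : ℂ) : chartDeriv σ z (c • z) = 0 := by
  simp only [chartDeriv, ratioDeriv_smul_self]
  exact map_zero realCoords

theorem chartDeriv_smul_smul {c : ℂ} (hc : c ≠ 0) (z v : CV 3) :
    chartDeriv σ (c • z) (c • v) = chartDeriv σ z v := by
  simp only [chartDeriv, ratioDeriv_smul_smul _ _ hc]

theorem eventually_lt_norm_chartMap (B : ℝ) {z : CV 3} (hz : z ≠ 0) (hzσ : z ∉ chartDomain σ) :
    ∀ᶠ w in 𝓝 z, w ∈ chartDomain σ → B < ‖chartMap σ w‖ := by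
  have hzero : z (σ 0) = 0 := not_not.1 hzσ
  have hratio (l : Fin 3) (hl : z l ≠ 0) :
      ∀ᶠ w : CV 3 in 𝓝 z, w ∈ chartDomain σ → 2 * B < ‖w l / w (σ 0)‖ := by
    have hcont : ∀ᶠ w : CV 3 in 𝓝 z, 2 * B * ‖w (σ 0)‖ < ‖w l‖ := by
      refine ((continuous_apply (σ 0)).norm.const_mul (2 * B)).continuousAt.eventually_lt
        (continuous_apply l).norm.continuousAt ?_
      rw [hzero, norm_zero, mul_zero]
      exact norm_pos_iff.2 hl
    filter_upwards [hcont] with w hw hwσ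
    rwa [norm_div, lt_div_iff₀ (norm_pos_iff.2 hwσ)]
  have hbound (a b : ℂ) : ‖a‖ ≤ 2 * ‖realCoords (a, b)‖ ∧ ‖b‖ ≤ 2 * ‖realCoords (a, b)‖ := by
    have h := norm_le_pi_norm (realCoords (a, b))
    have ha := Complex.norm_le_abs_re_add_abs_im a
    have hb := Complex.norm_le_abs_re_add_abs_im b
    exact ⟨ha.trans ((add_le_add (h 0) (h 1)).trans_eq (two_mul _).symm),
      hb.trans ((add_le_add (h 2) (h 3)).trans_eq (two_mul _).symm)⟩
  obtain ⟨l, hl⟩ := Function.ne_iff.1 hz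
  obtain ⟨m, rfl⟩ := σ.surjective l
  filter_upwards [hratio _ hl] with w hw hwσ
  have hle := hbound (w (σ 1) / w (σ 0)) (w (σ 2) / w (σ 0))
  have hlt := hw hwσ
  change B < ‖realCoords _‖
  fin_cases m
  · exact absurd hzero hl
  · exact lt_of_mul_lt_mul_left (hlt.trans_le hle.1) zero_le_two
  · exact lt_of_mul_lt_mul_left (hlt.trans_le hle.2) zero_le_two

end Chart

section ExtDeriv

variable {E F : Type*} [NormedAddCommGroup E] [NormedSpace ℝ E] [NormedAddCommGroup F]
  [NormedSpace ℝ F] {r : ℕ} {θ : E → E [⋀^Fin r]→L[ℝ] F}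

theorem contDiff_extDeriv (hθ : ContDiff ℝ ∞ θ) : ContDiff ℝ ∞ (extDeriv θ) :=
  (ContinuousAlternatingMap.alternatizeUncurryFinCLM ℝ E F).contDiff.comp
    (hθ.fderiv_right (by simp))

theorem hasCompactSupport_extDeriv (hsupp : HasCompactSupport θ) :
    HasCompactSupport (extDeriv θ) :=
  (hsupp.fderiv ℝ).comp_left (map_zero (ContinuousAlternatingMap.alternatizeUncurryFinCLM ℝ E F))

theorem extDeriv_zero (x : E) : extDeriv (0 : E → E [⋀^Fin r]→L[ℝ] F) x = 0 := by
  rw [extDeriv, fderiv_zero]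
  exact map_zero (ContinuousAlternatingMap.alternatizeUncurryFinCLM ℝ E F)

end ExtDeriv

section ChartForm

variable {σ : Equiv.Perm (Fin 3)} {r : ℕ} {θ : (Fin 4 → ℝ) → (Fin 4 → ℝ) [⋀^Fin r]→L[ℝ] ℝ}

/-- The pull-back of a form on `ℂ²` by an affine chart, extended by zero outside of the chart. -/
def chartPullback (σ : Equiv.Perm (Fin 3)) (θ : (Fin 4 → ℝ) → (Fin 4 → ℝ) [⋀^Fin r]→L[ℝ] ℝ) :
    CV 3 → CV 3 [⋀^Fin r]→L[ℝ] ℝ :=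
  (chartDomain σ).indicator (pullbackForm (chartMap σ) θ)

theorem chartPullback_of_notMem {z : CV 3} (hz : z ∉ chartDomain σ) : chartPullback σ θ z = 0 :=
  Set.indicator_of_notMem hz _

theorem chartPullback_apply {z : CV 3} (hz : z ∈ chartDomain σ) (v : Fin r → CV 3) :
    chartPullback σ θ z v = θ (chartMap σ z) fun l => chartDeriv σ z (v l) := by
  rw [chartPullback, Set.indicator_of_mem hz, pullbackForm_apply]
  simp only [fderiv_chartMap hz]

theorem chartPullback_eventuallyEq {z : CV 3} (hz : z ∈ chartDomain σ) :
    chartPullback σ θ =ᶠ[𝓝 z] pullbackForm (chartMap σ) θ :=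
  Set.eqOn_indicator.eventuallyEq_of_mem (isOpen_chartDomain.mem_nhds hz)

theorem chartPullback_eventuallyEq_zero (hsupp : HasCompactSupport θ) {z : CV 3} (hz : z ≠ 0)
    (hzσ : z ∉ chartDomain σ) : chartPullback σ θ =ᶠ[𝓝 z] 0 := by
  obtain ⟨B, -, hB⟩ := hsupp.exists_pos_le_norm
  filter_upwards [eventually_lt_norm_chartMap B hz hzσ] with w hw
  by_cases hwσ : w ∈ chartDomain σ
  · rw [chartPullback, Set.indicator_of_mem hwσ, pullbackForm, hB _ (hw hwσ).le]
    rfl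
  · exact chartPullback_of_notMem hwσ

theorem contDiffOn_chartPullback (hθ : ContDiff ℝ ∞ θ) (hsupp : HasCompactSupport θ) :
    ContDiffOn ℝ ∞ (chartPullback σ θ) {0}ᶜ := by
  refine fun z hz => ContDiffAt.contDiffWithinAt ?_
  by_cases hzσ : z ∈ chartDomain σ
  · have hpull : ContDiffOn ℝ ∞ (pullbackForm (chartMap σ) θ) (chartDomain σ) :=
      contDiffOn_pullbackForm hθ.contDiffOn isOpen_chartDomain contDiffOn_chartMap
        (Set.mapsTo_univ _ _)
    exact (hpull.contDiffAt (isOpen_chartDomain.mem_nhds hzσ)).congr_of_eventuallyEq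
      (chartPullback_eventuallyEq hzσ)
  · exact (contDiffAt_const (c := 0)).congr_of_eventuallyEq
      (chartPullback_eventuallyEq_zero hsupp hz hzσ)

/-- The form on `ℙ²` given by a form with compact support in an affine chart. -/
def chartForm (σ : Equiv.Perm (Fin 3)) (θ : (Fin 4 → ℝ) → (Fin 4 → ℝ) [⋀^Fin r]→L[ℝ] ℝ)
    (hθ : ContDiff ℝ ∞ θ) (hsupp : HasCompactSupport θ) : smoothForms r :=
  ⟨chartPullback σ θ, chartPullback_of_notMem (not_not.2 rfl), contDiffOn_chartPullback hθ hsupp,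
    fun z _ v ⟨l, c, hv⟩ => by
      by_cases hzσ : z ∈ chartDomain σ
      · rw [chartPullback_apply hzσ]
        exact (θ _).map_coord_zero l (by rw [hv, chartDeriv_smul_self])
      · rw [chartPullback_of_notMem hzσ]
        rfl,
    fun z _ c hc v => by
      by_cases hzσ : z ∈ chartDomain σ
      · rw [chartPullback_apply hzσ, chartPullback_apply ((smul_mem_chartDomain_iff hc).2 hzσ),
          chartMap_smul hc]
        simp only [chartDeriv_smul_smul hc]
      · rw [chartPullback_of_notMem hzσ,
          chartPullback_of_notMem (mt (smul_mem_chartDomain_iff hc).1 hzσ)]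
        rfl⟩

theorem chartPullback_extDeriv (hθ : ContDiff ℝ ∞ θ) (hsupp : HasCompactSupport θ) {z : CV 3}
    (hz : z ≠ 0) : chartPullback σ (extDeriv θ) z = extDeriv (chartPullback σ θ) z := by
  by_cases hzσ : z ∈ chartDomain σ
  · rw [(chartPullback_eventuallyEq hzσ).extDeriv_eq,
      extDeriv_pullbackForm (hθ.differentiable (by simp) _) (contDiffAt_chartMap hzσ)]
    exact Set.indicator_of_mem hzσ _
  · rw [(chartPullback_eventuallyEq_zero hsupp hz hzσ).extDeriv_eq, chartPullback_of_notMem hzσ,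
      extDeriv_zero]

theorem IsClosedFunctional.apply_chartForm_extDeriv {p : ℕ}
    {T : smoothForms (2 * (p + 1)) →ₗ[ℝ] ℝ} (hT : IsClosedFunctional T)
    {θ : (Fin 4 → ℝ) → (Fin 4 → ℝ) [⋀^Fin (2 * p + 1)]→L[ℝ] ℝ} (hθ : ContDiff ℝ ∞ θ)
    (hsupp : HasCompactSupport θ) :
    T (chartForm σ (extDeriv θ) (contDiff_extDeriv hθ) (hasCompactSupport_extDeriv hsupp)) = 0 :=
  hT (chartForm σ θ hθ hsupp) _ fun _ hz => chartPullback_extDeriv hθ hsupp hz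

end ChartForm

/-! ### The volume form -/

section VolForm

variable {n : ℕ}

/-- The determinant, as a form of top degree on `ℝⁿ`. -/
def volForm (n : ℕ) : (Fin n → ℝ) [⋀^Fin n]→L[ℝ] ℝ :=
  { (Matrix.detRowAlternating : (Fin n → ℝ) [⋀^Fin n]→ₗ[ℝ] ℝ) with
    cont := continuous_id.matrix_det }

theorem volForm_apply (v : Fin n → Fin n → ℝ) : volForm n v = Matrix.det (Matrix.of v) := rfl

theorem form_eq_mul_volForm (Φ : (Fin n → ℝ) [⋀^Fin n]→L[ℝ] ℝ) (v : Fin n → Fin n → ℝ) :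
    Φ v = Φ (fun l => Pi.single l 1) * volForm n v := by
  have h := congrArg (· v)
    (AlternatingMap.eq_smul_basis_det (Pi.basisFun ℝ (Fin n)) Φ.toAlternatingMap)
  simp only [Pi.basisFun_det, funext (Pi.basisFun_apply ℝ (Fin n))] at h
  exact h

theorem volForm_single : volForm n (fun l => Pi.single l 1) = 1 := by
  have hone : Matrix.of (fun l : Fin n => Pi.single l (1 : ℝ)) = 1 := by
    ext i j
    simp [Matrix.one_apply, Pi.single_apply, eq_comm]
  rw [volForm_apply, hone, Matrix.det_one]

theorem volForm_complex (a b a' b' : ℂ) :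
    volForm 4 ![realCoords (a, b), realCoords (Complex.I * a, Complex.I * b), realCoords (a', b'),
      realCoords (Complex.I * a', Complex.I * b')] = Complex.normSq (a * b' - b * a') := by
  rw [volForm_apply, Matrix.det_succ_row_zero]
  simp [realCoords_apply, Fin.sum_univ_succ, Matrix.det_fin_three, Matrix.submatrix_apply,
    Fin.succAbove, Complex.normSq_apply]
  ring

theorem extDeriv_smul_volForm_curryLeft {g : (Fin (n + 1) → ℝ) → ℝ} {x : Fin (n + 1) → ℝ}
    (hg : DifferentiableAt ℝ g x) :
    extDeriv (fun x => g x • (volForm (n + 1)).curryLeft (Pi.single 0 1)) x =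
      fderiv ℝ g x (Pi.single 0 1) • volForm (n + 1) := by
  let e : Fin (n + 1) → Fin (n + 1) → ℝ := fun l => Pi.single l 1
  have hremove (i : Fin (n + 1)) (y : Fin (n + 1) → ℝ) :
      (g y • (volForm (n + 1)).curryLeft (e 0)) (Fin.removeNth i e) = if i = 0 then g y else 0 := by
    change g y * volForm (n + 1) (Matrix.vecCons (e 0) (Fin.removeNth i e)) = _
    split_ifs with hi
    · subst hi
      rw [show Matrix.vecCons (e 0) (Fin.removeNth 0 e) = e from Fin.cons_self_tail e,
        volForm_single, mul_one]
    · obtain ⟨j, rfl⟩ := Fin.exists_succ_eq.2 hi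
      obtain ⟨k, hk⟩ := Fin.exists_succAbove_eq (Fin.succ_ne_zero j).symm
      refine mul_eq_zero_of_right _ ((volForm (n + 1)).map_eq_zero_of_eq _ (i := 0) (j := k.succ)
        ?_ (Fin.succ_ne_zero k).symm)
      change e 0 = e (j.succ.succAbove k)
      rw [hk]
  have hbasis : extDeriv (fun x => g x • (volForm (n + 1)).curryLeft (e 0)) x e =
      fderiv ℝ g x (e 0) := by
    rw [extDeriv_apply (hg.smul_const _), Finset.sum_eq_single 0 (fun i _ hi => ?_) (by simp)]
    · simp only [hremove, if_true, Fin.val_zero, pow_zero, one_smul]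
    · simp only [hremove, if_neg hi, fderiv_fun_const, Pi.zero_apply, zero_apply, smul_zero]
  ext v
  rw [form_eq_mul_volForm]
  exact congrArg (· * _) hbasis

end VolForm

/-! ### Cut-off functions -/

/-- A smooth bump function on `ℂ`, equal to `1` on the disc of radius `1` and supported in the
disc of radius `3`. -/
def discBump : ContDiffBump (0 : ℂ) := ⟨1, 3, one_pos, by norm_num⟩

theorem discBump_eq_one {w : ℂ} (h : ‖w‖ ≤ 1) : discBump w = 1 :=
  discBump.one_of_mem_closedBall (by simpa [discBump] using h)

theorem discBump_eq_zero {w : ℂ} (h : 3 ≤ ‖w‖) : discBump w = 0 :=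
  discBump.zero_of_le_dist (by simpa [discBump] using h)

/-- A smooth bump function on `ℂ² = ℝ⁴`, equal to `1` on the unit bidisc. -/
def cutoff (x : Fin 4 → ℝ) : ℝ := discBump (fstC x) * discBump (sndC x)

theorem contDiff_cutoff : ContDiff ℝ ∞ cutoff :=
  (discBump.contDiff.comp fstC.contDiff).mul (discBump.contDiff.comp sndC.contDiff)

theorem cutoff_nonneg (x : Fin 4 → ℝ) : 0 ≤ cutoff x := mul_nonneg discBump.nonneg discBump.nonneg

theorem cutoff_eq_one {x : Fin 4 → ℝ} (hfst : ‖fstC x‖ ≤ 1) (hsnd : ‖sndC x‖ ≤ 1) :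
    cutoff x = 1 := by
  rw [cutoff, discBump_eq_one hfst, discBump_eq_one hsnd, mul_one]

theorem cutoff_eq_zero {x : Fin 4 → ℝ} (h : 3 ≤ ‖fstC x‖ ∨ 3 ≤ ‖sndC x‖) : cutoff x = 0 :=
  mul_eq_zero.2 (h.imp discBump_eq_zero discBump_eq_zero)

theorem hasCompactSupport_cutoff : HasCompactSupport cutoff :=
  HasCompactSupport.intro (isCompact_closedBall 0 3) fun x hx => by
    rw [mem_closedBall_zero_iff, not_le] at hx
    exact cutoff_eq_zero (le_max_iff.1 (hx.le.trans (norm_le_max_fstC_sndC x)))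

theorem fderiv_cutoff_single_zero {x : Fin 4 → ℝ} (h : ‖fstC x‖ < 1 ∨ 3 ≤ ‖sndC x‖) :
    fderiv ℝ cutoff x (Pi.single 0 1) = 0 := by
  have hsnd (t : ℝ) : sndC (x + t • Pi.single 0 1) = sndC x := by
    simp [sndC_apply]
  have hconst : (fun t : ℝ => cutoff (x + t • Pi.single 0 1)) =ᶠ[𝓝 0] fun _ => cutoff x := by
    rcases h with h | h
    · have hnear : ∀ᶠ t : ℝ in 𝓝 0, ‖fstC (x + t • Pi.single 0 1)‖ < 1 :=
        ContinuousAt.eventually_lt (by fun_prop) continuousAt_const (by simpa using h)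
      filter_upwards [hnear] with t ht
      rw [cutoff, cutoff, hsnd, discBump_eq_one ht.le, discBump_eq_one h.le]
    · filter_upwards with t
      rw [cutoff_eq_zero (Or.inr h), cutoff_eq_zero (Or.inr (by rwa [hsnd]))]
  rw [← (contDiff_cutoff.differentiable (by simp) x).lineDeriv_eq_fderiv, lineDeriv,
    hconst.deriv_eq, deriv_const]

/-- The product of `cutoff` and the first real coordinate, a primitive of `cutoff` in this
coordinate wherever `cutoff` does not depend on it. -/
def cutoffPrimitive (x : Fin 4 → ℝ) : ℝ := x 0 * cutoff x

theorem contDiff_cutoffPrimitive : ContDiff ℝ ∞ cutoffPrimitive :=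
  (contDiff_apply ℝ ℝ 0).mul contDiff_cutoff

theorem hasCompactSupport_cutoffPrimitive : HasCompactSupport cutoffPrimitive :=
  hasCompactSupport_cutoff.mul_left

theorem fderiv_cutoffPrimitive_single_zero {x : Fin 4 → ℝ} (h : ‖fstC x‖ < 1 ∨ 3 ≤ ‖sndC x‖) :
    fderiv ℝ cutoffPrimitive x (Pi.single 0 1) = cutoff x := by
  have hcutoff : DifferentiableAt ℝ cutoff x := contDiff_cutoff.differentiable (by simp) x
  have hcoord : HasFDerivAt (fun x : Fin 4 → ℝ => x 0)
    (ContinuousLinearMap.proj 0 : (Fin 4 → ℝ) →L[ℝ] ℝ) x := hasFDerivAt_apply 0 x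
  have hmul : fderiv ℝ cutoffPrimitive x = x 0 • fderiv ℝ cutoff x + cutoff x •
      (ContinuousLinearMap.proj 0 : (Fin 4 → ℝ) →L[ℝ] ℝ) :=
    (hcoord.mul hcutoff.hasFDerivAt).fderiv
  simp [hmul, fderiv_cutoff_single_zero h]

/-! ### Currents of bidimension `(2, 2)` -/

section BumpForm

variable (σ : Equiv.Perm (Fin 3))

/-- A positive form of top degree supported in an affine chart. -/
def bumpForm : smoothForms (2 * 2) :=
  chartForm (r := 2 * 2) σ (fun x => cutoff x • volForm 4) (contDiff_cutoff.smul contDiff_const)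
    hasCompactSupport_cutoff.smul_right

/-- An exact form supported in an affine chart, which agrees with `bumpForm σ` wherever `cutoff`
does not depend on the first coordinate of the chart. -/
def exactBumpForm : smoothForms (2 * 2) :=
  chartForm (r := 2 * 2) σ
    (extDeriv fun x => cutoffPrimitive x • (volForm 4).curryLeft (Pi.single 0 1))
    (contDiff_extDeriv (contDiff_cutoffPrimitive.smul contDiff_const))
    (hasCompactSupport_extDeriv hasCompactSupport_cutoffPrimitive.smul_right)

variable {σ}

theorem bumpForm_of_notMem {z : CV 3} (hz : z ∉ chartDomain σ) : (bumpForm σ).1 z = 0 :=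
  chartPullback_of_notMem hz

theorem bumpForm_apply {z : CV 3} (hz : z ∈ chartDomain σ) (v : Fin (2 * 2) → CV 3) :
    (bumpForm σ).1 z v =
      cutoff (chartMap σ z) * volForm 4 fun l : Fin 4 => chartDeriv σ z (v l) :=
  chartPullback_apply (r := 2 * 2) hz v

theorem bumpForm_eq_zero {z : CV 3}
    (h : 3 * ‖z (σ 0)‖ ≤ ‖z (σ 1)‖ ∨ 3 * ‖z (σ 0)‖ ≤ ‖z (σ 2)‖) : (bumpForm σ).1 z = 0 := by
  by_cases hz : z ∈ chartDomain σ
  · have hratio (l : Fin 3) (hl : 3 * ‖z (σ 0)‖ ≤ ‖z l‖) : 3 ≤ ‖z l / z (σ 0)‖ := by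
      rwa [norm_div, le_div_iff₀ (norm_pos_iff.2 hz)]
    ext v
    rw [bumpForm_apply hz, cutoff_eq_zero (h.imp (hratio _) (hratio _)), zero_mul]
    rfl
  · exact bumpForm_of_notMem hz

theorem bumpForm_eq_exactBumpForm {z : CV 3}
    (h : ‖z (σ 1)‖ < ‖z (σ 0)‖ ∨ 3 * ‖z (σ 0)‖ ≤ ‖z (σ 2)‖) :
    (bumpForm σ).1 z = (exactBumpForm σ).1 z := by
  by_cases hz : z ∈ chartDomain σ
  · have hpos : 0 < ‖z (σ 0)‖ := norm_pos_iff.2 hz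
    have hcutoff : fderiv ℝ cutoffPrimitive (chartMap σ z) (Pi.single 0 1) =
        cutoff (chartMap σ z) := by
      refine fderiv_cutoffPrimitive_single_zero (h.imp (fun hlt => ?_) fun hle => ?_)
      · rwa [chartMap, fstC_realCoords, norm_div, div_lt_one hpos]
      · rwa [chartMap, sndC_realCoords, norm_div, le_div_iff₀ hpos]
    ext v
    refine (chartPullback_apply hz v).trans (Eq.trans ?_ (chartPullback_apply hz v).symm)
    rw [extDeriv_smul_volForm_curryLeft (contDiff_cutoffPrimitive.differentiable (by simp) _),
      hcutoff]
  · exact (chartPullback_of_notMem hz).trans (chartPullback_of_notMem hz).symm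

theorem volForm_chartDeriv_complexTuple_nonneg (z : CV 3) (v : Fin 2 → CV 3) :
    0 ≤ volForm 4 fun l : Fin 4 => chartDeriv σ z (complexTuple v l) := by
  have h := Complex.normSq_nonneg
    (ratioDeriv (σ 0) (σ 1) z (v 0) * ratioDeriv (σ 0) (σ 2) z (v 1) -
      ratioDeriv (σ 0) (σ 2) z (v 0) * ratioDeriv (σ 0) (σ 1) z (v 1))
  rw [← volForm_complex] at h
  convert h using 2
  funext l
  fin_cases l <;> simp [complexTuple, chartDeriv, ratioDeriv_smul_right]

theorem bumpForm_complexTuple_nonneg (z : CV 3) (v : Fin 2 → CV 3) :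
    0 ≤ (bumpForm σ).1 z (complexTuple v) := by
  by_cases hz : z ∈ chartDomain σ
  · rw [bumpForm_apply hz]
    exact mul_nonneg (cutoff_nonneg _) (volForm_chartDeriv_complexTuple_nonneg z v)
  · rw [bumpForm_of_notMem hz]
    rfl

variable (σ) in
/-- A right inverse of `chartDeriv σ z`. -/
def chartSection (z : CV 3) : (Fin 4 → ℝ) →L[ℝ] CV 3 :=
  z (σ 0) • (ContinuousLinearMap.single ℝ (fun _ => ℂ) (σ 1) ∘L fstC +
    ContinuousLinearMap.single ℝ (fun _ => ℂ) (σ 2) ∘L sndC)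

theorem chartSection_chartDeriv_add_smul {z : CV 3} (hz : z ∈ chartDomain σ) (w : CV 3) :
    chartSection σ z (chartDeriv σ z w) + (w (σ 0) / z (σ 0)) • z = w := by
  have hz' : z (σ 0) ≠ 0 := hz
  funext m
  obtain ⟨l, rfl⟩ := σ.surjective m
  simp only [chartSection, chartDeriv, ratioDeriv]
  fin_cases l <;> simp [fstC_realCoords, sndC_realCoords] <;> field_simp <;> ring

theorem norm_chartSection_single_le (z : CV 3) (l : Fin 4) :
    ‖chartSection σ z (Pi.single l 1)‖ ≤ ‖z‖ := by
  refine le_trans (le_of_eq ?_) (norm_le_pi_norm z (σ 0))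
  have hI : ‖(⟨0, 1⟩ : ℂ)‖ = 1 := Complex.norm_I
  have hone : ‖(⟨1, 0⟩ : ℂ)‖ = 1 := norm_one
  have hzero : (⟨0, 0⟩ : ℂ) = 0 := rfl
  fin_cases l <;>
    simp [chartSection, fstC_apply, sndC_apply, norm_smul, Pi.norm_single, hI, hone, hzero]

theorem abs_form_apply_le_volForm (φ : smoothForms (2 * 2)) {M : ℝ}
    (hM : ∀ z : CV 3, ‖z‖ = 1 → ‖φ.1 z‖ ≤ M) {z : CV 3} (hz : z ∈ chartDomain σ)
    (v : Fin (2 * 2) → CV 3) :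
    |φ.1 z v| ≤ M * |volForm 4 fun l : Fin 4 => chartDeriv σ z (v l)| := by
  have hz₀ : z ≠ 0 := fun h => hz (congrFun h _)
  have hM₀ : 0 ≤ M := nonneg_of_forall_norm_form_le hM
  let L := chartSection σ z
  have hchart : φ.1 z v =
      (φ.1 z).compContinuousLinearMap L fun l : Fin 4 => chartDeriv σ z (v l) := by
    have h := form_apply_add_smul φ hz₀ (fun l => L (chartDeriv σ z (v l)))
      fun l => v l (σ 0) / z (σ 0)
    simp only [L, chartSection_chartDeriv_add_smul hz] at h
    exact h
  have hframe : |φ.1 z fun l : Fin 4 => L (Pi.single l 1)| ≤ M :=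
    (abs_form_apply_le φ hM hz₀ _).trans (mul_le_of_le_one_right hM₀
      (Finset.prod_le_one (fun _ _ => by positivity) fun l _ =>
        div_le_one_of_le₀ (norm_chartSection_single_le z l) (norm_nonneg z)))
  rw [hchart, form_eq_mul_volForm, abs_mul]
  exact mul_le_mul_of_nonneg_right hframe (abs_nonneg _)

theorem abs_form_le_bumpForm (φ : smoothForms (2 * 2)) {M : ℝ}
    (hM : ∀ z : CV 3, ‖z‖ = 1 → ‖φ.1 z‖ ≤ M) {z : CV 3} (hz : z ≠ 0)
    (hmax : ∀ l, ‖z l‖ ≤ ‖z (σ 0)‖) (v : Fin 2 → CV 3) :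
    |φ.1 z (complexTuple v)| ≤ M * (bumpForm σ).1 z (complexTuple v) := by
  have hzσ : z ∈ chartDomain σ := fun h =>
    hz (funext fun l => norm_le_zero_iff.1 ((hmax l).trans_eq (by rw [h, norm_zero])))
  have hratio (l : Fin 3) : ‖z l / z (σ 0)‖ ≤ 1 := by
    rw [norm_div]
    exact div_le_one_of_le₀ (hmax l) (norm_nonneg _)
  rw [bumpForm_apply hzσ, cutoff_eq_one (hratio (σ 1)) (hratio (σ 2)), one_mul]
  exact (abs_form_apply_le_volForm φ hM hzσ _).trans_eq
    (congrArg (M * ·) (abs_of_nonneg (volForm_chartDeriv_complexTuple_nonneg z v)))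

theorem apply_eq_of_isSupportedIn {r : ℕ} {T : smoothForms r →ₗ[ℝ] ℝ} {A V : Set (PS 3)}
    (hT : IsSupportedIn T A) (hV : IsOpen V) (hAV : A ⊆ V) {φ ψ : smoothForms r}
    (h : ∀ (z : CV 3) (hz : z ≠ 0), Projectivization.mk ℂ z hz ∈ V → φ.1 z = ψ.1 z) :
    T φ = T ψ := by
  rw [← sub_eq_zero, ← map_sub]
  exact hT _ ⟨V, hV, hAV, fun z hz hzV => sub_eq_zero.2 (h z hz hzV)⟩

end BumpForm

/-- A permutation sending `0` to `i`, which selects the affine chart where `z i ≠ 0`. For `i ≠ 2`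
the first coordinate of the chart is `z 2 / z i`. -/
def chartPerm : Fin 3 → Equiv.Perm (Fin 3) := ![Equiv.swap 1 2, finRotate 3, Equiv.swap 0 2]

theorem chartPerm_apply_zero (i : Fin 3) : chartPerm i 0 = i := by
  fin_cases i <;> rfl

theorem lt_norm_of_mk_mem_regionU {ρ : ℝ} (hρ : ρ ≤ 1 / 3) {z : CV 3} {hz : z ≠ 0}
    (h : Projectivization.mk ℂ z hz ∈ regionU ρ) : 3 * ‖z 2‖ < ‖z 0‖ ∨ 3 * ‖z 2‖ < ‖z 1‖ := by
  have hle := mul_le_mul_of_nonneg_right hρ (norm_nonneg (head z))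
  have hlt : 3 * ‖z 2‖ < ‖head z‖ := by linarith [(mk_mem_regionU hz).1 h]
  rwa [norm_head, lt_max_iff] at hlt

theorem IsPositiveClosedCurrent.apply_bumpForm_chartPerm {A : Set (PS 3)} {ρ : ℝ}
    (hρ : ρ ≤ 1 / 3) (hA : A ⊆ regionU ρ) {T : smoothForms (2 * 2) →ₗ[ℝ] ℝ}
    (hT : IsPositiveClosedCurrent T) (hTA : IsSupportedIn T A) (i : Fin 3) :
    T (bumpForm (chartPerm i)) = 0 := by
  have hexact : T (exactBumpForm (chartPerm i)) = 0 :=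
    hT.closed.apply_chartForm_extDeriv (p := 1)
      (contDiff_cutoffPrimitive.smul contDiff_const) hasCompactSupport_cutoffPrimitive.smul_right
  have hzero : T (0 : smoothForms (2 * 2)) = 0 := map_zero T
  have hsupp (ψ : smoothForms (2 * 2)) (hψ : ∀ z : CV 3, (3 * ‖z 2‖ < ‖z 0‖ ∨ 3 * ‖z 2‖ < ‖z 1‖) →
      (bumpForm (chartPerm i)).1 z = ψ.1 z) : T (bumpForm (chartPerm i)) = T ψ :=
    apply_eq_of_isSupportedIn hTA (isOpen_regionU ρ) hA fun z hz hzU =>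
      hψ z (lt_norm_of_mk_mem_regionU hρ hzU)
  have hcases (z : CV 3) (a b : Fin 3) (h : 3 * ‖z 2‖ < ‖z a‖ ∨ 3 * ‖z 2‖ < ‖z b‖) :
      ‖z 2‖ < ‖z a‖ ∨ 3 * ‖z a‖ ≤ ‖z b‖ := by
    by_contra! hcon
    rcases h with h | h <;> linarith [norm_nonneg (z 2)]
  match i with
  | 0 => exact (hsupp _ fun z h => bumpForm_eq_exactBumpForm (hcases z 0 1 h)).trans hexact
  | 1 => exact (hsupp _ fun z h => bumpForm_eq_exactBumpForm (hcases z 1 0 h.symm)).trans hexact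
  | 2 => exact (hsupp 0 fun z h => bumpForm_eq_zero (h.symm.imp le_of_lt le_of_lt)).trans hzero

theorem not_supportsCurrent_two {A : Set (PS 3)} {ρ : ℝ} (hρ : ρ ≤ 1 / 3) (hA : A ⊆ regionU ρ) :
    ¬ SupportsCurrent A 2 := by
  rintro ⟨T, hT, hTA, hT₀⟩
  refine hT₀ (LinearMap.ext fun φ => abs_nonpos_iff.1 ?_)
  obtain ⟨M, hM⟩ := exists_norm_form_le φ
  let Ω : smoothForms (2 * 2) := ∑ i, bumpForm (chartPerm i)
  have hΩ : T Ω = 0 := by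
    rw [map_sum]
    exact Finset.sum_eq_zero fun i _ => hT.apply_bumpForm_chartPerm hρ hA hTA i
  have hdom : ∀ z ≠ 0, ∀ v : Fin 2 → CV 3,
      |φ.1 z (complexTuple v)| ≤ M * Ω.1 z (complexTuple v) := by
    intro z hz v
    obtain ⟨i, hi⟩ := Finite.exists_max fun l => ‖z l‖
    have hΩv : Ω.1 z (complexTuple v) = ∑ i, (bumpForm (chartPerm i)).1 z (complexTuple v) := by
      simp [Ω]
    rw [hΩv]
    refine (abs_form_le_bumpForm φ hM hz (σ := chartPerm i)
      (by rwa [chartPerm_apply_zero]) v).trans (mul_le_mul_of_nonneg_left ?_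
        (nonneg_of_forall_norm_form_le hM))
    exact Finset.single_le_sum (f := fun i => (bumpForm (chartPerm i)).1 z (complexTuple v))
      (fun _ _ => bumpForm_complexTuple_nonneg z v) (Finset.mem_univ i)
  simpa only [hΩ, mul_zero] using hT.positive.abs_apply_le hdom

/-! ### The choice of the constants -/

theorem eventually_exists_radius {d : ℕ} (hd : 2 ≤ d) {c C η : ℝ} (hc : 0 < c) (hC : 0 < C)
    (hη : 0 < η) :
    ∀ᶠ e : ℝ in 𝓝[>] 0, ∃ ρ : ℝ, 0 < ρ ∧ ρ ≤ 1 / 3 ∧ 2 * (ρ ^ d + e * C) ≤ c * ρ ∧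
      2 * (ρ ^ d / c) ≤ η * e := by
  have hsmall (a : ℝ) {b : ℝ} (hb : 0 < b) : ∀ᶠ e : ℝ in 𝓝 0, a * e < b :=
    ContinuousAt.eventually_lt (by fun_prop) continuousAt_const (by rwa [mul_zero])
  let K : ℝ := 4 * C / c
  have hK : 0 < K := by positivity
  have hKC : c * K = 4 * C := mul_div_cancel₀ _ hc.ne'
  filter_upwards [self_mem_nhdsWithin,
    nhdsWithin_le_nhds (hsmall K (by norm_num : (0 : ℝ) < 1 / 3)),
    nhdsWithin_le_nhds (hsmall (2 * K) (half_pos hc)),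
    nhdsWithin_le_nhds (hsmall (2 * K ^ 2) (mul_pos hη hc))] with e (he : 0 < e) h₁ h₂ h₃
  have hρ : 0 < K * e := mul_pos hK he
  have hpow : (K * e) ^ d ≤ (K * e) ^ 2 := pow_le_pow_of_le_one hρ.le (by linarith) hd
  refine ⟨K * e, hρ, h₁.le, ?_, ?_⟩
  · calc 2 * ((K * e) ^ d + e * C)
      _ ≤ 2 * K * e * (K * e) + 2 * C * e := by linarith
      _ ≤ c / 2 * (K * e) + 2 * C * e := by gcongr
      _ = c * (K * e) := by linear_combination -e / 2 * hKC
  · rw [← mul_div_assoc, div_le_iff₀ hc]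
    calc 2 * (K * e) ^ d
      _ ≤ 2 * K ^ 2 * e * e := by linarith
      _ ≤ η * c * e := by gcongr
      _ = η * e * c := by ring

/-! ### Small topological degree -/

namespace HomTriple

variable {d : ℕ} (T : HomTriple d) {ε : ℂ} {ρ : ℝ}

theorem exists_pos_forall_not_near (hd : d ≠ 0) (hXY : Disjoint T.X T.Y)
    (hZ : T.fInf^[2] ⁻¹' T.Z ∩ T.fInf ⁻¹' T.Z ∩ T.Z = ∅) :
    ∃ η > 0, ∀ b : CV 2, b ≠ 0 → ¬ (T.NearX η b ∧ T.NearY η b) ∧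
      ¬ (T.NearZ η b ∧ T.NearZ η (T.liftInf b) ∧ T.NearZ η (T.liftInf (T.liftInf b))) := by
  obtain ⟨η₁, hη₁, h₁⟩ := T.exists_pos_forall_not_nearX_and_nearY hd hXY
  obtain ⟨η₂, hη₂, h₂⟩ := T.exists_pos_forall_not_nearZ_iterate hd hZ
  have hle₁ := min_le_left η₁ η₂
  have hle₂ := min_le_right η₁ η₂
  exact ⟨min η₁ η₂, lt_min hη₁ hη₂, fun b hb => ⟨fun h => h₁ b hb ⟨h.1.mono hle₁, h.2.mono hle₁⟩,
    fun h => h₂ b hb ⟨h.1.mono hle₂, h.2.1.mono hle₂, h.2.2.mono hle₂⟩⟩⟩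

theorem hasDimension_one_attractingSet (hd : d ≠ 0) (hρ : 0 < ρ) (hρ' : ρ ≤ 1 / 3)
    (hU : IsTrappingRegion (T.f hd ε) (regionU ρ)) :
    HasDimension (attractingSet (T.f hd ε) (regionU ρ)) 1 := by
  refine ⟨one_le_two, T.supportsCurrent_one_attractingSet hd ε hρ hU, fun l hl hl2 => ?_⟩
  obtain rfl : l = 2 := by lia
  exact not_supportsCurrent_two hρ' (attractingSet_subset _ _)

theorem isOfSmallTopologicalDegreeOn_iterate_three (hd : 2 ≤ d) {hd₀ : d ≠ 0} (hρ : 0 < ρ)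
    (hρ' : ρ ≤ 1 / 3) (hU : IsTrappingRegion (T.f hd₀ ε) (regionU ρ))
    (hfibre : ∀ p, ((T.f hd₀ ε)^[3] ⁻¹' {p} ∩ T.f hd₀ ε '' regionU ρ).encard ≤ (d * d : ℕ)) :
    IsOfSmallTopologicalDegreeOn (T.f hd₀ ε)^[3] (T.f hd₀ ε '' regionU ρ) := by
  have hend : IsEndomorphism (T.f hd₀ ε) d := ⟨_, _, _, rfl⟩
  have hopen : IsOpen (T.f hd₀ ε '' regionU ρ) :=
    T.isOpen_image_f hd₀ ε (isOpen_regionU ρ) fun _ => head_ne_zero_of_mem_cone_regionU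
  refine ⟨d ^ 3, 1, hend.iterate 3,
    isTrappingRegion_iterate_image (T.continuous_f hd₀ ε) hU hopen 2, ?_, fun p _ => ?_⟩
  · rw [hU.attractingSet_iterate_image 2]
    exact T.hasDimension_one_attractingSet hd₀ hρ hρ' hU
  · refine (hfibre p).trans_lt (Nat.cast_lt.2 ?_)
    calc d * d
      _ = d ^ 2 := (sq d).symm
      _ < d ^ 3 := Nat.pow_lt_pow_right hd (by norm_num)
      _ = (d ^ 3) ^ 1 := (pow_one _).symm

end HomTriple

end SmallDegree

end

theorem mainTheorem7 (d : ℕ) (hd : 2 ≤ d) (T : SmallDegree.HomTriple d)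
    (hXY : Disjoint T.X T.Y)
    (hZ : T.fInf^[2] ⁻¹' T.Z ∩ T.fInf ⁻¹' T.Z ∩ T.Z = ∅) :
    ∃ ε₀ : ℝ, 0 < ε₀ ∧ ∀ ε : ℂ, 0 < ‖ε‖ → ‖ε‖ < ε₀ →
      ∃ ρ : ℝ, 0 < ρ ∧
        SmallDegree.IsTrappingRegion (T.f (by omega) ε) (SmallDegree.regionU ρ) ∧
        SmallDegree.IsOfSmallTopologicalDegreeOn (T.f (by omega) ε)^[3]
          (T.f (by omega) ε '' SmallDegree.regionU ρ) := by
  have hd₀ : d ≠ 0 := by lia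
  obtain ⟨c, hc, hG⟩ := SmallDegree.exists_pos_forall_le_norm_map_of_homogeneous hd₀
    T.continuous_liftInf T.liftInf_smul fun _ => T.eq_zero_of_liftInf_eq_zero
  obtain ⟨C, hC, hR⟩ := SmallDegree.exists_pos_forall_norm_map_le_of_homogeneous hd₀
    T.continuous_evalR T.evalR_smul
  obtain ⟨η, hη, hnear⟩ := T.exists_pos_forall_not_near hd₀ hXY hZ
  obtain ⟨ε₀, hε₀, hradius⟩ := mem_nhdsGT_iff_exists_Ioo_subset.1
    (SmallDegree.eventually_exists_radius hd hc hC hη)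
  refine ⟨ε₀, hε₀, fun ε hε hlt => ?_⟩
  obtain ⟨ρ, hρ, hρ', hsmall, hκ⟩ := hradius ⟨hε, hlt⟩
  have hU : SmallDegree.IsTrappingRegion (T.f hd₀ ε) (SmallDegree.regionU ρ) :=
    T.isTrappingRegion_regionU hd₀ hρ (T.image_f_regionU_subset hd₀ hρ.le hG hR hsmall)
  exact ⟨ρ, hρ, hU, T.isOfSmallTopologicalDegreeOn_iterate_three hd hρ hρ' hU
    (T.encard_f_iterate_three_fibre_le hd₀ hc (norm_pos_iff.1 hε) hG hU.image_subset hκ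
      (fun b hb => (hnear b hb).1) fun b hb => (hnear b hb).2)⟩
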